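/- **Model.** Space is $\mathbb{R}^d$; a spacetime point is a pair $(L,t)\in\mathbb{R}^d\times\mathbb{R}$. A party has a position at every time, a memory of qubits (initially $|0\rangle$), and for each value $\lambda$ of the security parameter a finite list of operations carried out at prescribed times. At the point $x$ where it then is, a party can apply quantum channels to and measure its memory together with the directional signals passing through $x$ (signals are qubits that travel along straight lines at unit speed; this covers reception and emission), broadcast measured bits from $x$, and read the bits of broadcasts whose future light cone contains $x$ at a strictly later time. The verifiers, and likewise a coalition of provers, may share a state prepared beforehand. A coalition is finite and nonempty, its operations are arbitrary (computationally unbounded), and it *occupies* $\alpha=(L,t)$ if one of its members is at $L$ at time $t$. "Quantum polynomial time" (QPT) means: given by a family of circuits, of size polynomial in $\lambda$, of one- and two-qubit channels, measurements and bit copies. Two families of states are computationally indistinguishable if every QPT distinguisher has negligible advantage. Honest parties, simulators and distinguishers are QPT. **Position verification.** A protocol $(P,V,R)$ has verifiers $V$, a region $R$, and for each $\alpha\in R$ an honest prover $P_\alpha$, a single party that occupies $\alpha$; at the end the verifiers jointly compute from their memories whether they accept. It has completeness (error) $c$ if $V$ accepts $P_\alpha$ with probability at least $1-c(\lambda)$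 for all $\alpha\in R$ and all $\lambda$, and position security $s$ against a class $\mathscr{C}$ of coalitions if for every $P^*\in\mathscr{C}$ that occupies no point of $R$ and all $\lambda$, $V$ accepts $P^*$ with probability at most $s(\lambda)$. It is singleton if $|R|=1$. **Position commitments.** A scheme $\mathcal{C}=(P,V,S)$ has verifiers $V$, a finite set $S$ of committable points, and for each $\alpha\in S$ an honest prover $P_\alpha$, a single party that occupies $\alpha$. The Commit phase takes place in a time window $[t_{\rm init},t_{\rm final}]$ that contains the times of all points of $S$; at $t_{\rm final}$ the verifiers measure a designated classical part of their memories, and their joint memory is then the commitment state $\rho$. Later, in the Reveal phase for a claimed $\alpha\in S$, the verifiers interact with a prover and jointly accept or reject. * *Completeness (error) $c$:* for all $\alpha\in S$ and all $\lambda$, Commit followed by Reveal for $\alpha$, both with $P_\alpha$, accepts with probability at least $1-c(\lambda)$. * *Statistical position binding $s$ against $\mathscr{C}$:* for all $P^*\in\mathscr{C}$ and all $\lambda$, with probability at least $1-s(\lambda)$ over $\rho\leftarrow\mathrm{Commit}_{P^*\leftrightarrows V}(1^\lambda)$ (that is, over the measurement outcome of the classical part, $\rho$ being the state given this outcome) there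 is a spacetime point $\alpha_\rho$ occupied by $P^*$ such that for every $\alpha'\in S$ with $\alpha'\neq\alpha_\rho$ and every unbounded $A$ (any coalition, anywhere, that starts afresh), Reveal on $\rho$ for $\alpha'$ with $A$ accepts with probability $0$. Signals that are already under way when Reveal starts are chosen by $A$. * *Computational honest-verifier hiding:* there is a QPT simulator $\mathrm{Sim}$ such that for all $\alpha\in S$ and all $\tau\in[t_{\rm init},t_{\rm final}]$, the families $\mathrm{Sim}(1^\lambda,\tau)$ and (joint memory state of the verifiers at time $\tau$ in Commit with $P_\alpha$) are computationally indistinguishable. **Quantum bit commitments.** An interactive quantum bit commitment scheme is a two-party protocol (no time, no positions) in which a sender commits to a bit $b$ in a Commit phase, at the end of which the receiver measures a designated classical part of its memory; its memory is then the state $\rho$. In a Reveal phase for a claimed bit the receiver accepts or rejects. Honest sender and receiver are QPT. It has completeness (error) $c$ if an honest sender is accepted with probability at least $1-c(\lambda)$ for both bits and all $\lambda$. It is $s$-statistically binding if for every $\lambda$ and every unbounded sender, with probability at least $1-s(\lambda)$ over $\rho$ there is a bit $b_\rho$ such that for the other bit $b'\ne b_\rho$ and every unbounded $A$ that starts afresh,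 Reveal on $\rho$ for $b'$ with $A$ accepts with probability $0$. It is computationally hiding against semi-honest receivers if the receiver's states at the end of an honest Commit phase for $0$ and for $1$ are computationally indistinguishable. **Proposition.** Let $\mathcal{C}=(P,V,S)$ be a position commitment scheme with completeness $c(\lambda)$, statistical position binding $s(\lambda)$ against a class $\mathscr{C}$ of coalitions, and computational honest-verifier hiding. Then the following hold. 1. For every $\alpha\in S$ there is a singleton position verification protocol $(P',V',\{\alpha\})$ with completeness $c(\lambda)$ and position security $s(\lambda)$ against $\mathscr{C}$. 2. Suppose that $\mathscr{C}$ has no computational limits, that is, with a coalition it contains every coalition that has the same positions and the same preparation of the state shared beforehand, whatever operations it carries out. Suppose further that there are distinct $\alpha_0,\alpha_1\in S$ whose honest provers have the same position at all times (for example $\alpha_b=(L,t_b)$ with provers staying at $L$), and that $\mathscr{C}$ contains some single-prover coalition with these positions. Then there is an interactive quantum bit commitment scheme with completeness $c(\lambda)$, $s(\lambda)$-statistical binding, and computational hiding against semi-honest receivers. -/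

import Mathlib

open scoped Matrix BigOperators

/-! ## Quantum states and operations on a pool of qubits

A pool of qubits ("wires") is a type `W`; all but finitely many of them are always in state `|0⟩`.
A computational basis state is a configuration `W → Bool`. A state is a finitely supported
density operator, stored as its coefficients in front of the matrix units `|c⟩⟨c'|`. -/

abbrev Conf (W : Type) := W → Bool

abbrev Dens (W : Type) := (Conf W × Conf W) →₀ ℂ

/-- A quantum channel on `n` qubits, given by Kraus operators. -/
structure QChannel (n : ℕ) where
  rank : ℕ
  kraus : Fin rank → Matrix (Fin n → Bool) (Fin n → Bool) ℂ
  trace_preserving : ∑ k, (kraus k)ᴴ * kraus k = 1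

/-- The operations a party can carry out. `copy a b` measures qubit `a` in the computational basis
and adds the outcome (mod 2) to qubit `b`. -/
inductive QOp (W : Type) where
  | channel {n : ℕ} (w : Fin n ↪ W) (Φ : QChannel n) : QOp W
  | measure (q : W) : QOp W
  | copy (a b : W) : QOp W

namespace QOp

/-- All qubits touched by the operation satisfy `A`. -/
def ActsOn {W : Type} (A : W → Prop) : QOp W → Prop
  | channel w _ => ∀ i, A (w i)
  | measure q => A q
  | copy a b => A a ∧ A b

/-- Elementary steps: arbitrary quantum channels on at most two qubits, measurement and copying of
one bit. Circuit size is the number of elementary steps. -/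
def Elementary {W : Type} : QOp W → Prop
  | channel (n := n) _ _ => n ≤ 2
  | measure _ => True
  | copy _ _ => True

open Classical in
/-- The image of the matrix unit `|c⟩⟨c'|`. -/
noncomputable def onUnit {W : Type} (o : QOp W) (c c' : Conf W) : Dens W :=
  match o with
  | channel w Φ => ∑ k, ∑ x, ∑ y,
      Finsupp.single (Function.extend w x c, Function.extend w y c')
        (Φ.kraus k x (c ∘ w) * star (Φ.kraus k y (c' ∘ w)))
  | measure q => if c q = c' q then Finsupp.single (c, c') 1 else 0
  | copy a b =>
      if c a = c' a then
        Finsupp.single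
          (Function.update c b (xor (c b) (c a)), Function.update c' b (xor (c' b) (c' a))) 1
      else 0

noncomputable def apply {W : Type} (o : QOp W) : Dens W →ₗ[ℂ] Dens W :=
  Finsupp.linearCombination ℂ fun cc => o.onUnit cc.1 cc.2

end QOp

namespace Dens

variable {W W' : Type}

/-- All qubits are in state `|0⟩`. -/
noncomputable def vacuum : Dens W := Finsupp.single (fun _ => false, fun _ => false) 1

/-- Apply a list of operations, the head first. -/
noncomputable def run (l : List (QOp W)) (ρ : Dens W) : Dens W :=
  l.foldl (fun σ o => o.apply σ) ρ

open Classical in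
noncomputable def trace (ρ : Dens W) : ℂ := ρ.sum fun cc z => if cc.1 = cc.2 then z else 0

open Classical in
/-- The probability that a computational basis measurement of qubit `q` returns `1`. -/
noncomputable def probOne (q : W) (ρ : Dens W) : ℝ :=
  (ρ.sum fun cc z => if cc.1 = cc.2 ∧ cc.1 q = true then z else 0).re

open Classical in
/-- The reduced state on the qubits `f q`, `q : W'` (partial trace over all others). -/
noncomputable def restrict (f : W' → W) : Dens W →ₗ[ℂ] Dens W' :=
  Finsupp.linearCombination ℂ fun cc =>
    if ∀ q, q ∉ Set.range f → cc.1 q = cc.2 q then Finsupp.single (cc.1 ∘ f, cc.2 ∘ f) 1 else 0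

/-- Put a state on the qubits `f q`, `q : W'`; all other qubits are in state `|0⟩`. -/
noncomputable def extend (f : W' → W) : Dens W' →ₗ[ℂ] Dens W :=
  Finsupp.linearCombination ℂ fun cc =>
    Finsupp.single
      (Function.extend f cc.1 (fun _ => false), Function.extend f cc.2 (fun _ => false)) 1

open Classical in
/-- Projection onto the outcome "exactly the qubits in `z` are `1`" of a measurement of the qubits
in `K`. -/
noncomputable def project (K z : Finset W) : Dens W →ₗ[ℂ] Dens W :=
  Finsupp.linearCombination ℂ fun cc =>
    if (∀ q ∈ K, (cc.1 q = true ↔ q ∈ z)) ∧ (∀ q ∈ K, (cc.2 q = true ↔ q ∈ z)) then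
      Finsupp.single cc 1 else 0

open Classical in
/-- Measure the qubits in `K`. This is the probability that the (normalized) state after the
measurement has the property `Good`. -/
noncomputable def probGood (K : Finset W) (ρ : Dens W) (Good : Dens W → Prop) : ℝ :=
  ∑ z ∈ K.powerset with Good ((trace (project K z ρ))⁻¹ • project K z ρ),
    (trace (project K z ρ)).re

end Dens

/-! ## Polynomial size circuits and computational indistinguishability -/

/-- A function of the security parameter that is bounded by a polynomial. -/
def PolyBounded (f : ℕ → ℕ) : Prop := ∃ p : Polynomial ℕ, ∀ n, f n ≤ p.eval n

/-- Quantum polynomial time: a family of elementary circuits of polynomial size. -/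
def IsQPT {W : Type} (D : ℕ → List (QOp W)) : Prop :=
  PolyBounded (fun n => (D n).length) ∧ ∀ n, ∀ o ∈ D n, o.Elementary

/-- A distinguisher acts on the given qubits and on work qubits `Sum.inr j` that start in `|0⟩`;
its output bit is the work qubit `Sum.inr 0`. -/
noncomputable def distinguisherProb {ι : Type} (D : List (QOp (ι ⊕ ℕ))) (ρ : Dens ι) : ℝ :=
  Dens.probOne (Sum.inr 0) (Dens.run D (Dens.extend Sum.inl ρ))

def CompIndist {ι : Type} (X Y : ℕ → Dens ι) : Prop :=
  ∀ D : ℕ → List (QOp (ι ⊕ ℕ)), IsQPT D →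
    Asymptotics.SuperpolynomialDecay Filter.atTop (fun n : ℕ => (n : ℝ))
      (fun n => |distinguisherProb (D n) (X n) - distinguisherProb (D n) (Y n)|)

/-! ## Spacetime, signals and parties -/

abbrev Space (d : ℕ) := EuclideanSpace ℝ (Fin d)

/-- A spacetime point `(L, t)`. -/
abbrev SpacetimePoint (d : ℕ) := Space d × ℝ

inductive Side where
  | verifier
  | prover

/-- The qubits of a world of dimension `d`:
* `mem s i j`: the `j`-th memory qubit of the `i`-th party on side `s`;
* `ray b u e`: the `e`-th qubit of the signal travelling at unit speed along the trajectory
  `t ↦ b + t • u`, `u` a unit vector (state `|0⟩` when nothing has been sent);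
* `bcast x e`: the `e`-th bit of the broadcast emitted at the spacetime point `x`. -/
inductive Wire (d : ℕ) where
  | mem (s : Side) (i j : ℕ)
  | ray (b u : Space d) (e : ℕ)
  | bcast (x : SpacetimePoint d) (e : ℕ)

/-- The qubits that party `i` of side `s` has in its hands when it is at the spacetime point `x`:
its memory and the directional signals passing through `x`. Acting on the latter covers reception
as well as emission. -/
def Wire.AccessibleAt {d : ℕ} (s : Side) (i : ℕ) (x : SpacetimePoint d) : Wire d → Prop
  | mem s' i' _ => s' = s ∧ i' = i
  | ray b u _ => ‖u‖ = 1 ∧ x.1 = b + x.2 • u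
  | bcast _ _ => False

/-- `y` lies on the future light cone of `x`, strictly later than `x`. -/
def ArrivesAt {d : ℕ} (x y : SpacetimePoint d) : Prop :=
  x.2 < y.2 ∧ dist x.1 y.1 = y.2 - x.2

/-- The operation `o` can be carried out by party `i` of side `s` at the spacetime point `x`: it
acts on accessible qubits, or it broadcasts a (measured) bit from `x`, or it reads a bit of a
broadcast that arrives at `x`. -/
def QOp.LocalAt {d : ℕ} (s : Side) (i : ℕ) (x : SpacetimePoint d) (o : QOp (Wire d)) : Prop :=
  o.ActsOn (Wire.AccessibleAt s i x) ∨
  (∃ a e, o = QOp.copy a (Wire.bcast x e) ∧ Wire.AccessibleAt s i x a) ∨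
  (∃ y e b, o = QOp.copy (Wire.bcast y e) b ∧ ArrivesAt y x ∧ Wire.AccessibleAt s i x b)

/-- Party `who` carries out `op` at time `time`. -/
structure PartyEvent (d : ℕ) where
  who : ℕ
  time : ℝ
  op : QOp (Wire d)

/-- The joint memory of the first `k` parties of side `s`. -/
def Wire.InMemory {d : ℕ} (s : Side) (k : ℕ) (w : Wire d) : Prop :=
  ∃ i j, i < k ∧ w = Wire.mem s i j

/-- `l` is a chronological list of operations, each one carried out by one of `k` parties of side
`s`, moving as prescribed by `loc`, at its position at that time. -/
structure IsProgram {d : ℕ} (s : Side) (k : ℕ) (loc : ℕ → ℝ → Space d)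
    (l : List (PartyEvent d)) : Prop where
  sorted : l.Pairwise fun a b => a.time ≤ b.time
  located : ∀ e ∈ l, e.who < k ∧ e.op.LocalAt s e.who (loc e.who e.time, e.time)

/-- A finite nonempty set of parties on side `s`, with their positions at all times. For each value
of the security parameter, `prep` prepares the state that they share beforehand, and `events` are
their operations. -/
structure Team (d : ℕ) (s : Side) where
  size : ℕ
  size_pos : 0 < size
  loc : ℕ → ℝ → Space d
  prep : ℕ → List (QOp (Wire d))
  prep_mem : ∀ n, ∀ o ∈ prep n, o.ActsOn (Wire.InMemory s size)
  events : ℕ → List (PartyEvent d)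
  isProgram : ∀ n, IsProgram s size loc (events n)

/-- A coalition of provers. -/
abbrev Coalition (d : ℕ) := Team d Side.prover

namespace Team

variable {d : ℕ} {s : Side}

def Occupies (T : Team d s) (α : SpacetimePoint d) : Prop :=
  ∃ i, i < T.size ∧ T.loc i α.2 = α.1

def Efficient (T : Team d s) : Prop :=
  IsQPT T.prep ∧ IsQPT fun n => (T.events n).map PartyEvent.op

/-- A single party on the given worldline. -/
def IsLone (T : Team d s) (track : ℝ → Space d) : Prop :=
  T.size = 1 ∧ T.loc 0 = track

end Team

open Classical in
/-- Verifier events `l` and prover events `l'`, merged chronologically (at equal times, verifiers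
first). -/
noncomputable def interact {d : ℕ} (l l' : List (PartyEvent d)) : List (QOp (Wire d)) :=
  (List.merge l l' fun a b => decide (a.time ≤ b.time)).map PartyEvent.op

open Classical in
noncomputable def eventsUntil {d : ℕ} (τ : ℝ) (l : List (PartyEvent d)) : List (PartyEvent d) :=
  l.filter fun e => decide (e.time ≤ τ)

/-- The global state at time `τ` when verifiers `V` and provers `P` interact. -/
noncomputable def stateAt {d : ℕ} (V : Team d Side.verifier) (P : Coalition d) (n : ℕ) (τ : ℝ) :
    Dens (Wire d) :=
  Dens.run (interact (eventsUntil τ (V.events n)) (eventsUntil τ (P.events n)))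
    (Dens.run (P.prep n) (Dens.run (V.prep n) Dens.vacuum))

/-- The `j`-th memory qubit of verifier `i`. -/
def verifierMem (d : ℕ) (q : ℕ × ℕ) : Wire d := Wire.mem Side.verifier q.1 q.2

/-- The view of the verifiers at time `τ`: their joint internal state. -/
noncomputable def viewAt {d : ℕ} (V : Team d Side.verifier) (P : Coalition d) (n : ℕ) (τ : ℝ) :
    Dens (ℕ × ℕ) :=
  Dens.restrict (verifierMem d) (stateAt V P n τ)

/-- The qubit that holds the decision of the verifiers. -/
def acceptWire (d : ℕ) : Wire d := verifierMem d (0, 0)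

/-! ## Position verification -/

/-- Verifiers, a region of allowable prover points, and an honest prover for each point of the
region. After their last event the verifiers jointly compute the verdict from their memories. -/
structure PositionVerification (d : ℕ) where
  verifiers : Team d Side.verifier
  verdict : ℕ → List (QOp (Wire d))
  verdict_mem : ∀ n, ∀ o ∈ verdict n, o.ActsOn (Wire.InMemory Side.verifier verifiers.size)
  region : Set (SpacetimePoint d)
  track : SpacetimePoint d → ℝ → Space d
  prover : SpacetimePoint d → Coalition d
  prover_lone : ∀ α ∈ region, (prover α).IsLone (track α)
  prover_at : ∀ α ∈ region, track α α.2 = α.1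
  verifiers_efficient : verifiers.Efficient
  verdict_efficient : IsQPT verdict
  prover_efficient : ∀ α ∈ region, (prover α).Efficient

namespace PositionVerification

variable {d : ℕ}

/-- The probability that the verifiers accept in the interaction with `P`. -/
noncomputable def acceptProb (Q : PositionVerification d) (P : Coalition d) (n : ℕ) : ℝ :=
  Dens.probOne (acceptWire d) (Dens.run (Q.verdict n)
    (Dens.run (interact (Q.verifiers.events n) (P.events n))
      (Dens.run (P.prep n) (Dens.run (Q.verifiers.prep n) Dens.vacuum))))

def HasCompletenessError (Q : PositionVerification d) (c : ℕ → ℝ) : Prop :=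
  ∀ α ∈ Q.region, ∀ n, 1 - c n ≤ Q.acceptProb (Q.prover α) n

def HasPositionSecurity (Q : PositionVerification d) (𝒞 : Set (Coalition d)) (s : ℕ → ℝ) : Prop :=
  ∀ P ∈ 𝒞, (∀ α ∈ Q.region, ¬ P.Occupies α) → ∀ n, Q.acceptProb P n ≤ s n

end PositionVerification

/-! ## Position commitments -/

/-- The syntax of a position commitment scheme. In the Commit phase the verifiers carry out the
events of `verifiers`, during `[tInit, tFinal]`; at time `tFinal` they measure the qubits
`classical` of their memories, which makes up the classical part of the commitment state. The
events `reveal α` and the joint computation `verdict α` are what they do in the Reveal phase for the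
claimed point `α`. The events of the honest provers up to time `tFinal` belong to the Commit phase,
the later ones to the Reveal phase. -/
structure PositionCommitment (d : ℕ) where
  points : Finset (SpacetimePoint d)
  tInit : ℝ
  tFinal : ℝ
  tInit_le_tFinal : tInit ≤ tFinal
  points_window : ∀ α ∈ points, tInit ≤ α.2 ∧ α.2 ≤ tFinal
  verifiers : Team d Side.verifier
  commit_window : ∀ n, ∀ e ∈ verifiers.events n, tInit ≤ e.time ∧ e.time ≤ tFinal
  classical : ℕ → Finset (ℕ × ℕ)
  classical_mem : ∀ n, ∀ q ∈ classical n, q.1 < verifiers.size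
  reveal : SpacetimePoint d → ℕ → List (PartyEvent d)
  reveal_isProgram : ∀ α n, IsProgram Side.verifier verifiers.size verifiers.loc (reveal α n)
  reveal_window : ∀ α n, ∀ e ∈ reveal α n, tFinal < e.time
  verdict : SpacetimePoint d → ℕ → List (QOp (Wire d))
  verdict_mem : ∀ α n, ∀ o ∈ verdict α n,
    o.ActsOn (Wire.InMemory Side.verifier verifiers.size)
  track : SpacetimePoint d → ℝ → Space d
  prover : SpacetimePoint d → Coalition d
  prover_lone : ∀ α ∈ points, (prover α).IsLone (track α)
  prover_at : ∀ α ∈ points, track α α.2 = α.1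
  verifiers_efficient : verifiers.Efficient
  classical_efficient : PolyBounded fun n => (classical n).card
  reveal_efficient : ∀ α ∈ points, IsQPT fun n => (reveal α n).map PartyEvent.op
  verdict_efficient : ∀ α ∈ points, IsQPT (verdict α)
  prover_efficient : ∀ α ∈ points, (prover α).Efficient

namespace PositionCommitment

variable {d : ℕ}

/-- The measurement of the classical part of the commitment state. -/
noncomputable def outputEvents (C : PositionCommitment d) (n : ℕ) : List (PartyEvent d) :=
  (C.classical n).toList.map fun q => ⟨q.1, C.tFinal, QOp.measure (verifierMem d q)⟩

theorem commit_isProgram (C : PositionCommitment d) (n : ℕ) :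
    IsProgram Side.verifier C.verifiers.size C.verifiers.loc
      (C.verifiers.events n ++ C.outputEvents n) where
  sorted := by
    refine List.pairwise_append.2 ⟨(C.verifiers.isProgram n).sorted, ?_, ?_⟩
    · exact List.pairwise_map.2 (List.pairwise_of_forall fun _ _ => le_rfl)
    · intro a ha b hb
      obtain ⟨q, -, rfl⟩ := List.mem_map.1 hb
      exact (C.commit_window n a ha).2
  located := by
    intro e he
    rcases List.mem_append.1 he with he | he
    · exact (C.verifiers.isProgram n).located e he
    · obtain ⟨q, hq, rfl⟩ := List.mem_map.1 he
      exact ⟨C.classical_mem n q (Finset.mem_toList.1 hq), Or.inl ⟨rfl, rfl⟩⟩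

/-- The verifiers in the Commit phase. -/
noncomputable def commit (C : PositionCommitment d) : Team d Side.verifier where
  size := C.verifiers.size
  size_pos := C.verifiers.size_pos
  loc := C.verifiers.loc
  prep := C.verifiers.prep
  prep_mem := C.verifiers.prep_mem
  events n := C.verifiers.events n ++ C.outputEvents n
  isProgram := C.commit_isProgram

/-- The probability that the verifiers accept `α` when the Reveal phase follows the Commit phase,
both with the prover `P`. -/
noncomputable def acceptProb (C : PositionCommitment d) (α : SpacetimePoint d) (P : Coalition d)
    (n : ℕ) : ℝ :=
  Dens.probOne (acceptWire d) (Dens.run (C.verdict α n)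
    (Dens.run (interact (C.commit.events n ++ C.reveal α n) (P.events n))
      (Dens.run (P.prep n) (Dens.run (C.commit.prep n) Dens.vacuum))))

/-- The probability that the Reveal phase for `α` accepts, when the verifiers hold the commitment
state `ρ` and interact with `A`, which starts from scratch. The events of `A` may have any time;
those up to `tFinal` determine the signals of `A` that are under way when the phase starts. -/
noncomputable def revealProb (C : PositionCommitment d) (α : SpacetimePoint d) (A : Coalition d)
    (n : ℕ) (ρ : Dens (ℕ × ℕ)) : ℝ :=
  Dens.probOne (acceptWire d) (Dens.run (C.verdict α n)
    (Dens.run (interact (C.reveal α n) (A.events n))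
      (Dens.run (A.prep n) (Dens.extend (verifierMem d) ρ))))

def HasCompletenessError (C : PositionCommitment d) (c : ℕ → ℝ) : Prop :=
  ∀ n, ∀ α ∈ C.points, 1 - c n ≤ C.acceptProb α (C.prover α) n

/-- The commitment state `ρ` binds `P` to one spacetime point, which `P` has occupied. -/
def Binds (C : PositionCommitment d) (P : Coalition d) (n : ℕ) (ρ : Dens (ℕ × ℕ)) : Prop :=
  ∃ β : SpacetimePoint d, P.Occupies β ∧
    ∀ α' ∈ C.points, α' ≠ β → ∀ A : Coalition d, C.revealProb α' A n ρ = 0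

/-- Statistical position binding. -/
def HasPositionBinding (C : PositionCommitment d) (𝒞 : Set (Coalition d)) (s : ℕ → ℝ) : Prop :=
  ∀ P ∈ 𝒞, ∀ n, 1 - s n ≤
    Dens.probGood (C.classical n) (viewAt C.commit P n C.tFinal) (C.Binds P n)

/-- The output of the simulator circuit `M`, whose work qubits are the `Sum.inr j`. -/
noncomputable def simOutput (M : List (QOp ((ℕ × ℕ) ⊕ ℕ))) : Dens (ℕ × ℕ) :=
  Dens.restrict Sum.inl (Dens.run M Dens.vacuum)

/-- Computational honest-verifier hiding. -/
def IsHiding (C : PositionCommitment d) : Prop :=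
  ∃ Sim : ℕ → ℝ → List (QOp ((ℕ × ℕ) ⊕ ℕ)),
    (∃ p : Polynomial ℕ, ∀ n τ, (Sim n τ).length ≤ p.eval n ∧ ∀ o ∈ Sim n τ, o.Elementary) ∧
    ∀ α ∈ C.points, ∀ τ, C.tInit ≤ τ → τ ≤ C.tFinal →
      CompIndist (fun n => simOutput (Sim n τ)) (fun n => viewAt C.commit (C.prover α) n τ)

end PositionCommitment

/-- The class `𝒞` does not limit the computations of its members: with a coalition it contains every
coalition that has the same positions and starts from the same shared state. -/
def NoComputationalLimits {d : ℕ} (𝒞 : Set (Coalition d)) : Prop :=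
  ∀ P ∈ 𝒞, ∀ P' : Coalition d, P'.size = P.size → (∀ i, i < P.size → P'.loc i = P.loc i) →
    P'.prep = P.prep → P' ∈ 𝒞

/-! ## Interactive quantum bit commitments -/

/-- The qubits of a two-party protocol; the message register is handed back and forth. -/
inductive CommWire where
  | receiver (j : ℕ)
  | sender (j : ℕ)
  | message (j : ℕ)

def CommWire.ReceiverSide : CommWire → Prop
  | receiver _ => True
  | sender _ => False
  | message _ => True

def CommWire.SenderSide : CommWire → Prop
  | receiver _ => False
  | sender _ => True
  | message _ => True

/-- A strategy of the sender: its operations in each round. -/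
structure SenderStrategy where
  move : ℕ → List (QOp CommWire)
  move_local : ∀ r, ∀ o ∈ move r, o.ActsOn CommWire.SenderSide

/-- In each round the sender moves first, then the receiver. -/
def playRounds (S : SenderStrategy) (R : List (List (QOp CommWire))) : List (QOp CommWire) :=
  R.zipIdx.flatMap fun mr => S.move mr.2 ++ mr.1

/-- The syntax of an interactive quantum bit commitment scheme. `commitR` and `revealR b` list the
receiver's moves in the rounds of the two phases, `b` being the bit that is claimed; `senderC b`
and `senderR b` are the honest sender's moves. At the end of the Commit phase the receiver measures
its qubits `classical`; its decision at the end of the Reveal phase is its qubit `0`. -/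
structure QuantumBitCommitment where
  commitR : ℕ → List (List (QOp CommWire))
  commitR_local : ∀ n, ∀ m ∈ commitR n, ∀ o ∈ m, o.ActsOn CommWire.ReceiverSide
  classical : ℕ → Finset ℕ
  revealR : Bool → ℕ → List (List (QOp CommWire))
  revealR_local : ∀ b n, ∀ m ∈ revealR b n, ∀ o ∈ m, o.ActsOn CommWire.ReceiverSide
  senderC : Bool → ℕ → SenderStrategy
  senderR : Bool → ℕ → SenderStrategy
  classical_efficient : PolyBounded fun n => (classical n).card
  commit_rounds : PolyBounded fun n => (commitR n).length
  reveal_rounds : ∀ b, PolyBounded fun n => (revealR b n).length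
  commit_efficient : ∀ b, IsQPT fun n => playRounds (senderC b n) (commitR n)
  reveal_efficient : ∀ b, IsQPT fun n => playRounds (senderR b n) (revealR b n)

namespace QuantumBitCommitment

/-- The global state at the end of the Commit phase with the sender `S`. -/
noncomputable def commitState (B : QuantumBitCommitment) (S : SenderStrategy) (n : ℕ) :
    Dens CommWire :=
  Dens.run ((B.classical n).toList.map fun j => QOp.measure (CommWire.receiver j))
    (Dens.run (playRounds S (B.commitR n)) Dens.vacuum)

/-- The state of the receiver at the end of the Commit phase with the sender `S`. -/
noncomputable def commitView (B : QuantumBitCommitment) (S : SenderStrategy) (n : ℕ) : Dens ℕ :=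
  Dens.restrict CommWire.receiver (B.commitState S n)

/-- The probability that the Reveal phase for the bit `b` with the sender `A` accepts, starting from
the global state `σ`. -/
noncomputable def revealProb (B : QuantumBitCommitment) (b : Bool) (A : SenderStrategy) (n : ℕ)
    (σ : Dens CommWire) : ℝ :=
  Dens.probOne (CommWire.receiver 0) (Dens.run (playRounds A (B.revealR b n)) σ)

def HasCompletenessError (B : QuantumBitCommitment) (c : ℕ → ℝ) : Prop :=
  ∀ n b, 1 - c n ≤ B.revealProb b (B.senderR b n) n (B.commitState (B.senderC b n) n)

/-- The receiver's state `ρ` after the Commit phase can be opened to at most one bit. -/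
def Binds (B : QuantumBitCommitment) (n : ℕ) (ρ : Dens ℕ) : Prop :=
  ∃ b : Bool, ∀ b', b' ≠ b → ∀ A : SenderStrategy,
    B.revealProb b' A n (Dens.extend CommWire.receiver ρ) = 0

/-- Statistical binding, against unbounded senders. -/
def HasStatisticalBinding (B : QuantumBitCommitment) (s : ℕ → ℝ) : Prop :=
  ∀ n, ∀ S : SenderStrategy,
    1 - s n ≤ Dens.probGood (B.classical n) (B.commitView S n) (B.Binds n)

/-- Computational hiding against semi-honest receivers: the states of the receiver after an honest
Commit phase for `0` and for `1` are computationally indistinguishable. -/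
def IsHiding (B : QuantumBitCommitment) : Prop :=
  CompIndist (fun n => B.commitView (B.senderC false n) n)
    (fun n => B.commitView (B.senderC true n) n)

end QuantumBitCommitment

/-! # Position commitments give position verification and bit commitments -/

/-! ## Functions of configurations -/

/-! First claim. The verifiers run Commit and immediately afterwards Reveal for α. A coalition that
avoids α is, except with probability `s`, bound to a point that it occupies, hence to a point other
than α, and then no coalition that starts afresh can open α. The cheating coalition does not start
afresh, however: its memory and the signals under way may be entangled with the commitment state.

Positivity closes this gap. Acceptance in Reveal is a positive linear functional F of the global
state. With one extra stationary helper per qubit, a fresh coalition can produce every basis state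
with finitely many ones on the qubits that Commit can have reached outside the verifiers' memories
(`exists_coalition`), so F vanishes on the product of the commitment state with each of these.
Decompose a pure global state v into components v_e with configuration e outside the verifiers'
memories. The operator |v_e⟩⟨v_e| is one of the positive summands of the product with e, so F
vanishes on it; and the vectors on which F vanishes are closed under addition, because |u+v⟩⟨u+v| +
|u-v⟩⟨u-v| = 2|u⟩⟨u| + 2|v⟩⟨v| (`Dens.eq_zero_of_plant`). Hence F vanishes on v
(`PositionCommitment.accept_eq_zero`). That binding asks for acceptance probability exactly 0 is
essential here. Summing over the outcomes of the classical part gives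
`PositionCommitment.acceptProb_le`.

Second claim. The receiver simulates the verifiers and the medium between them: it stores the
verifiers' memories and every signal and broadcast that an honest execution can use. The sender
plays the prover. Not knowing the bit, the receiver offers rounds for the events of both honest
provers in chronological order; this is possible because both follow one worldline. An event takes
three rounds: the accessible signals are swapped into the message register, at most one broadcast
bit is relayed, and the signals are swapped back. A sender of the other bit stays idle and clears
the relayed bit, which disturbs nothing because broadcasts are classical (`Interface.run_idle`).

One identity (`map_cutRounds`) turns a two-party run into an interaction in spacetime, for every
sender and every placement of its qubits. For the honest sender it yields the run of the honest
prover (`Interface.run_honest`), which gives completeness. For an arbitrary sender it yields a lone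
prover on the worldline who performs the swaps and relays itself; this prover belongs to 𝒞 because 𝒞
has no computational limits. It is bound to one point, and at most one of the two bits names that
point. At the end of Commit the receiver ships the signals under way to the sender. In an honest run
it then holds the verifiers' memories and zeros, so hiding is inherited through the simulator, which
does not depend on the point. In Reveal the sender fills in those signals as it likes, as a fresh
coalition may, and what is still correlated with the verifiers' memories is handled by
`PositionCommitment.accept_eq_zero` once more. -/

theorem extend_comp_self {I W : Type} (w : I ↪ W) (c : Conf W) :
    Function.extend w (c ∘ w) c = c := by
  funext q
  by_cases h : ∃ i, w i = q
  · obtain ⟨i, rfl⟩ := h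
    rw [w.injective.extend_apply]; rfl
  · rw [Function.extend_apply' _ _ _ h]

theorem extend_comp_of_disjoint {I J W : Type} (w : I ↪ W) (f : J → W) (x : I → Bool) (c : Conf W)
    (h : ∀ i j, w i ≠ f j) : Function.extend w x c ∘ f = c ∘ f := by
  funext j
  exact Function.extend_apply' _ _ _ fun ⟨i, hi⟩ => h i j hi

theorem extend_extend_comm {I J W : Type} (w : I ↪ W) (v : J ↪ W) (x : I → Bool) (y : J → Bool)
    (c : Conf W) (h : ∀ i j, w i ≠ v j) :
    Function.extend v y (Function.extend w x c) = Function.extend w x (Function.extend v y c) := by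
  funext q
  by_cases h1 : ∃ i, w i = q
  · obtain ⟨i, rfl⟩ := h1
    rw [w.injective.extend_apply, Function.extend_apply' _ _ _ (fun ⟨j, hj⟩ => h i j hj.symm),
      w.injective.extend_apply]
  · rw [Function.extend_apply' (f := w) _ _ _ h1]
    by_cases h2 : ∃ j, v j = q
    · obtain ⟨j, rfl⟩ := h2
      rw [v.injective.extend_apply, v.injective.extend_apply]
    · rw [Function.extend_apply' (f := v) _ _ _ h2, Function.extend_apply' (f := v) _ _ _ h2,
        Function.extend_apply' (f := w) _ _ _ h1]

theorem extend_trans {I W V : Type} (w : I ↪ W) (f : W ↪ V) (x : I → Bool) (c : Conf W)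
    (c0 : Conf V) :
    Function.extend (w.trans f) x (Function.extend f c c0)
      = Function.extend f (Function.extend w x c) c0 := by
  funext q
  by_cases h1 : ∃ i, f i = q
  · obtain ⟨p, rfl⟩ := h1
    rw [f.injective.extend_apply]
    by_cases h2 : ∃ i, w i = p
    · obtain ⟨i, rfl⟩ := h2
      rw [w.injective.extend_apply]
      exact (w.trans f).injective.extend_apply _ _ i
    · rw [Function.extend_apply' (f := w) _ _ _ h2, Function.extend_apply' (f := w.trans f),
        f.injective.extend_apply]
      rintro ⟨i, hi⟩
      exact h2 ⟨i, f.injective hi⟩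
  · rw [Function.extend_apply' (f := f) _ _ _ h1, Function.extend_apply' (f := w.trans f),
      Function.extend_apply' (f := f) _ _ _ h1]
    rintro ⟨i, hi⟩
    exact h1 ⟨w i, hi⟩

/-! ## Syntax of operations -/

namespace QOp

variable {W V U : Type}

/-- The qubits that the operation touches. -/
def wires : QOp W → List W
  | channel w _ => List.ofFn w
  | measure q => [q]
  | copy a b => [a, b]

theorem actsOn_iff {A : W → Prop} {o : QOp W} : o.ActsOn A ↔ ∀ w ∈ o.wires, A w := by
  cases o <;> simp [ActsOn, wires, List.mem_ofFn]

theorem ActsOn.mono {A B : W → Prop} {o : QOp W} (h : o.ActsOn A) (hAB : ∀ w, A w → B w) :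
    o.ActsOn B := by
  rw [actsOn_iff] at *
  exact fun w hw => hAB w (h w hw)

/-- Rename the qubits. -/
def map (f : W ↪ V) : QOp W → QOp V
  | channel w Φ => channel (w.trans f) Φ
  | measure q => measure (f q)
  | copy a b => copy (f a) (f b)

theorem map_map (f : W ↪ V) (g : V ↪ U) (o : QOp W) : (o.map f).map g = o.map (f.trans g) := by
  cases o <;> rfl

theorem wires_map (f : W ↪ V) (o : QOp W) : (o.map f).wires = o.wires.map f := by
  cases o <;> simp [map, wires, List.map_ofFn]
  rfl

theorem actsOn_map {f : W ↪ V} {o : QOp W} {A : V → Prop} :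
    (o.map f).ActsOn A ↔ o.ActsOn fun w => A (f w) := by
  simp [actsOn_iff, wires_map]

theorem elementary_map {f : W ↪ V} {o : QOp W} : (o.map f).Elementary ↔ o.Elementary := by
  cases o <;> rfl

theorem Elementary.length_wires_le {o : QOp W} (h : o.Elementary) : o.wires.length ≤ 2 := by
  cases o with
  | channel w Φ => simpa [wires, Elementary] using h
  | measure q => simp [wires]
  | copy a b => simp [wires]

/-- This allows an operation of the spacetime world to be carried out on another pool of qubits that
encodes the wires it touches. -/
theorem exists_map_eq (f : W ↪ V) {o : QOp V} {A : W → Prop}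
    (h : o.ActsOn fun v => ∃ w, A w ∧ f w = v) : ∃ o' : QOp W, o'.map f = o ∧ o'.ActsOn A := by
  cases o with
  | channel w Φ =>
    choose u hA hu using h
    refine ⟨channel ⟨u, fun i j hij => w.injective ?_⟩ Φ, ?_, hA⟩
    · rw [← hu, ← hu, hij]
    · simp only [map]
      congr 1
      ext i
      exact hu i
  | measure q =>
    obtain ⟨u, hA, rfl⟩ := h
    exact ⟨measure u, rfl, hA⟩
  | copy a b =>
    obtain ⟨⟨u, hA, rfl⟩, v, hB, rfl⟩ := h
    exact ⟨copy u v, rfl, hA, hB⟩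

theorem apply_single (o : QOp W) (cc : Conf W × Conf W) (z : ℂ) :
    o.apply (Finsupp.single cc z) = z • o.onUnit cc.1 cc.2 := by
  simp [apply, Finsupp.linearCombination_single]

end QOp

/-! ## Classical channels -/

/-- Measure the label `κ` of the basis state, and replace the basis state by its image under a
function that is injective on each class of equal labels. -/
noncomputable def QChannel.ofFun {n : ℕ} (κ : (Fin n → Bool) → Bool)
    (g : (Fin n → Bool) → (Fin n → Bool)) (h : ∀ y y', κ y = κ y' → g y = g y' → y = y') :
    QChannel n where
  rank := 2
  kraus k := Matrix.of fun x y => if κ y = finTwoEquiv k ∧ x = g y then 1 else 0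
  trace_preserving := by
    ext y y'
    simp only [Matrix.sum_apply, Matrix.mul_apply, Matrix.conjTranspose_apply, Matrix.of_apply,
      Matrix.one_apply]
    have : ∀ k x, star (if κ y = finTwoEquiv k ∧ x = g y then (1 : ℂ) else 0) *
        (if κ y' = finTwoEquiv k ∧ x = g y' then 1 else 0) =
        if x = g y then (if finTwoEquiv k = κ y then
          (if κ y' = κ y ∧ g y = g y' then 1 else 0) else 0) else 0 := by
      intro k x
      split_ifs <;> simp_all
    simp_rw [this]
    simp only [Finset.sum_ite_eq', Finset.mem_univ, if_true]
    have h2 : ∀ k, (finTwoEquiv k = κ y) = (k = finTwoEquiv.symm (κ y)) := by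
      intro k; rw [Equiv.eq_symm_apply]
    simp_rw [h2]
    simp only [Finset.sum_ite_eq', Finset.mem_univ, if_true]
    refine if_congr ⟨fun e => h _ _ e.1.symm e.2, ?_⟩ rfl rfl
    rintro rfl
    exact ⟨rfl, rfl⟩

open Classical in
-- The Kraus operator with index k is the sum of |g y⟩⟨y| over the y with label k. A matrix unit
-- therefore survives for exactly one k if the two labels agree, and for none otherwise.
theorem QOp.onUnit_ofFun {W : Type} {n : ℕ} (w : Fin n ↪ W) (κ : (Fin n → Bool) → Bool)
    (g : (Fin n → Bool) → (Fin n → Bool)) (h : ∀ y y', κ y = κ y' → g y = g y' → y = y')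
    (c c' : Conf W) :
    (QOp.channel w (QChannel.ofFun κ g h)).onUnit c c' =
      if κ (c ∘ w) = κ (c' ∘ w) then
        Finsupp.single (Function.extend w (g (c ∘ w)) c, Function.extend w (g (c' ∘ w)) c') 1
      else 0 := by
  have : ∀ (k : Fin 2) (x y : Fin n → Bool),
      Finsupp.single (Function.extend w x c, Function.extend w y c')
        ((QChannel.ofFun κ g h).kraus k x (c ∘ w) * star ((QChannel.ofFun κ g h).kraus k y (c' ∘ w)))
      = if y = g (c' ∘ w) then (if x = g (c ∘ w) then (if finTwoEquiv k = κ (c ∘ w) then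
        (if κ (c ∘ w) = κ (c' ∘ w) then Finsupp.single
          (Function.extend w (g (c ∘ w)) c, Function.extend w (g (c' ∘ w)) c') (1 : ℂ) else 0)
          else 0) else 0) else 0 := by
    intro k x y
    simp only [QChannel.ofFun, Matrix.of_apply]
    by_cases h1 : x = g (c ∘ w)
    · by_cases h2 : y = g (c' ∘ w)
      · subst h1 h2
        by_cases h3 : κ (c ∘ w) = finTwoEquiv k
        · rw [h3]
          by_cases h4 : κ (c' ∘ w) = finTwoEquiv k <;> simp [h4, eq_comm]
        · simp [h3, Ne.symm h3]
      · simp [h2]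
    · simp [h1]
  simp only [onUnit]
  change ∑ k : Fin 2, _ = _
  simp_rw [this]
  simp only [Finset.sum_ite_eq', Finset.mem_univ, if_true]
  have h2 : ∀ k, (finTwoEquiv k = κ (c ∘ w)) = (k = finTwoEquiv.symm (κ (c ∘ w))) := by
    intro k; rw [Equiv.eq_symm_apply]
  simp_rw [h2]
  simp only [Finset.sum_ite_eq', Finset.mem_univ, if_true]

namespace QOp

variable {W V : Type}

theorem onUnit_ofFun_eq {n : ℕ} (w : Fin n ↪ W) (κ : (Fin n → Bool) → Bool)
    (g : (Fin n → Bool) → (Fin n → Bool)) (h : ∀ y y', κ y = κ y' → g y = g y' → y = y')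
    (c c' : Conf W) {p q : Bool} {u v : Conf W} (hp : κ (c ∘ w) = p) (hq : κ (c' ∘ w) = q)
    (hu : Function.extend w (g (c ∘ w)) c = u) (hv : Function.extend w (g (c' ∘ w)) c' = v) :
    (QOp.channel w (QChannel.ofFun κ g h)).onUnit c c' =
      if p = q then Finsupp.single (u, v) 1 else 0 := by
  subst hp hq hu hv
  rw [onUnit_ofFun]

/-- The embedding of one qubit. -/
def one (q : W) : Fin 1 ↪ W := ⟨fun _ => q, fun i j _ => Subsingleton.elim i j⟩

/-- The embedding of two different qubits. -/
def two (a b : W) (h : a ≠ b) : Fin 2 ↪ W :=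
  ⟨![a, b], fun i j hij => by
    revert hij
    fin_cases i <;> fin_cases j <;> simp [h, h.symm]⟩

theorem two_trans (a b : W) (h : a ≠ b) (f : W ↪ V) :
    (two a b h).trans f = two (f a) (f b) (f.injective.ne h) := by
  ext i
  fin_cases i <;> rfl

theorem extend_one [DecidableEq W] (q : W) (x : Fin 1 → Bool) (c : Conf W) :
    Function.extend (one q) x c = Function.update c q (x 0) := by
  funext p
  by_cases h : p = q
  · subst h
    rw [Function.update_self]
    exact (one p).injective.extend_apply _ _ 0
  · rw [Function.update_of_ne h, Function.extend_apply']
    rintro ⟨i, hi⟩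
    exact h hi.symm

theorem extend_two [DecidableEq W] (a b : W) (h : a ≠ b) (x : Fin 2 → Bool) (c : Conf W) :
    Function.extend (two a b h) x c = Function.update (Function.update c b (x 1)) a (x 0) := by
  funext p
  by_cases h1 : p = a
  · subst h1
    rw [Function.update_self]
    exact (two p b h).injective.extend_apply _ _ 0
  · rw [Function.update_of_ne h1]
    by_cases h2 : p = b
    · subst h2
      rw [Function.update_self]
      exact (two a p h).injective.extend_apply _ _ 1
    · rw [Function.update_of_ne h2, Function.extend_apply']
      rintro ⟨i, hi⟩
      fin_cases i
      · exact h1 hi.symm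
      · exact h2 hi.symm

theorem apply_congr {o o' : QOp W} (h : ∀ c c', o.onUnit c c' = o'.onUnit c c') :
    o.apply = o'.apply := by
  unfold apply
  congr 1
  funext cc
  exact h _ _

/-- Every operation acts like a channel on the qubits that it touches. -/
theorem exists_channel (o : QOp W) : ∃ (n : ℕ) (w : Fin n ↪ W) (Φ : QChannel n),
    (∀ i, w i ∈ o.wires) ∧ o.apply = (channel w Φ).apply ∧
    ∀ {V : Type} (f : W ↪ V), (o.map f).apply = (channel (w.trans f) Φ).apply := by
  classical
  cases o with
  | channel w Φ =>
    exact ⟨_, w, Φ, fun i => by simp [wires, List.mem_ofFn], rfl, fun f => rfl⟩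
  | measure q =>
    have key : ∀ {V : Type} (q : V), (measure q).apply = (channel (one q)
        (QChannel.ofFun (fun y => y 0) id (fun y y' _ h => h))).apply := by
      intro V q
      refine apply_congr fun c c' => ?_
      rw [onUnit_ofFun_eq (one q) _ id _ c c' (p := c q) (q := c' q) (u := c) (v := c') rfl rfl
        (extend_comp_self _ _) (extend_comp_self _ _)]
      simp only [onUnit]
    exact ⟨1, one q, _, fun i => List.mem_cons_self, key q, fun f => key (f q)⟩
  | copy a b =>
    -- Copying a qubit onto itself measures it and sets it to x xor x = 0. It is a reset, not a
    -- permutation of basis states, and needs a channel of its own.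
    by_cases hab : a = b
    · subst hab
      have key : ∀ {V : Type} (q : V), (copy q q).apply = (channel (one q)
          (QChannel.ofFun (fun y => y 0) (fun _ _ => false) (fun y y' h _ => by
            ext i; rwa [Subsingleton.elim i 0]))).apply := by
        intro V q
        refine apply_congr fun c c' => ?_
        rw [onUnit_ofFun_eq (one q) _ _ _ c c' (p := c q) (q := c' q)
          (u := Function.update c q (xor (c q) (c q)))
          (v := Function.update c' q (xor (c' q) (c' q))) rfl rfl
          (by rw [extend_one]; simp) (by rw [extend_one]; simp)]
        simp only [onUnit]
      exact ⟨1, one a, _, fun i => List.mem_cons_self, key a, fun f => key (f a)⟩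
    · have key : ∀ {V : Type} (a b : V) (h : a ≠ b), (copy a b).apply = (channel (two a b h)
          (QChannel.ofFun (fun y => y 0) (fun y => ![y 0, xor (y 1) (y 0)]) (fun y y' h h' => by
            have h0 := congrFun h' 0
            have h1 := congrFun h' 1
            ext i
            fin_cases i <;> simp_all))).apply := by
        intro V a b h
        have hu : ∀ c : Conf V, Function.extend (two a b h)
            ((fun y : Fin 2 → Bool => ![y 0, xor (y 1) (y 0)]) (c ∘ two a b h)) c =
            Function.update c b (xor (c b) (c a)) := by
          intro c
          rw [extend_two]
          funext p
          by_cases hp : p = a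
          · subst hp
            rw [Function.update_self, Function.update_of_ne h]; rfl
          · rw [Function.update_of_ne hp]; rfl
        refine apply_congr fun c c' => ?_
        rw [onUnit_ofFun_eq (two a b h) _ _ _ c c' (p := c a) (q := c' a) rfl rfl (hu c) (hu c')]
        simp only [onUnit]
      refine ⟨2, two a b hab, _, fun i => ?_, key a b hab, fun f => ?_⟩
      · fin_cases i
        · exact List.mem_cons_self
        · exact List.mem_cons_of_mem _ List.mem_cons_self
      · rw [two_trans]
        exact key (f a) (f b) _

end QOp

/-! ## Locality of operations -/

namespace Dens

variable {W V U : Type}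

theorem hom_ext {M : Type*} [AddCommMonoid M] [Module ℂ M] {L L' : Dens W →ₗ[ℂ] M}
    (h : ∀ c c', L (Finsupp.single (c, c') 1) = L' (Finsupp.single (c, c') 1)) : L = L' := by
  refine Finsupp.lhom_ext' fun cc => LinearMap.ext_ring ?_
  exact h cc.1 cc.2

open Classical in
theorem restrict_single (f : V → W) (c c' : Conf W) (z : ℂ) :
    restrict f (Finsupp.single (c, c') z) =
      if ∀ q, q ∉ Set.range f → c q = c' q then Finsupp.single (c ∘ f, c' ∘ f) z else 0 := by
  rw [restrict, Finsupp.linearCombination_single]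
  simp only
  split_ifs <;> simp

theorem extend_single (f : V → W) (c c' : Conf V) (z : ℂ) :
    extend f (Finsupp.single (c, c') z) =
      Finsupp.single (Function.extend f c (fun _ => false), Function.extend f c' (fun _ => false))
        z := by
  rw [extend, Finsupp.linearCombination_single]
  simp

theorem extend_eq_mapDomain (f : V → W) (ρ : Dens V) :
    extend f ρ = Finsupp.mapDomain (fun cc => (Function.extend f cc.1 (fun _ => false),
      Function.extend f cc.2 (fun _ => false))) ρ := by
  have : extend f = Finsupp.lmapDomain ℂ ℂ (fun cc : Conf V × Conf V =>
      (Function.extend f cc.1 (fun _ => false), Function.extend f cc.2 (fun _ => false))) := by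
    refine hom_ext fun c c' => ?_
    rw [extend_single, Finsupp.lmapDomain_apply, Finsupp.mapDomain_single]
  rw [this]; rfl

theorem _root_.QOp.apply_unit (o : QOp W) (c c' : Conf W) :
    o.apply (Finsupp.single (c, c') 1) = o.onUnit c c' := by
  rw [QOp.apply_single, one_smul]

/-- Kraus coefficients read only the qubits acted on, so further qubits in state |0⟩ go along
unchanged. All comparisons between the two-party protocol and spacetime rest on this. -/
theorem apply_map_extend (f : V ↪ W) (o : QOp V) (ρ : Dens V) :
    (o.map f).apply (extend f ρ) = extend f (o.apply ρ) := by
  obtain ⟨n, w, Φ, -, h1, h2⟩ := o.exists_channel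
  rw [h1, h2]
  suffices h : (QOp.channel (w.trans f) Φ).apply ∘ₗ extend f =
      extend f ∘ₗ (QOp.channel w Φ).apply from LinearMap.congr_fun h ρ
  refine hom_ext fun c c' => ?_
  have hc : ∀ c : Conf V, Function.extend f c (fun _ => false) ∘ (w.trans f) = c ∘ w := by
    intro c
    funext i
    exact f.injective.extend_apply _ _ _
  simp only [LinearMap.comp_apply, extend_single, QOp.apply_unit, QOp.onUnit, map_sum]
  refine Finset.sum_congr rfl fun k _ => Finset.sum_congr rfl fun x _ =>
    Finset.sum_congr rfl fun y _ => ?_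
  rw [hc, hc, extend_trans, extend_trans]

theorem run_nil (ρ : Dens W) : run [] ρ = ρ := rfl

theorem run_cons (o : QOp W) (l : List (QOp W)) (ρ : Dens W) :
    run (o :: l) ρ = run l (o.apply ρ) := rfl

theorem run_append (l l' : List (QOp W)) (ρ : Dens W) : run (l ++ l') ρ = run l' (run l ρ) :=
  List.foldl_append

/-- `run` as a linear map. -/
noncomputable def runHom (l : List (QOp W)) : Dens W →ₗ[ℂ] Dens W where
  toFun := run l
  map_add' := by
    induction l with
    | nil => exact fun _ _ => rfl
    | cons o l ih => intro x y; rw [run_cons, map_add, ih]; rfl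
  map_smul' := by
    induction l with
    | nil => exact fun _ _ => rfl
    | cons o l ih => intro x y; rw [run_cons, map_smul, ih]; rfl

theorem runHom_apply (l : List (QOp W)) (ρ : Dens W) : runHom l ρ = run l ρ := rfl

theorem run_map_extend (f : V ↪ W) (l : List (QOp V)) (ρ : Dens V) :
    run (l.map (QOp.map f)) (extend f ρ) = extend f (run l ρ) := by
  induction l generalizing ρ with
  | nil => rfl
  | cons o l ih => rw [List.map_cons, run_cons, run_cons, apply_map_extend, ih]

theorem sum_triple_comm {α β γ δ ε ζ M : Type*} [Fintype α] [Fintype β] [Fintype γ] [Fintype δ]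
    [Fintype ε] [Fintype ζ] [AddCommMonoid M] (F : α → β → γ → δ → ε → ζ → M) :
    ∑ a, ∑ b, ∑ c, ∑ x, ∑ y, ∑ z, F a b c x y z = ∑ x, ∑ y, ∑ z, ∑ a, ∑ b, ∑ c, F a b c x y z := by
  have h1 : ∀ G : α → β → γ → M,
      ∑ a, ∑ b, ∑ c, G a b c = ∑ p : α × β × γ, G p.1 p.2.1 p.2.2 := by
    intro G; simp [Fintype.sum_prod_type]
  have h2 : ∀ G : δ → ε → ζ → M,
      ∑ a, ∑ b, ∑ c, G a b c = ∑ p : δ × ε × ζ, G p.1 p.2.1 p.2.2 := by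
    intro G; simp [Fintype.sum_prod_type]
  simp_rw [h1, h2]
  exact Finset.sum_comm

/-- Neither operation changes what the other reads, so both orders expand into the same sixfold sum
up to the order of summation. -/
theorem apply_comm {A B : W → Prop} {o o' : QOp W} (h : o.ActsOn A) (h' : o'.ActsOn B)
    (hAB : ∀ w, A w → ¬ B w) (ρ : Dens W) : o.apply (o'.apply ρ) = o'.apply (o.apply ρ) := by
  obtain ⟨n, w, Φ, hw, h1, -⟩ := o.exists_channel
  obtain ⟨m, v, Ψ, hv, h2, -⟩ := o'.exists_channel
  have hd : ∀ i j, w i ≠ v j := fun i j hij =>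
    hAB _ (QOp.actsOn_iff.1 h _ (hw i)) (hij ▸ QOp.actsOn_iff.1 h' _ (hv j))
  rw [h1, h2]
  suffices h : (QOp.channel w Φ).apply ∘ₗ (QOp.channel v Ψ).apply =
      (QOp.channel v Ψ).apply ∘ₗ (QOp.channel w Φ).apply from LinearMap.congr_fun h ρ
  refine hom_ext fun c c' => ?_
  simp only [LinearMap.comp_apply, QOp.apply_unit]
  have e1 : (QOp.channel w Φ).apply ((QOp.channel v Ψ).onUnit c c') =
      ∑ l, ∑ x', ∑ y', ∑ k, ∑ x, ∑ y, Finsupp.single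
        (Function.extend w x (Function.extend v x' c), Function.extend w y (Function.extend v y' c'))
        ((Ψ.kraus l x' (c ∘ v) * star (Ψ.kraus l y' (c' ∘ v))) *
          (Φ.kraus k x (c ∘ w) * star (Φ.kraus k y (c' ∘ w)))) := by
    simp only [QOp.onUnit, map_sum, QOp.apply_single, Finset.smul_sum, Finsupp.smul_single,
      smul_eq_mul, extend_comp_of_disjoint v w _ _ (fun i j => (hd j i).symm)]
  have e2 : (QOp.channel v Ψ).apply ((QOp.channel w Φ).onUnit c c') =
      ∑ k, ∑ x, ∑ y, ∑ l, ∑ x', ∑ y', Finsupp.single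
        (Function.extend w x (Function.extend v x' c), Function.extend w y (Function.extend v y' c'))
        ((Ψ.kraus l x' (c ∘ v) * star (Ψ.kraus l y' (c' ∘ v))) *
          (Φ.kraus k x (c ∘ w) * star (Φ.kraus k y (c' ∘ w)))) := by
    simp only [QOp.onUnit, map_sum, QOp.apply_single, Finset.smul_sum, Finsupp.smul_single,
      smul_eq_mul, extend_comp_of_disjoint w v _ _ hd, extend_extend_comm w v _ _ _ hd, mul_comm]
  rw [e1, e2]
  exact sum_triple_comm _

end Dens

namespace Dens

variable {W V U : Type}

/-! ## Operations on other qubits do not change a reduced state -/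

/-- Trace preservation, read off entry by entry. -/
theorem kraus_sum {n : ℕ} (Φ : QChannel n) (a b : Fin n → Bool) :
    ∑ k, ∑ x, Φ.kraus k x a * star (Φ.kraus k x b) = if a = b then 1 else 0 := by
  have h := congrFun (congrFun Φ.trace_preserving b) a
  simp only [Matrix.sum_apply, Matrix.mul_apply, Matrix.conjTranspose_apply, Matrix.one_apply] at h
  simp_rw [eq_comm (a := a), ← h, mul_comm]

/-- No signalling: the partial trace forces the two new local configurations to coincide, and the
sum over them collapses by trace preservation. -/
theorem restrict_apply_of_disjoint {f : V → W} {o : QOp W} (h : o.ActsOn fun w => w ∉ Set.range f)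
    (ρ : Dens W) : restrict f (o.apply ρ) = restrict f ρ := by
  classical
  obtain ⟨n, w, Φ, hw, h1, -⟩ := o.exists_channel
  have hd : ∀ i, w i ∉ Set.range f := fun i => QOp.actsOn_iff.1 h _ (hw i)
  have hd' : ∀ i j, w i ≠ f j := fun i j hij => hd i ⟨j, hij.symm⟩
  rw [h1]
  suffices h : restrict f ∘ₗ (QOp.channel w Φ).apply = restrict f from LinearMap.congr_fun h ρ
  refine hom_ext fun c c' => ?_
  simp only [LinearMap.comp_apply, QOp.apply_unit, QOp.onUnit, map_sum, restrict_single,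
    extend_comp_of_disjoint w f _ _ hd']
  have key : ∀ x y, (∀ q, q ∉ Set.range f →
      Function.extend w x c q = Function.extend w y c' q) ↔
      x = y ∧ ∀ q, q ∉ Set.range f → q ∉ Set.range w → c q = c' q := by
    intro x y
    constructor
    · intro hq
      refine ⟨funext fun i => ?_, fun q h1 h2 => ?_⟩
      · have := hq _ (hd i)
        rwa [w.injective.extend_apply, w.injective.extend_apply] at this
      · have := hq _ h1
        rwa [Function.extend_apply' (f := w) _ _ _ h2,
          Function.extend_apply' (f := w) _ _ _ h2] at this
    · rintro ⟨rfl, hq⟩ q h1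
      by_cases h2 : q ∈ Set.range w
      · obtain ⟨i, rfl⟩ := h2
        rw [w.injective.extend_apply, w.injective.extend_apply]
      · rw [Function.extend_apply' (f := w) _ _ _ h2, Function.extend_apply' (f := w) _ _ _ h2]
        exact hq q h1 h2
  have hR : (∀ q, q ∉ Set.range f → c q = c' q) ↔
      (c ∘ w = c' ∘ w ∧ ∀ q, q ∉ Set.range f → q ∉ Set.range w → c q = c' q) := by
    constructor
    · exact fun hq => ⟨funext fun i => hq _ (hd i), fun q h1 _ => hq q h1⟩
    · rintro ⟨hq1, hq2⟩ q h1
      by_cases h2 : q ∈ Set.range w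
      · obtain ⟨i, rfl⟩ := h2
        exact congrFun hq1 i
      · exact hq2 q h1 h2
  simp only [key, hR, ite_and, Finset.sum_ite_eq, Finset.mem_univ, if_true]
  by_cases hq : ∀ q, q ∉ Set.range f → q ∉ Set.range w → c q = c' q
  · simp only [if_pos hq, ← Finsupp.single_finsetSum, kraus_sum]
    split_ifs <;> simp
  · simp only [if_neg hq, ite_self, Finset.sum_const_zero]

theorem restrict_run_of_disjoint {f : V → W} {l : List (QOp W)}
    (h : ∀ o ∈ l, o.ActsOn fun w => w ∉ Set.range f) (ρ : Dens W) :
    restrict f (run l ρ) = restrict f ρ := by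
  induction l generalizing ρ with
  | nil => rfl
  | cons o l ih =>
    rw [run_cons, ih (fun o ho => h o (List.mem_cons_of_mem _ ho)),
      restrict_apply_of_disjoint (h o List.mem_cons_self)]

theorem run_comm {A B : W → Prop} {l l' : List (QOp W)} (h : ∀ o ∈ l, o.ActsOn A)
    (h' : ∀ o ∈ l', o.ActsOn B) (hAB : ∀ w, A w → ¬ B w) (ρ : Dens W) :
    run l (run l' ρ) = run l' (run l ρ) := by
  have one : ∀ (o : QOp W) (l' : List (QOp W)), o.ActsOn A → (∀ o ∈ l', o.ActsOn B) → ∀ ρ,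
      o.apply (run l' ρ) = run l' (o.apply ρ) := by
    intro o l' ho h' ρ
    induction l' generalizing ρ with
    | nil => rfl
    | cons o' l' ih =>
      rw [run_cons, run_cons, ih (fun o ho => h' o (List.mem_cons_of_mem _ ho)),
        apply_comm ho (h' o' List.mem_cons_self) hAB]
  induction l generalizing ρ with
  | nil => rfl
  | cons o l ih =>
    rw [run_cons, run_cons, one o l' (h o List.mem_cons_self) h',
      ih (fun o ho => h o (List.mem_cons_of_mem _ ho))]

/-! ## Composition of reductions and extensions -/

theorem conf_extend_extend (f : V ↪ W) (g : U ↪ V) (c : Conf U) :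
    Function.extend f (Function.extend g c fun _ => false) (fun _ => false) =
      Function.extend (g.trans f) c fun _ => false := by
  rw [← extend_trans]
  congr 1
  funext q
  by_cases h : ∃ a, f a = q
  · obtain ⟨a, rfl⟩ := h
    exact f.injective.extend_apply _ _ _
  · exact Function.extend_apply' _ _ _ h

theorem extend_extend (f : V ↪ W) (g : U ↪ V) (ρ : Dens U) :
    extend f (extend g ρ) = extend (g.trans f) ρ := by
  suffices h : extend f ∘ₗ extend g = extend (g.trans f) from LinearMap.congr_fun h ρ
  refine hom_ext fun c c' => ?_
  simp only [LinearMap.comp_apply, extend_single, conf_extend_extend]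

theorem restrict_trans (f : V ↪ W) (g : U ↪ V) (ρ : Dens W) :
    restrict (g.trans f) ρ = restrict g (restrict f ρ) := by
  classical
  suffices h : restrict (g.trans f) = restrict g ∘ₗ restrict f from LinearMap.congr_fun h ρ
  refine hom_ext fun c c' => ?_
  simp only [LinearMap.comp_apply, restrict_single]
  rw [apply_ite (restrict g), map_zero, restrict_single, ← ite_and]
  refine if_congr ⟨fun h => ⟨fun q hq => h q ?_, fun q hq => h (f q) ?_⟩, ?_⟩ rfl rfl
  · rintro ⟨a, rfl⟩; exact hq ⟨_, rfl⟩
  · rintro ⟨a, ha⟩; exact hq ⟨a, f.injective ha⟩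
  · rintro ⟨h1, h2⟩ q hq
    by_cases h : q ∈ Set.range f
    · obtain ⟨a, rfl⟩ := h
      exact h2 a fun ⟨b, hb⟩ => hq ⟨b, congrArg f hb⟩
    · exact h1 q h

theorem restrict_extend_self (f : V ↪ W) (ρ : Dens V) : restrict f (extend f ρ) = ρ := by
  suffices h : restrict f ∘ₗ extend f = LinearMap.id from LinearMap.congr_fun h ρ
  refine hom_ext fun c c' => ?_
  simp only [LinearMap.comp_apply, extend_single, restrict_single, LinearMap.id_apply]
  rw [if_pos]
  · have : ∀ c : Conf V, Function.extend f c (fun _ => false) ∘ f = c := fun c =>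
      funext fun a => f.injective.extend_apply _ _ _
    rw [this, this]
  · intro q hq
    rw [Function.extend_apply' (f := f) _ _ _ hq, Function.extend_apply' (f := f) _ _ _ hq]

theorem restrict_extend (f : V ↪ W) (g : U ↪ V) (ρ : Dens V) :
    restrict (g.trans f) (extend f ρ) = restrict g ρ := by
  rw [restrict_trans, restrict_extend_self]

/-- All qubits outside `A` are in state `|0⟩`. -/
def SupportedOn (A : W → Prop) (ρ : Dens W) : Prop :=
  ∀ cc ∈ ρ.support, ∀ w, ¬ A w → cc.1 w = false ∧ cc.2 w = false

/-- A partial trace over qubits in state |0⟩ loses nothing. Hiding uses this to recover the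
receiver's whole state from the verifiers' memories. -/
theorem extend_restrict (f : V ↪ W) {ρ : Dens W} (h : SupportedOn (· ∈ Set.range f) ρ) :
    extend f (restrict f ρ) = ρ := by
  classical
  have e : ∀ cc ∈ ρ.support, ∀ z : ℂ, extend f (restrict f (Finsupp.single cc z))
      = Finsupp.single cc z := by
    rintro ⟨c, c'⟩ hc z
    have h' := h _ hc
    have key : ∀ c : Conf W, (∀ w, w ∉ Set.range f → c w = false) →
        Function.extend f (c ∘ f) (fun _ => false) = c := by
      intro c hc
      funext q
      by_cases hq : q ∈ Set.range f
      · obtain ⟨a, rfl⟩ := hq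
        exact f.injective.extend_apply _ _ _
      · rw [Function.extend_apply' (f := f) _ _ _ hq, hc q hq]
    rw [restrict_single, if_pos, extend_single, key c fun w hw => (h' w hw).1,
      key c' fun w hw => (h' w hw).2]
    intro q hq
    exact (h' q hq).1.trans (h' q hq).2.symm
  conv_rhs => rw [← Finsupp.sum_single ρ]
  conv_lhs => rw [← Finsupp.sum_single ρ]
  simp only [Finsupp.sum, map_sum]
  exact Finset.sum_congr rfl fun cc hc => e cc hc _

/-! ## Supports -/

theorem run_vacuum_extend (f : V ↪ W) : extend f (vacuum : Dens V) = vacuum := by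
  rw [vacuum, extend_single, vacuum]
  congr 1
  have : Function.extend f (fun _ : V => false) (fun _ => false) = fun _ => false := by
    funext q
    by_cases h : ∃ a, f a = q
    · obtain ⟨a, rfl⟩ := h
      exact f.injective.extend_apply _ _ _
    · exact Function.extend_apply' _ _ _ h
  rw [this]

/-- A property of pairs of configurations that is preserved on matrix units is preserved on
supports. -/
theorem support_induction {L : Dens W →ₗ[ℂ] Dens V} {P : Conf W → Conf W → Prop}
    {Q : Conf V → Conf V → Prop}
    (h : ∀ c c', P c c' → ∀ dd ∈ (L (Finsupp.single (c, c') 1)).support, Q dd.1 dd.2)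
    {ρ : Dens W} (hρ : ∀ cc ∈ ρ.support, P cc.1 cc.2) :
    ∀ dd ∈ (L ρ).support, Q dd.1 dd.2 := by
  classical
  intro dd hdd
  have e : L ρ = ∑ cc ∈ ρ.support, ρ cc • L (Finsupp.single cc 1) := by
    conv_lhs => rw [← Finsupp.sum_single ρ]
    simp only [Finsupp.sum, map_sum]
    refine Finset.sum_congr rfl fun cc _ => ?_
    rw [← map_smul, Finsupp.smul_single, smul_eq_mul, mul_one]
  rw [e] at hdd
  obtain ⟨cc, hcc, hd⟩ := Finset.mem_biUnion.1 (Finsupp.support_finsetSum hdd)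
  exact h _ _ (hρ cc hcc) _ (Finsupp.support_smul hd)

theorem mem_support_onUnit_channel {n : ℕ} {w : Fin n ↪ W} {Φ : QChannel n} {c c' : Conf W}
    {dd : Conf W × Conf W} (h : dd ∈ ((QOp.channel w Φ).onUnit c c').support) :
    ∃ x y, dd = (Function.extend w x c, Function.extend w y c') := by
  classical
  simp only [QOp.onUnit] at h
  obtain ⟨k, -, h⟩ := Finset.mem_biUnion.1 (Finsupp.support_finsetSum h)
  obtain ⟨x, -, h⟩ := Finset.mem_biUnion.1 (Finsupp.support_finsetSum h)
  obtain ⟨y, -, h⟩ := Finset.mem_biUnion.1 (Finsupp.support_finsetSum h)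
  exact ⟨x, y, Finset.mem_singleton.1 (Finsupp.support_single_subset h)⟩

theorem SupportedOn.apply {A : W → Prop} {o : QOp W} (h : o.ActsOn A) {ρ : Dens W}
    (hρ : SupportedOn A ρ) : SupportedOn A (o.apply ρ) := by
  obtain ⟨n, w, Φ, hw, h1, -⟩ := o.exists_channel
  rw [h1]
  refine support_induction (P := fun c c' => ∀ w, ¬ A w → c w = false ∧ c' w = false)
    (Q := fun c c' => ∀ w, ¬ A w → c w = false ∧ c' w = false) ?_ hρ
  intro c c' hc dd hdd q hq
  rw [QOp.apply_unit] at hdd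
  obtain ⟨x, y, rfl⟩ := mem_support_onUnit_channel hdd
  have hq' : ¬ ∃ i, w i = q := fun ⟨i, hi⟩ => hq (hi ▸ QOp.actsOn_iff.1 h _ (hw i))
  simp only
  rw [Function.extend_apply' (f := w) _ _ _ hq', Function.extend_apply' (f := w) _ _ _ hq']
  exact hc q hq

theorem SupportedOn.run {A : W → Prop} {l : List (QOp W)} (h : ∀ o ∈ l, o.ActsOn A) {ρ : Dens W}
    (hρ : SupportedOn A ρ) : SupportedOn A (run l ρ) := by
  induction l generalizing ρ with
  | nil => exact hρ
  | cons o l ih =>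
    exact ih (fun o ho => h o (List.mem_cons_of_mem _ ho)) (hρ.apply (h o List.mem_cons_self))

theorem supportedOn_vacuum (A : W → Prop) : SupportedOn A (vacuum : Dens W) := by
  intro cc hcc
  rw [vacuum] at hcc
  rw [Finset.mem_singleton.1 (Finsupp.support_single_subset hcc)]
  exact fun _ _ => ⟨rfl, rfl⟩

/-- Qubit `q` is classical. -/
def Diag (q : W) (ρ : Dens W) : Prop := ∀ cc ∈ ρ.support, cc.1 q = cc.2 q

theorem Diag.apply_of_not_mem {q : W} {o : QOp W} (h : q ∉ o.wires) {ρ : Dens W} (hρ : Diag q ρ) :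
    Diag q (o.apply ρ) := by
  obtain ⟨n, w, Φ, hw, h1, -⟩ := o.exists_channel
  rw [h1]
  refine support_induction (P := fun c c' => c q = c' q) (Q := fun c c' => c q = c' q) ?_ hρ
  intro c c' hc dd hdd
  rw [QOp.apply_unit] at hdd
  obtain ⟨x, y, rfl⟩ := mem_support_onUnit_channel hdd
  have hq' : ¬ ∃ i, w i = q := fun ⟨i, hi⟩ => h (hi ▸ hw i)
  simp only
  rwa [Function.extend_apply' (f := w) _ _ _ hq', Function.extend_apply' (f := w) _ _ _ hq']

theorem Diag.apply_measure {q p : W} {ρ : Dens W} (hρ : p = q ∨ Diag q ρ) :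
    Diag q ((QOp.measure p).apply ρ) := by
  have : ∀ cc ∈ ρ.support, p = q ∨ cc.1 q = cc.2 q := fun cc hcc =>
    hρ.imp_right fun h => h cc hcc
  refine support_induction (P := fun c c' => p = q ∨ c q = c' q) (Q := fun c c' => c q = c' q)
    ?_ this
  intro c c' hc dd hdd
  rw [QOp.apply_unit] at hdd
  simp only [QOp.onUnit] at hdd
  split_ifs at hdd with h
  · rw [Finset.mem_singleton.1 (Finsupp.support_single_subset hdd)]
    rcases hc with rfl | hc
    · exact h
    · exact hc
  · simp at hdd

/-- Only matrix units that agree at the source survive, so even if the qubit in question is the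
target, both sides are flipped by the same amount. -/
theorem Diag.apply_copy {q a b : W} {ρ : Dens W} (hρ : Diag q ρ) :
    Diag q ((QOp.copy a b).apply ρ) := by
  classical
  refine support_induction (P := fun c c' => c q = c' q) (Q := fun c c' => c q = c' q) ?_ hρ
  intro c c' hc dd hdd
  rw [QOp.apply_unit] at hdd
  simp only [QOp.onUnit] at hdd
  split_ifs at hdd with h
  · rw [Finset.mem_singleton.1 (Finsupp.support_single_subset hdd)]
    simp only
    by_cases hq : q = b
    · subst hq
      rw [Function.update_self, Function.update_self, h, hc]
    · rw [Function.update_of_ne hq, Function.update_of_ne hq, hc]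
  · simp at hdd

theorem eq_of_forall_support {L : Dens W →ₗ[ℂ] Dens W} {ρ : Dens W}
    (h : ∀ cc ∈ ρ.support, L (Finsupp.single cc 1) = Finsupp.single cc 1) : L ρ = ρ := by
  conv_rhs => rw [← Finsupp.sum_single ρ]
  conv_lhs => rw [← Finsupp.sum_single ρ]
  simp only [Finsupp.sum, map_sum]
  refine Finset.sum_congr rfl fun cc hcc => ?_
  have := congrArg (fun x => ρ cc • x) (h cc hcc)
  simpa only [← map_smul, Finsupp.smul_single, smul_eq_mul, mul_one] using this

theorem Diag.measure_eq {q : W} {ρ : Dens W} (h : Diag q ρ) : (QOp.measure q).apply ρ = ρ := by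
  refine eq_of_forall_support ?_
  rintro ⟨c, c'⟩ hcc
  rw [QOp.apply_unit]
  exact if_pos (h _ hcc)

/-- A classical qubit can be measured again without effect; the receiver's final measurement repeats
one that the simulated verifiers have made. -/
theorem run_measure_eq {l : List (QOp W)} {ρ : Dens W}
    (h : ∀ o ∈ l, ∃ q, o = QOp.measure q ∧ Diag q ρ) : run l ρ = ρ := by
  induction l with
  | nil => rfl
  | cons o l ih =>
    obtain ⟨q, rfl, hq⟩ := h o List.mem_cons_self
    rw [run_cons, hq.measure_eq, ih fun o ho => h o (List.mem_cons_of_mem _ ho)]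

theorem mem_support_extend (f : V ↪ W) {ρ : Dens V} {cc : Conf V × Conf V} (h : cc ∈ ρ.support) :
    (Function.extend f cc.1 (fun _ => false), Function.extend f cc.2 (fun _ => false)) ∈
      (extend f ρ).support := by
  have hinj : Function.Injective fun c : Conf V => Function.extend f c fun _ => false := by
    intro c c' hcc
    funext a
    have := congrFun hcc (f a)
    simpa only [f.injective.extend_apply] using this
  have hinj2 : Function.Injective fun cc : Conf V × Conf V =>
      (Function.extend f cc.1 (fun _ => false), Function.extend f cc.2 (fun _ => false)) :=
    hinj.prodMap hinj
  rw [extend_eq_mapDomain, Finsupp.mem_support_iff, Finsupp.mapDomain_apply hinj2]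
  exact Finsupp.mem_support_iff.1 h

theorem Diag.of_extend {f : V ↪ W} {ρ : Dens V} {q : V} (h : Diag (f q) (extend f ρ)) :
    Diag q ρ := by
  intro cc hcc
  have := h _ (mem_support_extend f hcc)
  simpa only [f.injective.extend_apply] using this

theorem SupportedOn.of_extend {f : V ↪ W} {ρ : Dens V} {A : W → Prop}
    (h : SupportedOn A (extend f ρ)) : SupportedOn (fun q => A (f q)) ρ := by
  intro cc hcc q hq
  have := h _ (mem_support_extend f hcc) (f q) hq
  simpa only [f.injective.extend_apply] using this

end Dens

namespace Dens

variable {W V U : Type}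

/-! ## Pure states and positivity -/

/-- The operator `|u⟩⟨v|`. -/
noncomputable def outer (u v : Conf W →₀ ℂ) : Dens W :=
  u.sum fun c a => v.sum fun c' b => Finsupp.single (c, c') (a * star b)

theorem outer_apply (u v : Conf W →₀ ℂ) (c c' : Conf W) : outer u v (c, c') = u c * star (v c') := by
  classical
  simp only [outer, Finsupp.sum, Finsupp.coe_finsetSum, Finset.sum_apply, Finsupp.single_apply,
    Prod.mk.injEq]
  simp only [ite_and]
  by_cases h1 : u c = 0
  · rw [h1, zero_mul]
    refine Finset.sum_eq_zero fun d hd => Finset.sum_eq_zero fun d' _ => if_neg ?_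
    rintro rfl
    exact Finsupp.mem_support_iff.1 hd h1
  · by_cases h2 : v c' = 0
    · rw [h2, star_zero, mul_zero]
      refine Finset.sum_eq_zero fun d hd => Finset.sum_eq_zero fun d' hd' => ?_
      split_ifs with h3 h4
      · rw [h4] at hd'
        exact absurd h2 (Finsupp.mem_support_iff.1 hd')
      · rfl
      · rfl
    · rw [Finset.sum_eq_single c, Finset.sum_eq_single c']
      · simp
      · intro d _ hd; simp [hd]
      · intro h; exact absurd (Finsupp.mem_support_iff.2 h2) h
      · intro d _ hd; simp [hd]
      · intro h; exact absurd (Finsupp.mem_support_iff.2 h1) h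

/-- The operator `|v⟩⟨v|`. -/
noncomputable def pure (v : Conf W →₀ ℂ) : Dens W := outer v v

theorem pure_apply (v : Conf W →₀ ℂ) (c c' : Conf W) : pure v (c, c') = v c * star (v c') :=
  outer_apply _ _ _ _

/-- Parallelogram identity: the cross terms cancel. Through it, a positive functional that vanishes
on two pure states vanishes on their superposition. -/
theorem pure_add_add_pure_sub (u v : Conf W →₀ ℂ) :
    pure (u + v) + pure (u - v) = pure u + pure u + (pure v + pure v) := by
  ext ⟨c, c'⟩
  simp only [Finsupp.add_apply, pure_apply, Finsupp.sub_apply, star_add, star_sub]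
  ring

theorem outer_single (c c' : Conf W) (a b : ℂ) :
    outer (Finsupp.single c a) (Finsupp.single c' b) = Finsupp.single (c, c') (a * star b) := by
  simp [outer]

theorem outer_sum_left {ι : Type*} (s : Finset ι) (u : ι → (Conf W →₀ ℂ)) (v : Conf W →₀ ℂ) :
    outer (∑ i ∈ s, u i) v = ∑ i ∈ s, outer (u i) v := by
  ext ⟨c, c'⟩
  simp only [outer_apply, Finsupp.coe_finsetSum, Finset.sum_apply, Finset.sum_mul]

theorem outer_sum_right {ι : Type*} (s : Finset ι) (u : Conf W →₀ ℂ) (v : ι → (Conf W →₀ ℂ)) :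
    outer u (∑ i ∈ s, v i) = ∑ i ∈ s, outer u (v i) := by
  ext ⟨c, c'⟩
  simp only [outer_apply, Finsupp.coe_finsetSum, Finset.sum_apply, Finset.mul_sum, star_sum]

theorem outer_smul (a b : ℂ) (u v : Conf W →₀ ℂ) :
    outer (a • u) (b • v) = (a * star b) • outer u v := by
  ext ⟨c, c'⟩
  simp only [outer_apply, Finsupp.smul_apply, smul_eq_mul, star_mul]
  ring

theorem pure_eq_sum (v : Conf W →₀ ℂ) : pure v =
    ∑ c ∈ v.support, ∑ c' ∈ v.support, (v c * star (v c')) • Finsupp.single (c, c') (1 : ℂ) := by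
  simp [pure, outer, Finsupp.sum]

/-- A linear map with Kraus operators `T k`. -/
theorem map_pure_eq_sum {ι : Type*} [Fintype ι] {L : Dens W →ₗ[ℂ] Dens V}
    (T : ι → Conf W → (Conf V →₀ ℂ))
    (h : ∀ c c', L (Finsupp.single (c, c') 1) = ∑ k, outer (T k c) (T k c')) (v : Conf W →₀ ℂ) :
    L (pure v) = ∑ k, pure (∑ c ∈ v.support, v c • T k c) := by
  have e : ∀ k, pure (∑ c ∈ v.support, v c • T k c) = ∑ c ∈ v.support, ∑ c' ∈ v.support,
      (v c * star (v c')) • outer (T k c) (T k c') := by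
    intro k
    rw [pure, outer_sum_left]
    simp only [outer_sum_right, outer_smul]
  simp only [e, pure_eq_sum v, map_sum, map_smul, h, Finset.smul_sum]
  rw [Finset.sum_comm]
  conv_rhs => rw [Finset.sum_comm]
  rw [Finset.sum_comm]
  refine Finset.sum_congr rfl fun c _ => ?_
  rw [Finset.sum_comm]

/-- The cone of positive operators generated by the pure states in the span of `G`. -/
noncomputable def Cone (G : Set (Conf W)) : AddSubmonoid (Dens W) :=
  AddSubmonoid.closure {ρ | ∃ v : Conf W →₀ ℂ, (∀ c ∈ v.support, c ∈ G) ∧ ρ = pure v}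

theorem pure_mem_cone {G : Set (Conf W)} {v : Conf W →₀ ℂ} (h : ∀ c ∈ v.support, c ∈ G) :
    pure v ∈ Cone G := AddSubmonoid.subset_closure ⟨v, h, rfl⟩

theorem map_mem_cone {G : Set (Conf W)} {G' : Set (Conf V)} {L : Dens W →ₗ[ℂ] Dens V}
    (h : ∀ v : Conf W →₀ ℂ, (∀ c ∈ v.support, c ∈ G) → L (pure v) ∈ Cone G') {ρ : Dens W}
    (hρ : ρ ∈ Cone G) : L ρ ∈ Cone G' := by
  induction hρ using AddSubmonoid.closure_induction with
  | mem x hx => obtain ⟨v, hv, rfl⟩ := hx; exact h v hv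
  | zero => rw [map_zero]; exact zero_mem _
  | add x y _ _ hx hy => rw [map_add]; exact add_mem hx hy

theorem cone_mono {G G' : Set (Conf W)} (h : G ⊆ G') : Cone G ≤ Cone G' :=
  AddSubmonoid.closure_mono fun _ ⟨v, hv, e⟩ => ⟨v, fun c hc => h (hv c hc), e⟩

/-- Configurations with finitely many ones, all of them in `A`. -/
def finConf (A : W → Prop) : Set (Conf W) := {c | (∀ w, ¬ A w → c w = false) ∧ {w | c w = true}.Finite}

theorem vacuum_mem_cone (A : W → Prop) : (vacuum : Dens W) ∈ Cone (finConf A) := by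
  have : (vacuum : Dens W) = pure (Finsupp.single (fun _ => false) 1) := by
    rw [pure, outer_single, vacuum]; simp
  rw [this]
  refine pure_mem_cone fun c hc => ?_
  rw [Finset.mem_singleton.1 (Finsupp.support_single_subset hc)]
  exact ⟨fun _ _ => rfl, by simp⟩

theorem sum_support_subset {ι : Type*} {s : Finset ι} {a : ι → ℂ} {T : ι → (Conf V →₀ ℂ)}
    {G : Set (Conf V)} (h : ∀ i ∈ s, ∀ c ∈ (T i).support, c ∈ G) :
    ∀ c ∈ (∑ i ∈ s, a i • T i).support, c ∈ G := by
  classical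
  intro c hc
  obtain ⟨i, hi, hc⟩ := Finset.mem_biUnion.1 (Finsupp.support_finsetSum hc)
  exact h i hi c (Finsupp.support_smul hc)

theorem extend_mem_finConf {n : ℕ} {A : W → Prop} {w : Fin n ↪ W} (hw : ∀ i, A (w i))
    (x : Fin n → Bool) {c : Conf W} (hc : c ∈ finConf A) :
    Function.extend w x c ∈ finConf A := by
  refine ⟨fun q hq => ?_, ?_⟩
  · have hq' : ¬ ∃ i, w i = q := fun ⟨i, hi⟩ => hq (hi ▸ hw i)
    rw [Function.extend_apply' (f := w) _ _ _ hq']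
    exact hc.1 q hq
  · refine (hc.2.union (Set.finite_range w)).subset fun q hq => ?_
    by_cases h : ∃ i, w i = q
    · exact Or.inr h
    · left
      have hq : _ = true := hq
      rwa [Function.extend_apply' (f := w) _ _ _ h] at hq

/-- Each Kraus operator sends a vector to a vector, so a pure state becomes a sum of pure states. -/
theorem apply_mem_cone_of {G : Set (Conf W)} {o : QOp W}
    (hG : ∀ (n : ℕ) (w : Fin n ↪ W), (∀ i, w i ∈ o.wires) → ∀ x, ∀ c ∈ G,
      Function.extend w x c ∈ G) {ρ : Dens W} (hρ : ρ ∈ Cone G) : o.apply ρ ∈ Cone G := by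
  obtain ⟨n, w, Φ, hw, h1, -⟩ := o.exists_channel
  rw [h1]
  refine map_mem_cone (fun v hv => ?_) hρ
  rw [map_pure_eq_sum (fun k c => ∑ x, Φ.kraus k x (c ∘ w) •
    Finsupp.single (Function.extend w x c) (1 : ℂ))]
  · refine sum_mem fun k _ => pure_mem_cone (sum_support_subset fun c hc =>
      sum_support_subset fun x _ d hd => ?_)
    rw [Finset.mem_singleton.1 (Finsupp.support_single_subset hd)]
    exact hG n w hw x c (hv c hc)
  · intro c c'
    rw [QOp.apply_unit]
    simp only [QOp.onUnit, outer_sum_left]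
    simp only [outer_sum_right, outer_single, Finsupp.smul_single, mul_one,
      smul_eq_mul]

theorem apply_mem_cone {A : W → Prop} {o : QOp W} (h : o.ActsOn A) {ρ : Dens W}
    (hρ : ρ ∈ Cone (finConf A)) : o.apply ρ ∈ Cone (finConf A) :=
  apply_mem_cone_of (fun _ _ hw x _ hc =>
    extend_mem_finConf (fun i => QOp.actsOn_iff.1 h _ (hw i)) x hc) hρ

theorem run_mem_cone_univ (l : List (QOp W)) {ρ : Dens W} (hρ : ρ ∈ Cone Set.univ) :
    run l ρ ∈ Cone Set.univ := by
  induction l generalizing ρ with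
  | nil => exact hρ
  | cons o l ih => exact ih (apply_mem_cone_of (fun _ _ _ _ _ _ => Set.mem_univ _) hρ)

theorem run_mem_cone {A : W → Prop} {l : List (QOp W)} (h : ∀ o ∈ l, o.ActsOn A) {ρ : Dens W}
    (hρ : ρ ∈ Cone (finConf A)) : run l ρ ∈ Cone (finConf A) := by
  induction l generalizing ρ with
  | nil => exact hρ
  | cons o l ih =>
    exact ih (fun o ho => h o (List.mem_cons_of_mem _ ho)) (apply_mem_cone (h o List.mem_cons_self) hρ)

/-! ### Images of pure states under maps of basis states -/

theorem mapDomain_pure (g : Conf W → Conf V) (v : Conf W →₀ ℂ) :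
    Finsupp.mapDomain (fun cc : Conf W × Conf W => (g cc.1, g cc.2)) (pure v) =
      pure (Finsupp.mapDomain g v) := by
  simp only [pure_eq_sum v, Finsupp.mapDomain_finsetSum, Finsupp.mapDomain_smul,
    Finsupp.mapDomain_single]
  conv_rhs => rw [pure, Finsupp.mapDomain, Finsupp.sum, outer_sum_left]
  simp only [outer_sum_right, outer_single, Finsupp.smul_single, smul_eq_mul, mul_one]

theorem mapDomain_support_subset {g : Conf W → Conf V} {v : Conf W →₀ ℂ} {G : Set (Conf V)}
    (h : ∀ c ∈ v.support, g c ∈ G) : ∀ c ∈ (Finsupp.mapDomain g v).support, c ∈ G := by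
  classical
  intro c hc
  obtain ⟨d, hd, rfl⟩ := Finset.mem_image.1 (Finsupp.mapDomain_support hc)
  exact h d hd

theorem extend_mem_cone {A : V → Prop} {B : W → Prop} (f : V ↪ W) (h : ∀ q, A q → B (f q))
    {ρ : Dens V} (hρ : ρ ∈ Cone (finConf A)) : extend f ρ ∈ Cone (finConf B) := by
  refine map_mem_cone (fun v hv => ?_) hρ
  rw [extend_eq_mapDomain, mapDomain_pure (fun c => Function.extend f c fun _ => false)]
  refine pure_mem_cone (mapDomain_support_subset fun c hc => ?_)
  obtain ⟨h1, h2⟩ := hv c hc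
  refine ⟨fun w hw => ?_, (h2.image f).subset fun w hw => ?_⟩
  · by_cases hq : ∃ q, f q = w
    · obtain ⟨q, rfl⟩ := hq
      rw [f.injective.extend_apply]
      exact h1 q fun h' => hw (h q h')
    · exact Function.extend_apply' _ _ _ hq
  · by_cases hq : ∃ q, f q = w
    · obtain ⟨q, rfl⟩ := hq
      have hw : _ = true := hw
      rw [f.injective.extend_apply] at hw
      exact ⟨q, hw, rfl⟩
    · have hw : _ = true := hw
      rw [Function.extend_apply' (f := f) _ _ _ hq] at hw
      exact absurd hw (by simp)

open Classical in
/-- The configuration of the qubits outside the range of `f`. -/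
noncomputable def envConf (f : V → W) (c : Conf W) : Conf W := fun w =>
  if w ∈ Set.range f then false else c w

theorem envConf_eq_iff {f : V → W} {c c' : Conf W} :
    envConf f c = envConf f c' ↔ ∀ q, q ∉ Set.range f → c q = c' q := by
  constructor
  · intro h q hq
    simpa [envConf, if_neg hq] using congrFun h q
  · intro h
    funext q
    simp only [envConf]
    split_ifs with hq
    · rfl
    · exact h q hq

open Classical in
-- The partial trace keeps only pairs of basis states that agree outside `f`. Grouping by this
-- environment configuration leaves one vector, hence one pure summand, per configuration.
theorem restrict_pure (f : V → W) (v : Conf W →₀ ℂ) :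
    restrict f (pure v) = ∑ e ∈ v.support.image (envConf f),
      pure (Finsupp.mapDomain (· ∘ f) (v.filter fun c => envConf f c = e)) := by
  have e1 : ∀ e, pure (Finsupp.mapDomain (· ∘ f) (v.filter fun c => envConf f c = e)) =
      ∑ c ∈ v.support, ∑ c' ∈ v.support, if envConf f c = e then (if envConf f c' = e then
        Finsupp.single (c ∘ f, c' ∘ f) (v c * star (v c')) else 0) else 0 := by
    intro e
    rw [← mapDomain_pure, pure_eq_sum, Finsupp.mapDomain_finsetSum, Finsupp.support_filter,
      Finset.sum_filter]
    refine Finset.sum_congr rfl fun c _ => ?_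
    split_ifs with h
    · rw [Finsupp.mapDomain_finsetSum, Finset.sum_filter]
      refine Finset.sum_congr rfl fun c' _ => ?_
      split_ifs with h'
      · rw [Finsupp.filter_apply_pos (fun c => envConf f c = e) _ h,
          Finsupp.filter_apply_pos (fun c => envConf f c = e) _ h', Finsupp.mapDomain_smul, Finsupp.mapDomain_single]
        simp
      · rfl
    · simp
  simp only [e1]
  rw [Finset.sum_comm, pure_eq_sum, map_sum]
  refine Finset.sum_congr rfl fun c hc => ?_
  rw [Finset.sum_comm, map_sum]
  refine Finset.sum_congr rfl fun c' hc' => ?_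
  rw [map_smul, restrict_single, Finset.sum_ite_eq,
    if_pos (Finset.mem_image_of_mem _ hc), ← envConf_eq_iff]
  rw [eq_comm (a := envConf f c')]
  split_ifs <;> simp

theorem restrict_mem_cone {A : W → Prop} (f : V ↪ W) {ρ : Dens W} (hρ : ρ ∈ Cone (finConf A)) :
    restrict f ρ ∈ Cone (finConf fun q => A (f q)) := by
  classical
  refine map_mem_cone (fun v hv => ?_) hρ
  rw [restrict_pure]
  refine sum_mem fun e _ => pure_mem_cone (mapDomain_support_subset fun c hc => ?_)
  rw [Finsupp.support_filter, Finset.mem_filter] at hc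
  obtain ⟨h1, h2⟩ := hv c hc.1
  exact ⟨fun q hq => h1 _ hq, h2.preimage f.injective.injOn⟩

/-! ### Projections onto sets of basis states -/

open Classical in
/-- The projection onto the span of `S`. -/
noncomputable def filt (S : Set (Conf W)) : Dens W →ₗ[ℂ] Dens W :=
  Finsupp.linearCombination ℂ fun cc => if cc.1 ∈ S ∧ cc.2 ∈ S then Finsupp.single cc 1 else 0

theorem filt_single (S : Set (Conf W)) (c c' : Conf W) (z : ℂ) [Decidable (c ∈ S ∧ c' ∈ S)] :
    filt S (Finsupp.single (c, c') z) = if c ∈ S ∧ c' ∈ S then Finsupp.single (c, c') z else 0 := by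
  rw [filt, Finsupp.linearCombination_single]
  simp only
  split_ifs <;> simp

theorem project_eq_filt (K z : Finset W) :
    project K z = filt {c | ∀ q ∈ K, (c q = true ↔ q ∈ z)} := by
  classical
  refine hom_ext fun c c' => ?_
  rw [filt_single, project, Finsupp.linearCombination_single, one_smul]
  exact if_congr (Iff.rfl) rfl rfl

theorem filt_mem_cone (S : Set (Conf W)) {G : Set (Conf W)} {ρ : Dens W} (hρ : ρ ∈ Cone G) :
    filt S ρ ∈ Cone G := by
  classical
  refine map_mem_cone (fun v hv => ?_) hρ
  have : filt S (pure v) = pure (v.filter (· ∈ S)) := by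
    rw [pure_eq_sum, pure_eq_sum, Finsupp.support_filter, Finset.sum_filter, map_sum]
    refine Finset.sum_congr rfl fun c _ => ?_
    rw [Finset.sum_filter, map_sum]
    split_ifs with h
    · refine Finset.sum_congr rfl fun c' _ => ?_
      rw [map_smul, filt_single]
      by_cases h' : c' ∈ S
      · rw [if_pos ⟨h, h'⟩, if_pos h', Finsupp.filter_apply_pos _ _ h, Finsupp.filter_apply_pos _ _ h']
      · rw [if_neg fun h'' => h' h''.2, if_neg h', smul_zero]
    · refine Finset.sum_eq_zero fun c' _ => ?_
      rw [map_smul, filt_single, if_neg fun h'' => h h''.1, smul_zero]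
  rw [this]
  refine pure_mem_cone fun c hc => hv c ?_
  rw [Finsupp.support_filter, Finset.mem_filter] at hc
  exact hc.1

/-- Whether a basis state is kept depends on its retained part alone, so conditioning on an outcome
in a subsystem may be done before or after the partial trace. -/
theorem restrict_filt (f : V → W) (S : Set (Conf V)) (ρ : Dens W) :
    restrict f (filt {c | c ∘ f ∈ S} ρ) = filt S (restrict f ρ) := by
  classical
  suffices h : restrict f ∘ₗ filt {c | c ∘ f ∈ S} = filt S ∘ₗ restrict f from
    LinearMap.congr_fun h ρ
  refine hom_ext fun c c' => ?_
  simp only [LinearMap.comp_apply, filt_single, restrict_single, Set.mem_ofPred_eq]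
  rw [apply_ite (restrict f), apply_ite (filt S), map_zero, map_zero, restrict_single, filt_single]
  split_ifs <;> rfl

/-! ### Probabilities -/

open Classical in
/-- The weight of the basis states in `S`. -/
noncomputable def weight (S : Set (Conf W)) : Dens W →ₗ[ℂ] ℂ :=
  Finsupp.linearCombination ℂ fun cc => if cc.1 = cc.2 ∧ cc.1 ∈ S then 1 else 0

theorem probOne_eq (q : W) (ρ : Dens W) : probOne q ρ = (weight {c | c q = true} ρ).re := by
  classical
  rw [probOne, weight, Finsupp.linearCombination_apply]
  congr 1
  refine Finset.sum_congr rfl fun cc _ => ?_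
  simp only [smul_eq_mul, mul_ite, mul_one, mul_zero]
  exact if_congr Iff.rfl rfl rfl

theorem trace_eq (ρ : Dens W) : trace ρ = weight Set.univ ρ := by
  classical
  rw [trace, weight, Finsupp.linearCombination_apply]
  refine Finset.sum_congr rfl fun cc _ => ?_
  simp only [smul_eq_mul, mul_ite, mul_one, mul_zero]
  exact if_congr (by simp) rfl rfl

theorem weight_single (S : Set (Conf W)) (c c' : Conf W) (z : ℂ) [Decidable (c = c' ∧ c ∈ S)] :
    weight S (Finsupp.single (c, c') z) = if c = c' ∧ c ∈ S then z else 0 := by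
  rw [weight, Finsupp.linearCombination_single]
  simp

theorem weight_pure (S : Set (Conf W)) (v : Conf W →₀ ℂ) [DecidablePred (· ∈ S)] :
    weight S (pure v) = ∑ c ∈ v.support with c ∈ S, ((‖v c‖ ^ 2 : ℝ) : ℂ) := by
  classical
  rw [pure_eq_sum, map_sum, Finset.sum_filter]
  refine Finset.sum_congr rfl fun c hc => ?_
  rw [map_sum, Finset.sum_eq_single c]
  · rw [map_smul, weight_single]
    by_cases h : c ∈ S
    · rw [if_pos ⟨rfl, h⟩, if_pos h, smul_eq_mul, mul_one]
      simp [Complex.mul_conj, Complex.normSq_eq_norm_sq]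
    · rw [if_neg fun h' => h h'.2, if_neg h, smul_zero]
  · intro c' _ hc'
    rw [map_smul, weight_single, if_neg fun h' => hc' h'.1.symm, smul_zero]
  · exact fun h => absurd hc h

open ComplexOrder in
theorem weight_nonneg (S : Set (Conf W)) {G : Set (Conf W)} {ρ : Dens W} (hρ : ρ ∈ Cone G) :
    0 ≤ weight S ρ := by
  classical
  induction hρ using AddSubmonoid.closure_induction with
  | mem x hx =>
    obtain ⟨v, -, rfl⟩ := hx
    rw [weight_pure]
    exact Finset.sum_nonneg fun c _ => Complex.zero_le_real.2 (sq_nonneg _)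
  | zero => rw [map_zero]
  | add x y _ _ hx hy => rw [map_add]; exact add_nonneg hx hy

open ComplexOrder in
theorem weight_le_trace (S : Set (Conf W)) {G : Set (Conf W)} {ρ : Dens W} (hρ : ρ ∈ Cone G) :
    weight S ρ ≤ trace ρ := by
  classical
  rw [trace_eq]
  induction hρ using AddSubmonoid.closure_induction with
  | mem x hx =>
    obtain ⟨v, -, rfl⟩ := hx
    simp only [weight_pure]
    exact Finset.sum_le_sum_of_subset_of_nonneg (fun c hc => by
      rw [Finset.mem_filter] at *; exact ⟨hc.1, trivial⟩)
      fun c _ _ => Complex.zero_le_real.2 (sq_nonneg _)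
  | zero => rw [map_zero, map_zero]
  | add x y _ _ hx hy => rw [map_add, map_add]; exact add_le_add hx hy

theorem trace_restrict (f : V → W) (ρ : Dens W) : trace (restrict f ρ) = trace ρ := by
  classical
  rw [trace_eq, trace_eq]
  suffices h : weight Set.univ ∘ₗ restrict f = weight Set.univ from LinearMap.congr_fun h ρ
  refine hom_ext fun c c' => ?_
  simp only [LinearMap.comp_apply, restrict_single, weight_single, Set.mem_univ, and_true]
  by_cases h : c = c'
  · subst h
    rw [if_pos fun _ _ => rfl, weight_single, if_pos ⟨rfl, trivial⟩, if_pos rfl]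
  · rw [if_neg h]
    split_ifs with h'
    · rw [weight_single, if_neg]
      rintro ⟨h'', -⟩
      refine h (funext fun q => ?_)
      by_cases hq : q ∈ Set.range f
      · obtain ⟨a, rfl⟩ := hq
        exact congrFun h'' a
      · exact h' q hq
    · exact map_zero _

theorem trace_run (l : List (QOp W)) (ρ : Dens W) : trace (run l ρ) = trace ρ := by
  -- The trace is the reduction to no qubits at all, and every operation is disjoint from the empty
  -- set of qubits.
  rw [← trace_restrict (Empty.elim : Empty → W), restrict_run_of_disjoint, trace_restrict]
  exact fun o _ => QOp.actsOn_iff.2 fun w _ => by simp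

theorem trace_vacuum : trace (vacuum : Dens W) = 1 := by
  classical
  rw [trace_eq, vacuum, weight_single, if_pos ⟨rfl, trivial⟩]

theorem trace_extend (f : V ↪ W) (ρ : Dens V) : trace (extend f ρ) = trace ρ := by
  rw [← trace_restrict f, restrict_extend_self]

theorem weight_extend (f : V ↪ W) (q : V) (ρ : Dens V) :
    weight {c | c (f q) = true} (extend f ρ) = weight {c | c q = true} ρ := by
  classical
  suffices h : weight {c | c (f q) = true} ∘ₗ extend f = weight {c | c q = true} from
    LinearMap.congr_fun h ρ
  refine hom_ext fun c c' => ?_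
  have hinj : Function.Injective fun c : Conf V => Function.extend f c fun _ => false := by
    intro c c' hcc
    funext a
    have := congrFun hcc (f a)
    simpa only [f.injective.extend_apply] using this
  simp only [LinearMap.comp_apply, extend_single, weight_single]
  refine if_congr ?_ rfl rfl
  rw [Set.mem_ofPred_eq, Set.mem_ofPred_eq, f.injective.extend_apply]
  exact and_congr_left' hinj.eq_iff

theorem probOne_extend (f : V ↪ W) (q : V) (ρ : Dens V) :
    probOne (f q) (extend f ρ) = probOne q ρ := by
  rw [probOne_eq, probOne_eq, weight_extend]

/-- A state is the sum of its projections if the measured qubits are classical. -/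
theorem sum_project_eq {K : Finset W} {ρ : Dens W} (h : ∀ q ∈ K, Diag q ρ) :
    ∑ z ∈ K.powerset, project K z ρ = ρ := by
  classical
  have : (∑ z ∈ K.powerset, project K z) ρ = ρ := by
    refine eq_of_forall_support ?_
    rintro ⟨c, c'⟩ hcc
    -- A basis state is kept by exactly one outcome, the set of its own ones in `K`.
    rw [LinearMap.sum_apply, Finset.sum_eq_single (K.filter fun q => c q = true)]
    · rw [project_eq_filt, filt_single, if_pos]
      refine ⟨fun q hq => by simp [hq], fun q hq => ?_⟩
      have : c q = c' q := h q hq _ hcc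
      simp [hq, this]
    · intro z hz hne
      rw [project_eq_filt, filt_single, if_neg]
      rintro ⟨h1, -⟩
      refine hne (Finset.ext fun q => ?_)
      rw [Finset.mem_filter]
      constructor
      · intro hq
        have := Finset.mem_powerset.1 hz hq
        exact ⟨this, (h1 q this).2 hq⟩
      · rintro ⟨h2, h3⟩
        exact (h1 q h2).1 h3
    · intro hn
      exact absurd (Finset.mem_powerset.2 (Finset.filter_subset _ _)) hn
  rwa [LinearMap.sum_apply] at this

end Dens

/-! ## Merging lists -/

section Merge

variable {α : Type*} {le : α → α → Bool}

theorem merge_append_left {l₁ l₂ l' : List α} (h : ∀ a ∈ l₁, ∀ b ∈ l', le a b = true) :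
    List.merge (l₁ ++ l₂) l' le = l₁ ++ List.merge l₂ l' le := by
  induction l₁ with
  | nil => rfl
  | cons a l₁ ih =>
    cases l' with
    | nil => simp [List.merge_right]
    | cons b l' =>
      rw [List.cons_append, List.cons_merge_cons,
        if_pos (h a List.mem_cons_self b List.mem_cons_self),
        ih fun a ha => h a (List.mem_cons_of_mem _ ha), List.cons_append]

theorem merge_append_right {l l₁' l₂' : List α} (h : ∀ a ∈ l, ∀ b ∈ l₁', ¬ le a b = true) :
    List.merge l (l₁' ++ l₂') le = l₁' ++ List.merge l l₂' le := by
  induction l₁' with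
  | nil => rfl
  | cons b l₁' ih =>
    cases l with
    | nil => simp [List.nil_merge]
    | cons a l =>
      rw [List.cons_append, List.cons_merge_cons,
        if_neg (h a List.mem_cons_self b List.mem_cons_self),
        ih fun a ha b hb => h a ha b (List.mem_cons_of_mem _ hb), List.cons_append]

/-- The hypotheses say that no element of the second parts may overtake one of the first parts, so
the merge splits at the cut. -/
theorem merge_append_append {l₁ l₂ l₁' l₂' : List α} (h : ∀ a ∈ l₁, ∀ b ∈ l₂', le a b = true)
    (h' : ∀ a ∈ l₂, ∀ b ∈ l₁', ¬ le a b = true) :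
    List.merge (l₁ ++ l₂) (l₁' ++ l₂') le = List.merge l₁ l₁' le ++ List.merge l₂ l₂' le := by
  induction l₁ generalizing l₁' with
  | nil => rw [List.nil_append, List.nil_merge, merge_append_right h']
  | cons a l₁ ih =>
    have ha := fun b hb => h a List.mem_cons_self b hb
    have ih' := fun l₁' h' => ih (l₁' := l₁')
      (fun a ha b hb => h a (List.mem_cons_of_mem _ ha) b hb) h'
    induction l₁' with
    | nil =>
      rw [List.nil_append, List.merge_right]
      exact merge_append_left h
    | cons b l₁' ihb =>
      rw [List.cons_append, List.cons_append, List.cons_merge_cons, List.cons_merge_cons]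
      split_ifs with hab
      · have := ih' (b :: l₁') h'
        rw [List.cons_append] at this
        rw [this, List.cons_append]
      · have := ihb (fun a ha b hb => h' a ha b (List.mem_cons_of_mem _ hb))
        rw [List.cons_append] at this
        rw [this, List.cons_append]

/-- The part of a merge that follows an element of the first list. -/
theorem merge_append_cons (l : List α) (x : α) (l₂ l' : List α) :
    ∃ m₁ m₂, List.merge (l ++ x :: l₂) l' le = m₁ ++ x :: m₂ ∧ ∀ y ∈ m₂, y ∈ l₂ ∨ y ∈ l' := by
  induction l generalizing l' with
  | nil =>
    induction l' with
    | nil => exact ⟨[], l₂, by simp [List.merge_right], fun y hy => Or.inl hy⟩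
    | cons b l' ih =>
      rw [List.nil_append, List.cons_merge_cons]
      split_ifs with h
      · exact ⟨[], _, rfl, fun y hy => by simpa [List.mem_merge] using hy⟩
      · obtain ⟨m₁, m₂, e, hm⟩ := ih
        rw [List.nil_append] at e
        exact ⟨b :: m₁, m₂, by rw [e, List.cons_append],
          fun y hy => (hm y hy).imp_right (List.mem_cons_of_mem _)⟩
  | cons a l ih =>
    induction l' with
    | nil =>
      refine ⟨a :: l, l₂, by simp [List.merge_right], fun y hy => Or.inl hy⟩
    | cons b l' ihb =>
      rw [List.cons_append, List.cons_merge_cons]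
      split_ifs with h
      · obtain ⟨m₁, m₂, e, hm⟩ := ih (b :: l')
        exact ⟨a :: m₁, m₂, by rw [e, List.cons_append], hm⟩
      · obtain ⟨m₁, m₂, e, hm⟩ := ihb
        rw [List.cons_append] at e
        exact ⟨b :: m₁, m₂, by rw [e, List.cons_append],
          fun y hy => (hm y hy).imp_right (List.mem_cons_of_mem _)⟩

end Merge

/-! ### Cutting interactions at a time -/

section Interact

variable {d : ℕ}

/-- Events at time τ itself belong to the first phase on both sides, so the precedence of verifiers
at equal times does no harm. -/
theorem interact_append {l₁ l₂ l₁' l₂' : List (PartyEvent d)} {τ : ℝ} (h₁ : ∀ e ∈ l₁, e.time ≤ τ)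
    (h₂ : ∀ e ∈ l₂, τ < e.time) (h₁' : ∀ e ∈ l₁', e.time ≤ τ) (h₂' : ∀ e ∈ l₂', τ < e.time) :
    interact (l₁ ++ l₂) (l₁' ++ l₂') = interact l₁ l₁' ++ interact l₂ l₂' := by
  rw [interact, merge_append_append, List.map_append]; rfl
  · exact fun a ha b hb => decide_eq_true ((h₁ a ha).trans (h₂' b hb).le)
  · exact fun a ha b hb => fun h =>
      absurd (of_decide_eq_true h) (not_le.2 ((h₁' b hb).trans_lt (h₂ a ha)))

theorem interact_append_right {l l₁' l₂' : List (PartyEvent d)}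
    (h : ∀ a ∈ l, ∀ b ∈ l₁', b.time < a.time) :
    interact l (l₁' ++ l₂') = l₁'.map PartyEvent.op ++ interact l l₂' := by
  rw [interact, merge_append_right, List.map_append]; rfl
  exact fun a ha b hb => fun h' => absurd (of_decide_eq_true h') (not_le.2 (h a ha b hb))

theorem interact_append_left {l₁ l₂ l' : List (PartyEvent d)}
    (h : ∀ a ∈ l₁, ∀ b ∈ l', a.time ≤ b.time) :
    interact (l₁ ++ l₂) l' = l₁.map PartyEvent.op ++ interact l₂ l' := by
  rw [interact, merge_append_left, List.map_append]; rfl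
  exact fun a ha b hb => decide_eq_true (h a ha b hb)

theorem interact_nil_right (l : List (PartyEvent d)) : interact l [] = l.map PartyEvent.op := by
  rw [interact, List.merge_right]

theorem mem_interact {l l' : List (PartyEvent d)} {o : QOp (Wire d)} :
    o ∈ interact l l' ↔ (∃ e ∈ l, e.op = o) ∨ ∃ e ∈ l', e.op = o := by
  simp only [interact, List.mem_map, List.mem_merge, or_and_right, exists_or]

/-- The events after time `τ`. -/
noncomputable def eventsAfter (τ : ℝ) (l : List (PartyEvent d)) : List (PartyEvent d) :=
  l.filter fun e => decide (τ < e.time)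

theorem mem_eventsUntil {τ : ℝ} {l : List (PartyEvent d)} {e : PartyEvent d} :
    e ∈ eventsUntil τ l ↔ e ∈ l ∧ e.time ≤ τ := by
  simp [eventsUntil]

theorem mem_eventsAfter {τ : ℝ} {l : List (PartyEvent d)} {e : PartyEvent d} :
    e ∈ eventsAfter τ l ↔ e ∈ l ∧ τ < e.time := by
  simp [eventsAfter]

theorem eventsUntil_eq_self {τ : ℝ} {l : List (PartyEvent d)} (h : ∀ e ∈ l, e.time ≤ τ) :
    eventsUntil τ l = l :=
  List.filter_eq_self.2 fun e he => decide_eq_true (h e he)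

theorem eventsUntil_append_eventsAfter {τ : ℝ} {l : List (PartyEvent d)}
    (h : l.Pairwise fun a b => a.time ≤ b.time) : eventsUntil τ l ++ eventsAfter τ l = l := by
  induction l with
  | nil => rfl
  | cons e l ih =>
    rw [List.pairwise_cons] at h
    have ih := ih h.2
    by_cases he : e.time ≤ τ
    · have h1 : eventsUntil τ (e :: l) = e :: eventsUntil τ l :=
        List.filter_cons_of_pos (decide_eq_true he)
      have h2 : eventsAfter τ (e :: l) = eventsAfter τ l :=
        List.filter_cons_of_neg (by simpa using he)
      rw [h1, h2, List.cons_append, ih]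
    · have h1 : eventsUntil τ (e :: l) = [] := by
        refine List.filter_eq_nil_iff.2 fun a ha => ?_
        rw [decide_eq_true_iff]
        rcases List.mem_cons.1 ha with rfl | ha
        · exact he
        · exact fun h' => he ((h.1 a ha).trans h')
      have h2 : eventsAfter τ (e :: l) = e :: l := by
        refine List.filter_eq_self.2 fun a ha => decide_eq_true ?_
        rcases List.mem_cons.1 ha with rfl | ha
        · exact not_le.1 he
        · exact (not_le.1 he).trans_le (h.1 a ha)
      rw [h1, h2, List.nil_append]

end Interact

/-! ## Reachable qubits -/

/-- The qubits that can differ from `|0⟩` at time `τ`, when there are `k` provers. -/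
def Wire.Reachable {d : ℕ} (k : ℕ) (τ : ℝ) : Wire d → Prop
  | mem Side.verifier _ _ => True
  | mem Side.prover i _ => i < k
  | ray _ u _ => ‖u‖ = 1
  | bcast x _ => x.2 ≤ τ

section Reach

variable {d : ℕ}

theorem Wire.AccessibleAt.reachable {s : Side} {i k : ℕ} {x : SpacetimePoint d} {τ : ℝ}
    (hi : s = Side.prover → i < k) {w : Wire d} (h : Wire.AccessibleAt s i x w) :
    Wire.Reachable k τ w := by
  cases w with
  | mem s' i' j =>
    obtain ⟨rfl, rfl⟩ := h
    cases s'
    · trivial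
    · exact hi rfl
  | ray b u e => exact h.1
  | bcast y e => exact h.elim

/-- A broadcast can be touched only at its emission or strictly after it, so by time τ no broadcast
from a later point can have left the state |0⟩. -/
theorem QOp.LocalAt.actsOn_reachable {s : Side} {i k : ℕ} {x : SpacetimePoint d} {τ : ℝ}
    (hi : s = Side.prover → i < k) (hx : x.2 ≤ τ) {o : QOp (Wire d)} (h : o.LocalAt s i x) :
    o.ActsOn (Wire.Reachable k τ) := by
  rcases h with h | ⟨a, e, rfl, ha⟩ | ⟨y, e, b, rfl, hy, hb⟩
  · exact h.mono fun w => Wire.AccessibleAt.reachable hi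
  · exact ⟨ha.reachable hi, hx⟩
  · exact ⟨hy.1.le.trans hx, hb.reachable hi⟩

theorem IsProgram.actsOn_reachable {s : Side} {m k : ℕ} {loc : ℕ → ℝ → Space d} {τ : ℝ}
    (hm : s = Side.prover → m ≤ k) {l : List (PartyEvent d)} (h : IsProgram s m loc l)
    {e : PartyEvent d} (he : e ∈ l) (hτ : e.time ≤ τ) :
    e.op.ActsOn (Wire.Reachable k τ) :=
  (h.located e he).2.actsOn_reachable (fun hs => (h.located e he).1.trans_le (hm hs)) hτ

theorem inMemory_reachable {s : Side} {m k : ℕ} {τ : ℝ} (hm : s = Side.prover → m ≤ k)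
    {w : Wire d} (h : Wire.InMemory s m w) : Wire.Reachable k τ w := by
  obtain ⟨i, j, hi, rfl⟩ := h
  cases s
  · trivial
  · exact hi.trans_le (hm rfl)

/-- The memory qubits of the verifiers, as an embedding. -/
def verifierEmb (d : ℕ) : ℕ × ℕ ↪ Wire d :=
  ⟨verifierMem d, fun p q h => by
    simp only [verifierMem, Wire.mem.injEq] at h
    exact Prod.ext h.2.1 h.2.2⟩

theorem not_mem_range_of_prover {i : ℕ} {x : SpacetimePoint d} {o : QOp (Wire d)}
    (h : o.LocalAt Side.prover i x) : o.ActsOn fun w => w ∉ Set.range (verifierMem d) := by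
  have key : ∀ w : Wire d, Wire.AccessibleAt Side.prover i x w → w ∉ Set.range (verifierMem d) := by
    rintro _ hw ⟨q, rfl⟩
    exact absurd hw.1 (by simp)
  rcases h with h | ⟨a, e, rfl, ha⟩ | ⟨y, e, b, rfl, hy, hb⟩
  · exact h.mono key
  · exact ⟨key _ ha, by rintro ⟨q, hq⟩; simp [verifierMem] at hq⟩
  · exact ⟨by rintro ⟨q, hq⟩; simp [verifierMem] at hq, key _ hb⟩

/-- A broadcast qubit is not accessible; parties only copy into it or out of it, and copying
measures. Broadcasts therefore stay classical whatever the parties do. -/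
theorem bcast_diag_of_local {s : Side} {i : ℕ} {x y : SpacetimePoint d} {e : ℕ}
    {o : QOp (Wire d)} (h : o.LocalAt s i x) {ρ : Dens (Wire d)}
    (hρ : Dens.Diag (Wire.bcast y e) ρ) : Dens.Diag (Wire.bcast y e) (o.apply ρ) := by
  rcases h with h | ⟨a, e, rfl, ha⟩ | ⟨y, e, b, rfl, hy, hb⟩
  · exact hρ.apply_of_not_mem fun hw => (QOp.actsOn_iff.1 h (Wire.bcast y e) hw : False)
  · exact hρ.apply_copy
  · exact hρ.apply_copy

end Reach

/-! ## Preparing a basis state from scratch -/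

namespace QOp

variable {W : Type}

/-- Flip a qubit. -/
noncomputable def flip (q : W) : QOp W :=
  channel (one q) (QChannel.ofFun (fun _ => true) (fun y i => !y i) (fun y y' _ h => by
    funext i
    simpa using congrFun h i))

theorem apply_flip [DecidableEq W] (q : W) (c c' : Conf W) :
    (flip q).apply (Finsupp.single (c, c') 1) =
      Finsupp.single (Function.update c q (!c q), Function.update c' q (!c' q)) 1 := by
  rw [apply_unit, flip, onUnit_ofFun_eq (one q) _ _ _ c c' (p := true) (q := true) rfl rfl
    (extend_one _ _ _) (extend_one _ _ _)]
  rfl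

theorem apply_copy_of_eq [DecidableEq W] {a b : W} {c c' : Conf W} (h : c a = c' a) :
    (copy a b).apply (Finsupp.single (c, c') 1) = Finsupp.single
      (Function.update c b (xor (c b) (c a)), Function.update c' b (xor (c' b) (c' a))) 1 := by
  rw [apply_unit]
  simp only [onUnit, if_pos h]
  congr!

end QOp

/-! ### Positive functionals and product states -/

namespace Dens

variable {W V : Type}

open Classical in
/-- Put a state on the qubits `f q`, and set exactly the qubits in `z` among the others. -/
noncomputable def plant (f : V → W) (z : Finset W) : Dens V →ₗ[ℂ] Dens W :=
  Finsupp.lmapDomain ℂ ℂ fun cc => (Function.extend f cc.1 (fun w => decide (w ∈ z)),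
    Function.extend f cc.2 (fun w => decide (w ∈ z)))

theorem plant_pure (f : V → W) (z : Finset W) [DecidableEq W] (v : Conf V →₀ ℂ) :
    plant f z (pure v) = pure (Finsupp.mapDomain
      (fun c => Function.extend f c (fun w => decide (w ∈ z))) v) := by
  rw [← mapDomain_pure, plant, Finsupp.lmapDomain_apply]
  congr!

open ComplexOrder in
/-- A positive functional that vanishes on all products of the reduced state with basis states
vanishes. -/
theorem eq_zero_of_plant {F : Dens W →ₗ[ℂ] ℂ} (hF : ∀ ρ ∈ Cone (Set.univ : Set (Conf W)), 0 ≤ F ρ)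
    {A : W → Prop} {f : V ↪ W} {σ : Dens W} (hσ : σ ∈ Cone (finConf A))
    (h : ∀ z : Finset W, (∀ w ∈ z, A w ∧ w ∉ Set.range f) → F (plant f z (restrict f σ)) = 0) :
    F σ = 0 := by
  classical
  have hplant : ∀ z, ∀ ρ ∈ Cone (Set.univ : Set (Conf V)), 0 ≤ F (plant f z ρ) := fun z ρ hρ =>
    hF _ (map_mem_cone (fun v _ => by rw [plant_pure]; exact pure_mem_cone fun _ _ => trivial) hρ)
  have hrestrict : ∀ σ ∈ Cone (finConf A), restrict f σ ∈ Cone (Set.univ : Set (Conf V)) :=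
    fun σ hσ => cone_mono (Set.subset_univ _) (restrict_mem_cone f hσ)
  induction hσ using AddSubmonoid.closure_induction with
  | zero => exact map_zero _
  | add x y hx hy ihx ihy =>
    -- Every summand of a positive operator contributes a nonnegative amount, so the hypothesis
    -- passes to both.
    have key : ∀ z : Finset W, (∀ w ∈ z, A w ∧ w ∉ Set.range f) →
        F (plant f z (restrict f x)) = 0 ∧ F (plant f z (restrict f y)) = 0 := by
      intro z hz
      have := h z hz
      rw [map_add, map_add, map_add] at this
      exact (add_eq_zero_iff_of_nonneg (hplant z _ (hrestrict x hx))
        (hplant z _ (hrestrict y hy))).1 this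
    rw [map_add, ihx fun z hz => (key z hz).1, ihy fun z hz => (key z hz).2, add_zero]
  | mem x hx =>
    obtain ⟨v, hv, rfl⟩ := hx
    have hpure : ∀ u : Conf W →₀ ℂ, 0 ≤ F (pure u) := fun u =>
      hF _ (pure_mem_cone fun _ _ => trivial)
    have hadd : ∀ u w : Conf W →₀ ℂ, F (pure u) = 0 → F (pure w) = 0 → F (pure (u + w)) = 0 := by
      intro u w hu hw
      -- The values at u + w and at u - w are nonnegative and add up to zero.
      have := congrArg F (pure_add_add_pure_sub u w)
      simp only [map_add, hu, hw, add_zero] at this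
      exact ((add_eq_zero_iff_of_nonneg (hpure _) (hpure _)).1 this).1
    have hsum : v = ∑ e ∈ v.support.image (envConf f), v.filter fun c => envConf f c = e := by
      ext c
      rw [Finsupp.coe_finsetSum, Finset.sum_apply]
      simp only [Finsupp.filter_apply]
      rw [Finset.sum_ite_eq]
      split_ifs with hc
      · rfl
      · by_contra hne
        exact hc (Finset.mem_image_of_mem _ (Finsupp.mem_support_iff.2 hne))
    rw [hsum]
    refine Finset.sum_induction _ (fun u => F (pure u) = 0) hadd ?_ ?_
    · have : pure (0 : Conf W →₀ ℂ) = 0 := by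
        ext ⟨c, c'⟩; simp [pure_apply]
      rw [this, map_zero]
    · intro e he
      obtain ⟨c₀, hc₀, rfl⟩ := Finset.mem_image.1 he
      obtain ⟨h1, h2⟩ := hv c₀ hc₀
      -- The basis state to be planted is the environment configuration of this component; it has
      -- finitely many ones, so it is given by a finite set.
      have hfin : {w | envConf f c₀ w = true}.Finite := h2.subset fun w hw => by
        have hw : envConf f c₀ w = true := hw
        simp only [envConf] at hw
        split_ifs at hw
        exact hw
      have hmem : ∀ w, w ∈ hfin.toFinset ↔ (w ∉ Set.range f ∧ c₀ w = true) := by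
        intro w
        rw [Set.Finite.mem_toFinset, Set.mem_ofPred_eq, envConf]
        split_ifs with hw <;> simp [hw]
      have hz := h hfin.toFinset fun w hw => by
        rw [hmem] at hw
        refine ⟨by_contra fun hA => ?_, hw.1⟩
        rw [h1 w hA] at hw
        exact absurd hw.2 (by simp)
      rw [restrict_pure, map_sum, map_sum] at hz
      -- Of the product state, only the summand that belongs to the planted configuration is needed:
      -- putting that configuration back restores the component itself.
      have hz' := (Finset.sum_eq_zero_iff_of_nonneg (fun e _ => by
        rw [plant_pure]
        exact hpure _)).1 hz _ (Finset.mem_image_of_mem _ hc₀)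
      rw [plant_pure, ← Finsupp.mapDomain_comp] at hz'
      convert hz' using 3
      conv_lhs => rw [← Finsupp.mapDomain_id (v := v.filter fun c => envConf f c = envConf f c₀)]
      refine Finsupp.mapDomain_congr fun c hc => ?_
      rw [Finsupp.support_filter, Finset.mem_filter, envConf_eq_iff] at hc
      funext w
      simp only [id, Function.comp_apply]
      by_cases hw : w ∈ Set.range f
      · obtain ⟨q, rfl⟩ := hw
        rw [f.injective.extend_apply]; rfl
      · rw [Function.extend_apply' (f := f) _ _ _ hw, hc.2 w hw, Bool.eq_iff_iff]
        simp only [decide_eq_true_eq, hmem]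
        exact ⟨fun h => ⟨hw, h⟩, fun h => h.2⟩

end Dens

/-! ### Fresh coalitions that set chosen qubits -/

section Setup

variable {d : ℕ}

/-- Setting the qubit `w` to `1`; a broadcast is emitted from the auxiliary memory qubit `h`. -/
noncomputable def setupOps (h : Wire d) : Wire d → List (QOp (Wire d))
  | Wire.bcast x e => [QOp.flip h, QOp.copy h (Wire.bcast x e), QOp.flip h]
  | w => [QOp.flip w]

/-- The time at which the qubit `w` is set. -/
def setupTime (τ : ℝ) : Wire d → ℝ
  | Wire.bcast x _ => x.2
  | _ => τ

/-- The place at which the qubit `w` is set. -/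
noncomputable def setupPos (τ : ℝ) : Wire d → Space d
  | Wire.bcast x _ => x.1
  | Wire.ray b u _ => b + τ • u
  | Wire.mem _ _ _ => 0

/-- The party that sets the qubit `w`. -/
def setupParty (m : ℕ) : Wire d → ℕ
  | Wire.mem _ i _ => i
  | _ => m

open Classical in
/-- The events that set the qubits in the list `zs`; the helpers are the parties from `k` on. -/
noncomputable def setupEvents (k : ℕ) (τ : ℝ) (zs : List (Wire d)) : List (PartyEvent d) :=
  zs.flatMap fun w => (setupOps (Wire.mem Side.prover (k + zs.idxOf w) 0) w).map fun o =>
    ⟨setupParty (k + zs.idxOf w) w, setupTime τ w, o⟩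

open Classical in
theorem run_setupOps {h w : Wire d} (hne : h ≠ w) {c c' : Conf (Wire d)} (hc : c h = false)
    (hc' : c' h = false) (hw : c w = false) (hw' : c' w = false) :
    Dens.run (setupOps h w) (Finsupp.single (c, c') 1) =
      Finsupp.single (Function.update c w true, Function.update c' w true) 1 := by
  have h1 : Dens.run [QOp.flip w] (Finsupp.single (c, c') 1) =
      Finsupp.single (Function.update c w true, Function.update c' w true) 1 := by
    rw [Dens.run_cons, Dens.run_nil, QOp.apply_flip, hw, hw']; rfl
  cases w with
  | mem s i j => exact h1
  | ray b u e => exact h1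
  | bcast x e =>
    -- The auxiliary qubit is raised, copied into the broadcast and lowered again, so only the
    -- broadcast remains changed.
    have key : ∀ c : Conf (Wire d), c h = false →
        Function.update (Function.update (Function.update c h true) (Wire.bcast x e) true) h false =
          Function.update c (Wire.bcast x e) true := by
      intro c hc
      rw [Function.update_comm hne, Function.update_idem]
      rw [Function.update_comm hne.symm, ← hc, Function.update_eq_self]
    simp only [setupOps, Dens.run_cons, Dens.run_nil]
    rw [QOp.apply_flip, QOp.apply_copy_of_eq (by simp [hc, hc']), QOp.apply_flip]
    simp only [Function.update_self, hc, hc', Function.update_of_ne hne.symm, hw, hw',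
      Function.update_of_ne hne, Bool.not_false, Bool.not_true, Bool.xor_true]
    rw [key c hc, key c' hc']

open Classical in
-- The helpers' auxiliary qubits start at 0, return to 0 and are not among the qubits to be set, so
-- the blocks do not interfere.
theorem run_setup_list {k : ℕ} {g : Wire d → ℕ} {zs : List (Wire d)} (hnd : zs.Nodup)
    (hz : ∀ w ∈ zs, ∀ w', w ≠ Wire.mem Side.prover (k + w') 0) {c c' : Conf (Wire d)}
    (hc : ∀ w, w ∈ zs ∨ (∃ m, w = Wire.mem Side.prover (k + m) 0) → c w = false ∧ c' w = false) :
    Dens.run (zs.flatMap fun w => setupOps (Wire.mem Side.prover (k + g w) 0) w)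
      (Finsupp.single (c, c') 1) =
      Finsupp.single (fun w => if w ∈ zs then true else c w, fun w => if w ∈ zs then true else c' w)
        1 := by
  induction zs generalizing c c' with
  | nil => simp [Dens.run_nil]
  | cons w zs ih =>
    rw [List.nodup_cons] at hnd
    have hw := hc w (Or.inl List.mem_cons_self)
    have hh := hc (Wire.mem Side.prover (k + g w) 0) (Or.inr ⟨_, rfl⟩)
    rw [List.flatMap_cons, Dens.run_append, run_setupOps (hz w List.mem_cons_self _).symm hh.1 hh.2
      hw.1 hw.2, ih hnd.2 (fun w hw => hz w (List.mem_cons_of_mem _ hw))]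
    · have key : ∀ c : Conf (Wire d),
          (fun p => if p ∈ zs then true else Function.update c w true p) =
          fun p => if p ∈ w :: zs then true else c p := by
        intro c
        funext p
        by_cases hp : p = w
        · subst hp; simp
        · simp [hp]
      rw [key, key]
    · intro p hp
      have hne : p ≠ w := by
        rintro rfl
        rcases hp with hp | ⟨m, rfl⟩
        · exact hnd.1 hp
        · exact hz _ List.mem_cons_self m rfl
      rw [Function.update_of_ne hne, Function.update_of_ne hne]
      exact hc p (hp.imp_left (List.mem_cons_of_mem _))

open Classical in
theorem run_setupEvents {k : ℕ} {τ : ℝ} {zs : List (Wire d)} (hnd : zs.Nodup)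
    (hz : ∀ w ∈ zs, Wire.Reachable k τ w ∧ w ∉ Set.range (verifierEmb d))
    (ρ : Dens (ℕ × ℕ)) :
    Dens.run ((setupEvents k τ zs).map PartyEvent.op) (Dens.extend (verifierMem d) ρ) =
      Dens.plant (verifierEmb d) zs.toFinset ρ := by
  suffices h : Dens.runHom ((setupEvents k τ zs).map PartyEvent.op) ∘ₗ
      Dens.extend (verifierMem d) = Dens.plant (verifierEmb d) zs.toFinset from
    LinearMap.congr_fun h ρ
  refine Dens.hom_ext fun c c' => ?_
  have e : (setupEvents k τ zs).map PartyEvent.op = zs.flatMap fun w =>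
      setupOps (Wire.mem Side.prover (k + zs.idxOf w) 0) w := by
    simp only [setupEvents, List.map_flatMap, List.map_map]
    congr 1
    funext w
    exact List.map_id _
  have hext : ∀ (c : Conf (ℕ × ℕ)) (w : Wire d), w ∉ Set.range (verifierEmb d) →
      Function.extend (verifierMem d) c (fun _ => false) w = false := fun c w hw =>
    Function.extend_apply' _ _ _ hw
  have key : ∀ c : Conf (ℕ × ℕ), (fun w : Wire d => if w ∈ zs then true else
      Function.extend (verifierMem d) c (fun _ => false) w) =
      Function.extend (verifierEmb d) c (fun w => decide (w ∈ zs.toFinset)) := by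
    intro c
    funext w
    by_cases hw : w ∈ Set.range (verifierEmb d)
    · rw [if_neg fun h => (hz w h).2 hw]
      obtain ⟨q, rfl⟩ := hw
      rw [(verifierEmb d).injective.extend_apply]
      exact (verifierEmb d).injective.extend_apply _ _ _
    · rw [hext c w hw, Function.extend_apply' (f := verifierEmb d) _ _ _ hw]
      by_cases h : w ∈ zs <;> simp [h]
  rw [LinearMap.comp_apply, Dens.extend_single, Dens.runHom_apply, e, run_setup_list hnd]
  · rw [Dens.plant, Finsupp.lmapDomain_apply, Finsupp.mapDomain_single, key, key]
  · rintro w hw m rfl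
    have : k + m < k := (hz _ hw).1
    omega
  · intro w hw
    have : w ∉ Set.range (verifierEmb d) := by
      rcases hw with hw | ⟨m, rfl⟩
      · exact (hz w hw).2
      · rintro ⟨q, hq⟩
        change verifierMem d q = _ at hq
        simp [verifierMem] at hq
    exact ⟨hext c w this, hext c' w this⟩

open Classical in
/-- A coalition that sets the qubits `zs` and then goes on as a given program. -/
theorem exists_coalition {k : ℕ} (hk : 0 < k) {loc : ℕ → ℝ → Space d} {l : List (PartyEvent d)}
    (hl : IsProgram Side.prover k loc l) {τ : ℝ} (hlt : ∀ e ∈ l, τ < e.time) {zs : List (Wire d)}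
    (hs : zs.Pairwise fun a b => setupTime τ a ≤ setupTime τ b)
    (hz : ∀ w ∈ zs, Wire.Reachable k τ w ∧ w ∉ Set.range (verifierEmb d)) :
    ∃ A : Coalition d, A.prep = (fun _ => []) ∧ A.events = fun _ => setupEvents k τ zs ++ l := by
  have hev : ∀ e ∈ setupEvents k τ zs, ∃ w ∈ zs, e.time = setupTime τ w ∧
      e.who = setupParty (k + zs.idxOf w) w ∧
      e.op ∈ setupOps (Wire.mem Side.prover (k + zs.idxOf w) 0) w := by
    intro e he
    obtain ⟨w, hw, he⟩ := List.mem_flatMap.1 he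
    obtain ⟨o, ho, rfl⟩ := List.mem_map.1 he
    exact ⟨w, hw, rfl, rfl, ho⟩
  have hle : ∀ w ∈ zs, setupTime τ w ≤ τ := by
    intro w hw
    cases w with
    | bcast x e => exact (hz _ hw).1
    | mem s i j => exact le_rfl
    | ray b u e => exact le_rfl
  -- The first k parties keep their worldlines. Each helper rests forever where its own qubit has to
  -- be set: at the emission point of a broadcast, or where a ray is at time τ. The default entry of
  -- `getD` plays no role.
  let pos : ℕ → ℝ → Space d := fun i t => if i < k then loc i t else
    setupPos τ (zs.getD (i - k) (Wire.mem Side.prover 0 0))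
  have hpos : ∀ w ∈ zs, ∀ t, pos (k + zs.idxOf w) t = setupPos τ w := by
    intro w hw t
    have : k + zs.idxOf w - k = zs.idxOf w := by omega
    simp only [pos]
    rw [if_neg (by omega), this, List.getD_eq_getElem _ _ (List.idxOf_lt_length_iff.2 hw),
      List.getElem_idxOf]
  refine ⟨⟨k + zs.length, by omega, pos, fun _ => [], fun _ o ho => by simp at ho,
    fun _ => setupEvents k τ zs ++ l, fun _ => ⟨?_, ?_⟩⟩, rfl, rfl⟩
  · refine List.pairwise_append.2 ⟨?_, hl.sorted, ?_⟩
    · rw [setupEvents, List.pairwise_flatMap]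
      refine ⟨fun w _ => List.pairwise_map.2 (List.pairwise_of_forall fun _ _ => le_rfl),
        hs.imp fun h => ?_⟩
      intro x hx y hy
      obtain ⟨_, _, rfl⟩ := List.mem_map.1 hx
      obtain ⟨_, _, rfl⟩ := List.mem_map.1 hy
      exact h
    · intro a ha b hb
      obtain ⟨w, hw, h1, -⟩ := hev a ha
      exact (h1.le.trans (hle w hw)).trans (hlt b hb).le
  · intro e he
    rcases List.mem_append.1 he with he | he
    · obtain ⟨w, hw, h1, h2, h3⟩ := hev e he
      have hidx : zs.idxOf w < zs.length := List.idxOf_lt_length_iff.2 hw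
      have hp := hpos w hw
      obtain ⟨hr, hv⟩ := hz w hw
      rw [h1, h2]
      cases w with
      | mem s i j =>
        cases s with
        | verifier => exact absurd ⟨(i, j), rfl⟩ hv
        | prover =>
          refine ⟨(show i < k from hr).trans_le (by omega), Or.inl ?_⟩
          rw [List.mem_singleton.1 h3]
          exact fun _ => ⟨rfl, rfl⟩
      | ray b u e =>
        refine ⟨by simpa [setupParty] using hidx, Or.inl ?_⟩
        rw [List.mem_singleton.1 h3]
        exact fun _ => ⟨hr, hp _⟩
      | bcast x e =>
        refine ⟨by simpa [setupParty] using hidx, ?_⟩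
        simp only [setupOps, List.mem_cons, List.not_mem_nil, or_false] at h3
        simp only [setupParty, setupTime, hp]
        rcases h3 with h3 | h3 | h3 <;> rw [h3]
        · exact Or.inl fun _ => ⟨rfl, rfl⟩
        · exact Or.inr (Or.inl ⟨_, e, rfl, rfl, rfl⟩)
        · exact Or.inl fun _ => ⟨rfl, rfl⟩
    · obtain ⟨h1, h2⟩ := hl.located e he
      refine ⟨h1.trans_le (by omega), ?_⟩
      simp only [pos, if_pos h1]
      exact h2

end Setup

/-! ### Binding against provers entangled with the commitment state -/

namespace PositionCommitment

variable {d : ℕ}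

open ComplexOrder in
/-- If no coalition that starts afresh has a chance to open the commitment state, then neither has
one that shares the global state after the Commit phase. -/
theorem accept_eq_zero (C : PositionCommitment d) (α : SpacetimePoint d) (n : ℕ) {k : ℕ}
    (hk : 0 < k) {loc : ℕ → ℝ → Space d} {l : List (PartyEvent d)}
    (hl : IsProgram Side.prover k loc l) (hlt : ∀ e ∈ l, C.tFinal < e.time) {σ : Dens (Wire d)}
    (hσ : σ ∈ Dens.Cone (Dens.finConf (Wire.Reachable k C.tFinal)))
    (h : ∀ A, C.revealProb α A n
      ((Dens.trace σ)⁻¹ • Dens.restrict (verifierMem d) σ) = 0) :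
    Dens.weight {c | c (acceptWire d) = true}
      (Dens.run (C.verdict α n) (Dens.run (interact (C.reveal α n) l) σ)) = 0 := by
  classical
  have hcone : ∀ ρ ∈ Dens.Cone (Set.univ : Set (Conf (Wire d))),
      Dens.run (C.verdict α n) (Dens.run (interact (C.reveal α n) l) ρ) ∈
        Dens.Cone (Set.univ : Set (Conf (Wire d))) := fun ρ hρ =>
    Dens.run_mem_cone_univ _ (Dens.run_mem_cone_univ _ hρ)
  have hσ' := Dens.cone_mono (Set.subset_univ _) hσ
  have ht : 0 ≤ Dens.trace σ := by
    rw [Dens.trace_eq]; exact Dens.weight_nonneg _ hσ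
  -- An outcome of probability zero cannot be normalized, and the hypothesis is then useless;
  -- acceptance is bounded by the trace instead.
  by_cases ht0 : Dens.trace σ = 0
  · refine le_antisymm ?_ (Dens.weight_nonneg _ (hcone _ hσ'))
    refine (Dens.weight_le_trace _ (hcone _ hσ')).trans ?_
    rw [Dens.trace_run, Dens.trace_run, ht0]
  let F : Dens (Wire d) →ₗ[ℂ] ℂ := Dens.weight {c | c (acceptWire d) = true} ∘ₗ
    Dens.runHom (C.verdict α n) ∘ₗ Dens.runHom (interact (C.reveal α n) l)
  change F σ = 0
  have hF : ∀ ρ ∈ Dens.Cone (Set.univ : Set (Conf (Wire d))), 0 ≤ F ρ := fun ρ hρ =>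
    Dens.weight_nonneg _ (hcone ρ hρ)
  refine Dens.eq_zero_of_plant hF (f := verifierEmb d) hσ fun z hz => ?_
  let le : Wire d → Wire d → Bool := fun a b => decide (setupTime C.tFinal a ≤ setupTime C.tFinal b)
  -- Broadcasts have to be emitted at their own times, so the qubits are set in chronological order.
  let zs := z.toList.mergeSort le
  have hperm : zs.Perm z.toList := List.mergeSort_perm _ _
  have hmem : ∀ w, w ∈ zs ↔ w ∈ z := fun w => by rw [hperm.mem_iff, Finset.mem_toList]
  have hs : zs.Pairwise fun a b => setupTime C.tFinal a ≤ setupTime C.tFinal b := by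
    have := List.pairwise_mergeSort (le := le)
      (fun a b c h1 h2 => by
        simp only [le, decide_eq_true_eq] at *; exact h1.trans h2)
      (fun a b => by simpa [le] using le_total _ _) z.toList
    exact this.imp fun h => by simpa [le] using h
  have hz' : ∀ w ∈ zs, Wire.Reachable k C.tFinal w ∧ w ∉ Set.range (verifierEmb d) :=
    fun w hw => hz w ((hmem w).1 hw)
  obtain ⟨A, hA1, hA2⟩ := exists_coalition hk hl hlt hs hz'
  have hnd : zs.Nodup := hperm.nodup_iff.2 z.nodup_toList
  have hzs : zs.toFinset = z := by
    ext w; rw [List.mem_toFinset, hmem]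
  have hle : ∀ e ∈ setupEvents k C.tFinal zs, e.time ≤ C.tFinal := by
    intro e he
    obtain ⟨w, hw, he⟩ := List.mem_flatMap.1 he
    obtain ⟨o, ho, rfl⟩ := List.mem_map.1 he
    have := (hz' w hw).1
    cases w with
    | bcast x e => exact this
    | mem s i j => exact le_rfl
    | ray b u e => exact le_rfl
  have := h A
  -- All setting up takes place by `tFinal`, strictly before the first Reveal event; the state at
  -- that moment is the planted one.
  rw [revealProb, hA1, hA2, interact_append_right fun a ha b hb =>
    (hle b hb).trans_lt (C.reveal_window α n a ha), Dens.run_append, Dens.run_nil,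
    run_setupEvents hnd hz', hzs, map_smul, Dens.probOne_eq] at this
  change (F ((Dens.trace σ)⁻¹ • Dens.plant (verifierEmb d) z
    (Dens.restrict (verifierEmb d) σ))).re = 0 at this
  rw [map_smul, smul_eq_mul] at this
  set x := F (Dens.plant (verifierEmb d) z (Dens.restrict (verifierEmb d) σ)) with hx
  have hx0 : 0 ≤ x := by
    refine hF _ (Dens.map_mem_cone (fun v _ => ?_) (Dens.restrict_mem_cone _ hσ))
    rw [Dens.plant_pure]
    exact Dens.pure_mem_cone fun _ _ => Set.mem_univ _
  rw [Complex.nonneg_iff] at hx0 ht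
  have e1 : Dens.trace σ = ((Dens.trace σ).re : ℂ) := Complex.ext rfl ht.2.symm
  have e2 : (Dens.trace σ).re ≠ 0 := fun h => ht0 (by rw [e1, h]; rfl)
  -- The trace is real and nonzero, so the normalization can be cancelled.
  rw [e1, ← Complex.ofReal_inv, Complex.re_ofReal_mul] at this
  refine Complex.ext ?_ hx0.2.symm
  exact (mul_eq_zero.1 this).resolve_left (inv_ne_zero e2)

/-- At the end of the Commit phase the classical part is classical. -/
theorem diag_commit (C : PositionCommitment d) (n : ℕ) {k : ℕ} {loc : ℕ → ℝ → Space d}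
    {l : List (PartyEvent d)} (hl : IsProgram Side.prover k loc l) {q : ℕ × ℕ}
    (hq : q ∈ C.classical n) (ρ : Dens (Wire d)) :
    Dens.Diag (verifierMem d q) (Dens.run (interact (C.commit.events n) l) ρ) := by
  let e : ℕ × ℕ → PartyEvent d := fun q => ⟨q.1, C.tFinal, QOp.measure (verifierMem d q)⟩
  -- The interaction is cut at the measurement of this qubit. Only further measurements and prover
  -- operations follow, and neither can make it nonclassical again.
  obtain ⟨l₁, l₂, hl12⟩ := List.append_of_mem (Finset.mem_toList.2 hq)
  have hc : C.commit.events n = (C.verifiers.events n ++ l₁.map e) ++ e q :: l₂.map e := by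
    change C.verifiers.events n ++ C.outputEvents n = _
    rw [outputEvents, hl12, List.map_append, List.map_cons, List.append_assoc]
  rw [hc, interact]
  obtain ⟨m₁, m₂, hm, hm2⟩ := merge_append_cons (C.verifiers.events n ++ l₁.map e) (e q)
    (l₂.map e) l
  rw [hm, List.map_append, List.map_cons, Dens.run_append, Dens.run_cons]
  have h0 : Dens.Diag (verifierMem d q) ((e q).op.apply (Dens.run (m₁.map PartyEvent.op) ρ)) :=
    Dens.Diag.apply_measure (Or.inl rfl)
  revert h0
  generalize (e q).op.apply (Dens.run (m₁.map PartyEvent.op) ρ) = σ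
  clear hm
  induction m₂ generalizing σ with
  | nil => exact fun h => h
  | cons x m₂ ih =>
    intro h0
    rw [List.map_cons, Dens.run_cons]
    refine ih (fun y hy => hm2 y (List.mem_cons_of_mem _ hy)) _ ?_
    rcases hm2 x List.mem_cons_self with hx | hx
    · obtain ⟨p, -, rfl⟩ := List.mem_map.1 hx
      exact Dens.Diag.apply_measure (Or.inr h0)
    · refine h0.apply_of_not_mem fun hw => ?_
      exact QOp.actsOn_iff.1 (not_mem_range_of_prover (hl.located x hx).2) _ hw ⟨q, rfl⟩

theorem isProgram_until {s : Side} {k : ℕ} {loc : ℕ → ℝ → Space d} {l : List (PartyEvent d)}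
    (hl : IsProgram s k loc l) (τ : ℝ) : IsProgram s k loc (eventsUntil τ l) where
  sorted := hl.sorted.sublist List.filter_sublist
  located e he := hl.located e (mem_eventsUntil.1 he).1

theorem isProgram_after {s : Side} {k : ℕ} {loc : ℕ → ℝ → Space d} {l : List (PartyEvent d)}
    (hl : IsProgram s k loc l) (τ : ℝ) : IsProgram s k loc (eventsAfter τ l) where
  sorted := hl.sorted.sublist List.filter_sublist
  located e he := hl.located e (mem_eventsAfter.1 he).1

theorem commit_time_le (C : PositionCommitment d) (n : ℕ) :
    ∀ e ∈ C.commit.events n, e.time ≤ C.tFinal := by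
  intro e he
  rcases List.mem_append.1 he with he | he
  · exact (C.commit_window n e he).2
  · obtain ⟨q, -, rfl⟩ := List.mem_map.1 he
    exact le_rfl

theorem stateAt_commit (C : PositionCommitment d) (P : Coalition d) (n : ℕ) :
    stateAt C.commit P n C.tFinal =
      Dens.run (interact (C.commit.events n) (eventsUntil C.tFinal (P.events n)))
        (Dens.run (P.prep n) (Dens.run (C.verifiers.prep n) Dens.vacuum)) := by
  rw [stateAt, eventsUntil_eq_self (C.commit_time_le n)]; rfl

theorem interact_commit_reveal (C : PositionCommitment d) (α : SpacetimePoint d) (n : ℕ)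
    {s : Side} {k : ℕ} {loc : ℕ → ℝ → Space d} {l : List (PartyEvent d)}
    (hl : IsProgram s k loc l) :
    interact (C.commit.events n ++ C.reveal α n) l =
      interact (C.commit.events n) (eventsUntil C.tFinal l) ++
        interact (C.reveal α n) (eventsAfter C.tFinal l) := by
  conv_lhs => rw [← eventsUntil_append_eventsAfter (τ := C.tFinal) hl.sorted]
  exact interact_append (C.commit_time_le n) (C.reveal_window α n)
    (fun e he => (mem_eventsUntil.1 he).2) fun e he => (mem_eventsAfter.1 he).2

/-- The acceptance probability in terms of the state at the end of the Commit phase. -/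
theorem acceptProb_eq (C : PositionCommitment d) (α : SpacetimePoint d) (P : Coalition d) (n : ℕ) :
    C.acceptProb α P n = Dens.probOne (acceptWire d) (Dens.run (C.verdict α n)
      (Dens.run (interact (C.reveal α n) (eventsAfter C.tFinal (P.events n)))
        (stateAt C.commit P n C.tFinal))) := by
  rw [acceptProb, interact_commit_reveal C α n (P.isProgram n), Dens.run_append, stateAt_commit]
  rfl

theorem actsOn_interact {k m : ℕ} {τ : ℝ} {locV loc : ℕ → ℝ → Space d} {l l' : List (PartyEvent d)}
    (hl : IsProgram Side.verifier m locV l) (hl' : IsProgram Side.prover k loc l')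
    (hτ : ∀ e ∈ l, e.time ≤ τ) (hτ' : ∀ e ∈ l', e.time ≤ τ) :
    ∀ o ∈ interact l l', o.ActsOn (Wire.Reachable k τ) := by
  intro o ho
  rcases mem_interact.1 ho with ⟨e, he, rfl⟩ | ⟨e, he, rfl⟩
  · exact hl.actsOn_reachable (by simp) he (hτ e he)
  · exact hl'.actsOn_reachable (fun _ => le_rfl) he (hτ' e he)

theorem stateAt_mem_cone (C : PositionCommitment d) (P : Coalition d) (n : ℕ) :
    stateAt C.commit P n C.tFinal ∈
      Dens.Cone (Dens.finConf (Wire.Reachable P.size C.tFinal)) := by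
  rw [stateAt_commit]
  refine Dens.run_mem_cone (actsOn_interact (C.commit_isProgram n)
    (isProgram_until (P.isProgram n) _) (C.commit_time_le n)
    fun e he => (mem_eventsUntil.1 he).2) (Dens.run_mem_cone ?_ (Dens.run_mem_cone ?_
      (Dens.vacuum_mem_cone _)))
  · exact fun o ho => (P.prep_mem n o ho).mono fun w => inMemory_reachable fun _ => le_rfl
  · exact fun o ho => (C.verifiers.prep_mem n o ho).mono fun w => inMemory_reachable (by simp)

theorem trace_stateAt (C : PositionCommitment d) (P : Coalition d) (n : ℕ) :
    Dens.trace (stateAt C.commit P n C.tFinal) = 1 := by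
  rw [stateAt_commit, Dens.trace_run, Dens.trace_run, Dens.trace_run, Dens.trace_vacuum]

open ComplexOrder in
/-- A coalition that has not occupied `α` is accepted for `α` with probability at most the binding
error. -/
theorem acceptProb_le (C : PositionCommitment d) {α : SpacetimePoint d} (hα : α ∈ C.points)
    {P : Coalition d} (hP : ¬ P.Occupies α) {n : ℕ} {s : ℝ}
    (h : 1 - s ≤ Dens.probGood (C.classical n) (viewAt C.commit P n C.tFinal) (C.Binds P n)) :
    C.acceptProb α P n ≤ s := by
  classical
  set σ := stateAt C.commit P n C.tFinal with hσdef
  have hσ := C.stateAt_mem_cone P n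
  set F : Dens (Wire d) →ₗ[ℂ] ℂ := Dens.weight {c | c (acceptWire d) = true} ∘ₗ
    Dens.runHom (C.verdict α n) ∘ₗ
      Dens.runHom (interact (C.reveal α n) (eventsAfter C.tFinal (P.events n))) with hFdef
  have hacc : C.acceptProb α P n = (F σ).re := by
    rw [acceptProb_eq, Dens.probOne_eq]; rfl
  let K := (C.classical n).map (verifierEmb d)
  -- The unnormalized global states, prover included, for the outcomes of the classical part; their
  -- reductions are the projected commitment states.
  let pr : Finset (ℕ × ℕ) → Dens (Wire d) := fun z =>
    Dens.filt {c | c ∘ verifierMem d ∈ {c : Conf (ℕ × ℕ) | ∀ q ∈ C.classical n, (c q = true ↔ q ∈ z)}} σ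
  have hview : ∀ z, Dens.restrict (verifierMem d) (pr z) =
      Dens.project (C.classical n) z (viewAt C.commit P n C.tFinal) := by
    intro z
    rw [Dens.restrict_filt, Dens.project_eq_filt]; rfl
  have hpr : ∀ z, pr z ∈ Dens.Cone (Dens.finConf (Wire.Reachable P.size C.tFinal)) :=
    fun z => Dens.filt_mem_cone _ hσ
  have hsum : ∑ z ∈ (C.classical n).powerset, pr z = σ := by
    have hd : ∀ q ∈ K, Dens.Diag q σ := by
      intro q hq
      obtain ⟨p, hp, rfl⟩ := Finset.mem_map.1 hq
      rw [hσdef, stateAt_commit]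
      exact C.diag_commit n (isProgram_until (P.isProgram n) _) hp _
    rw [← Dens.sum_project_eq hd]
    refine Finset.sum_bij (fun z _ => z.map (verifierEmb d)) ?_ ?_ ?_ ?_
    · intro z hz
      exact Finset.mem_powerset.2 (Finset.map_subset_map.2 (Finset.mem_powerset.1 hz))
    · intro z _ z' _ h
      exact Finset.map_injective _ h
    · intro z hz
      obtain ⟨z', hz', e⟩ := Finset.subset_map_iff.1 (Finset.mem_powerset.1 hz)
      exact ⟨z', Finset.mem_powerset.2 hz', e.symm⟩
    · intro z hz
      simp only [pr]
      rw [Dens.project_eq_filt]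
      congr 2
      ext c
      simp only [Set.mem_ofPred_eq, K, Finset.forall_mem_map, Finset.mem_map']
      rfl
  have htrace : ∑ z ∈ (C.classical n).powerset, (Dens.trace (pr z)).re = 1 := by
    have h1 : Dens.trace σ = 1 := C.trace_stateAt P n
    rw [← Complex.re_sum]
    simp only [Dens.trace_eq] at h1 ⊢
    rw [← map_sum, hsum, h1]; rfl
  have hbound : ∀ z, (F (pr z)).re ≤ (Dens.trace (pr z)).re := by
    intro z
    have hc : Dens.run (C.verdict α n) (Dens.run (interact (C.reveal α n)
        (eventsAfter C.tFinal (P.events n))) (pr z)) ∈ Dens.Cone (Set.univ : Set (Conf (Wire d))) :=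
      Dens.run_mem_cone_univ _ (Dens.run_mem_cone_univ _
        (Dens.cone_mono (Set.subset_univ _) (hpr z)))
    have := (Dens.weight_le_trace {c | c (acceptWire d) = true} hc)
    rw [Dens.trace_run, Dens.trace_run] at this
    exact (Complex.le_def.1 this).1
  have hgood : ∀ z, C.Binds P n ((Dens.trace (pr z))⁻¹ • Dens.restrict (verifierMem d) (pr z)) →
      F (pr z) = 0 := by
    rintro z ⟨β, hβ, hA⟩
    -- The point of binding is occupied by the coalition, whereas α is not.
    have hne : α ≠ β := by
      rintro rfl; exact hP hβ
    exact C.accept_eq_zero α n P.size_pos (isProgram_after (P.isProgram n) _)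
      (fun e he => (mem_eventsAfter.1 he).2) (hpr z) (hA α hα hne)
  rw [Dens.probGood] at h
  simp only [← hview, Dens.trace_restrict] at h
  rw [hacc, ← hsum, map_sum, Complex.re_sum]
  -- Binding outcomes contribute nothing to acceptance; the others contribute at most their total
  -- probability, which is at most `s`.
  rw [← Finset.sum_filter_add_sum_filter_not _ (fun z => C.Binds P n ((Dens.trace (pr z))⁻¹ •
    Dens.restrict (verifierMem d) (pr z)))] at htrace ⊢
  rw [Finset.sum_eq_zero (s := Finset.filter (fun z => C.Binds P n _) _) fun z hz => by
    rw [hgood z (Finset.mem_filter.1 hz).2]; rfl, zero_add]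
  refine (Finset.sum_le_sum fun z _ => hbound z).trans ?_
  have : ∀ a b : ℝ, a + b = 1 → 1 - s ≤ a → b ≤ s := fun a b h1 h2 => by linarith
  exact this _ _ htrace (by convert h)

end PositionCommitment

/-! ## Polynomial bounds -/

theorem PolyBounded.mono {f g : ℕ → ℕ} (hg : PolyBounded g) (h : ∀ n, f n ≤ g n) :
    PolyBounded f := by
  obtain ⟨p, hp⟩ := hg
  exact ⟨p, fun n => (h n).trans (hp n)⟩

theorem PolyBounded.add {f g : ℕ → ℕ} (hf : PolyBounded f) (hg : PolyBounded g) :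
    PolyBounded fun n => f n + g n := by
  obtain ⟨p, hp⟩ := hf
  obtain ⟨q, hq⟩ := hg
  exact ⟨p + q, fun n => by rw [Polynomial.eval_add]; exact add_le_add (hp n) (hq n)⟩

theorem PolyBounded.mul {f g : ℕ → ℕ} (hf : PolyBounded f) (hg : PolyBounded g) :
    PolyBounded fun n => f n * g n := by
  obtain ⟨p, hp⟩ := hf
  obtain ⟨q, hq⟩ := hg
  exact ⟨p * q, fun n => by rw [Polynomial.eval_mul]; exact Nat.mul_le_mul (hp n) (hq n)⟩

theorem polyBounded_const (k : ℕ) : PolyBounded fun _ => k :=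
  ⟨Polynomial.C k, fun n => by rw [Polynomial.eval_C]⟩

theorem IsQPT.append {W : Type} {D E : ℕ → List (QOp W)} (hD : IsQPT D) (hE : IsQPT E) :
    IsQPT fun n => D n ++ E n := by
  refine ⟨?_, fun n o ho => ?_⟩
  · simpa only [List.length_append] using hD.1.add hE.1
  · rcases List.mem_append.1 ho with ho | ho
    · exact hD.2 n o ho
    · exact hE.2 n o ho

theorem IsQPT.map {W V : Type} {D : ℕ → List (QOp W)} (hD : IsQPT D) (f : ℕ → W ↪ V) :
    IsQPT fun n => (D n).map (QOp.map (f n)) := by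
  refine ⟨?_, fun n o ho => ?_⟩
  · simpa only [List.length_map] using hD.1
  · obtain ⟨o', ho', rfl⟩ := List.mem_map.1 ho
    exact QOp.elementary_map.2 (hD.2 n o' ho')

/-! ### Position verification from a position commitment -/

namespace PositionCommitment

variable {d : ℕ}

theorem commit_efficient (C : PositionCommitment d) :
    IsQPT fun n => (C.commit.events n).map PartyEvent.op := by
  have : IsQPT fun n => (C.outputEvents n).map PartyEvent.op := by
    refine ⟨?_, fun n o ho => ?_⟩
    · simpa only [outputEvents, List.length_map, Finset.length_toList] using C.classical_efficient
    · simp only [outputEvents, List.map_map, List.mem_map] at ho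
      obtain ⟨q, -, rfl⟩ := ho
      trivial
  simpa only [commit, List.map_append] using C.verifiers_efficient.2.append this

/-- The verifiers carry out the Commit phase and then the Reveal phase for `α`. -/
noncomputable def commitReveal (C : PositionCommitment d) (α : SpacetimePoint d) :
    Team d Side.verifier where
  size := C.verifiers.size
  size_pos := C.verifiers.size_pos
  loc := C.verifiers.loc
  prep := C.verifiers.prep
  prep_mem := C.verifiers.prep_mem
  events n := C.commit.events n ++ C.reveal α n
  isProgram n :=
    { sorted := List.pairwise_append.2 ⟨(C.commit_isProgram n).sorted,
        (C.reveal_isProgram α n).sorted, fun a ha b hb =>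
          (C.commit_time_le n a ha).trans (C.reveal_window α n b hb).le⟩
      located := fun e he => by
        rcases List.mem_append.1 he with he | he
        · exact (C.commit_isProgram n).located e he
        · exact (C.reveal_isProgram α n).located e he }

/-- Position verification by a commitment that is opened at once. -/
noncomputable def toPositionVerification (C : PositionCommitment d) (α : SpacetimePoint d)
    (hα : α ∈ C.points) : PositionVerification d where
  verifiers := C.commitReveal α
  verdict := C.verdict α
  verdict_mem := C.verdict_mem α
  region := {α}
  track := C.track
  prover := C.prover
  prover_lone := by rintro β rfl; exact C.prover_lone β hα
  prover_at := by rintro β rfl; exact C.prover_at β hα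
  verifiers_efficient := ⟨C.verifiers_efficient.1, by
    simpa only [commitReveal, List.map_append] using
      C.commit_efficient.append (C.reveal_efficient α hα)⟩
  verdict_efficient := C.verdict_efficient α hα
  prover_efficient := by rintro β rfl; exact C.prover_efficient β hα

theorem exists_positionVerification (C : PositionCommitment d) {𝒞 : Set (Coalition d)}
    {c s : ℕ → ℝ} (hcomplete : C.HasCompletenessError c) (hbinding : C.HasPositionBinding 𝒞 s)
    {α : SpacetimePoint d} (hα : α ∈ C.points) : ∃ Q : PositionVerification d,
      Q.region = {α} ∧ Q.HasCompletenessError c ∧ Q.HasPositionSecurity 𝒞 s := by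
  refine ⟨C.toPositionVerification α hα, rfl, ?_, ?_⟩
  · intro β hβ n
    rw [Set.mem_singleton_iff.1 hβ]
    exact hcomplete n α hα
  · intro P hP hocc n
    exact C.acceptProb_le hα (hocc α rfl) (hbinding P hP n)

end PositionCommitment

/-! ## Swaps -/

namespace QOp

variable {W V : Type}

/-- Exchange two qubits. -/
noncomputable def swap (a b : W) (h : a ≠ b) : QOp W :=
  channel (two a b h) (QChannel.ofFun (fun _ => true) (fun y => ![y 1, y 0]) (fun y y' _ h => by
    have h0 := congrFun h 0
    have h1 := congrFun h 1
    funext i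
    fin_cases i
    · exact h1
    · exact h0))

theorem wires_swap {a b : W} (h : a ≠ b) : (swap a b h).wires = [a, b] := rfl

theorem elementary_swap {a b : W} (h : a ≠ b) : (swap a b h).Elementary := le_rfl

open Classical in
theorem apply_swap {a b : W} (h : a ≠ b) (ρ : Dens W) :
    (swap a b h).apply ρ = Dens.extend (Equiv.swap a b).toEmbedding ρ := by
  suffices e : (swap a b h).apply = Dens.extend (Equiv.swap a b).toEmbedding by rw [e]
  refine Dens.hom_ext fun c c' => ?_
  have hu : ∀ c : Conf W, Function.extend (two a b h)
      ((fun y : Fin 2 → Bool => ![y 1, y 0]) (c ∘ two a b h)) c =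
      Function.extend (Equiv.swap a b).toEmbedding c fun _ => false := by
    intro c
    have e : Function.extend (Equiv.swap a b).toEmbedding c (fun _ => false) =
        c ∘ Equiv.swap a b := by
      funext p
      conv_lhs => rw [← Equiv.swap_apply_self a b p]
      exact (Equiv.swap a b).toEmbedding.injective.extend_apply _ _ _
    rw [e, extend_two]
    funext p
    by_cases hp : p = a
    · subst hp
      rw [Function.update_self, Function.comp_apply, Equiv.swap_apply_left]; rfl
    · rw [Function.update_of_ne hp]
      by_cases hq : p = b
      · subst hq
        rw [Function.update_self, Function.comp_apply, Equiv.swap_apply_right]; rfl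
      · rw [Function.update_of_ne hq, Function.comp_apply, Equiv.swap_apply_of_ne_of_ne hp hq]
  rw [apply_unit, swap, onUnit_ofFun_eq (two a b h) _ _ _ c c' (p := true) (q := true) rfl rfl
    (hu c) (hu c'), Dens.extend_single]
  rfl

/-- Being its own inverse lets a swap be undone by the same elementary operation: this returns
exchanged signals and conjugates the relay of a broadcast bit. -/
theorem apply_swap_swap {a b : W} (h : a ≠ b) (ρ : Dens W) :
    (swap a b h).apply ((swap a b h).apply ρ) = ρ := by
  classical
  rw [apply_swap, apply_swap, Dens.extend_extend]
  have : (Equiv.swap a b).toEmbedding.trans (Equiv.swap a b).toEmbedding =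
      Function.Embedding.refl W := by
    ext p; exact Equiv.swap_apply_self a b p
  rw [this]
  have e : Dens.extend (Function.Embedding.refl W) = LinearMap.id := by
    refine Dens.hom_ext fun c c' => ?_
    have : ∀ c : Conf W, Function.extend (Function.Embedding.refl W) c (fun _ => false) = c :=
      fun c => funext fun p => (Function.Embedding.refl W).injective.extend_apply _ _ p
    rw [Dens.extend_single, this, this]; rfl
  rw [e]; rfl

end QOp

theorem Dens.run_reverse_run {W : Type} {L : List (QOp W)}
    (h : ∀ o ∈ L, ∀ ρ, o.apply (o.apply ρ) = ρ) (ρ : Dens W) :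
    Dens.run L.reverse (Dens.run L ρ) = ρ := by
  induction L generalizing ρ with
  | nil => rfl
  | cons o L ih =>
    rw [List.reverse_cons, Dens.run_append, Dens.run_cons o L,
      ih fun o ho => h o (List.mem_cons_of_mem _ ho), Dens.run_cons, Dens.run_nil,
      h o List.mem_cons_self]

/-! ## Cutting an interaction into rounds -/

/-- A round of the simulation: the receiver's operations `iface` for the sender at the given time,
and what the honest sender does just before. -/
structure Round where
  time : ℝ
  iface : List (QOp CommWire)
  move : Bool → List (QOp CommWire)

section Cut

variable {d : ℕ}

/-- The receiver's moves: it carries out `pre`, the events `l` of the verifiers, interrupted by the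
interface operations of the rounds, and `post`. -/
noncomputable def cutRounds (dec : QOp (Wire d) → QOp CommWire) (post : List (QOp CommWire)) :
    List (QOp CommWire) → List (PartyEvent d) → List Round → List (List (QOp CommWire))
  | pre, l, [] => [pre ++ l.map (fun e => dec e.op) ++ post]
  | pre, l, δ :: D => (pre ++ (eventsUntil δ.time l).map fun e => dec e.op) ::
      cutRounds dec post δ.iface (eventsAfter δ.time l) D

/-- The events of a prover that simulates the sender in the rounds `D`, from round `k` on. -/
def proverEvents (S : SenderStrategy) (f : CommWire ↪ Wire d) : ℕ → List Round → List (PartyEvent d)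
  | _, [] => []
  | k, δ :: D => ((S.move k ++ δ.iface).map fun o => ⟨0, δ.time, o.map f⟩) ++
      proverEvents S f (k + 1) D

theorem mem_proverEvents {S : SenderStrategy} {f : CommWire ↪ Wire d} {k : ℕ} {D : List Round}
    {e : PartyEvent d} (h : e ∈ proverEvents S f k D) :
    ∃ δ ∈ D, e.who = 0 ∧ e.time = δ.time ∧
      ∃ o, e.op = o.map f ∧ ((∃ r, o ∈ S.move r) ∨ o ∈ δ.iface) := by
  induction D generalizing k with
  | nil => simp [proverEvents] at h
  | cons δ D ih =>
    rcases List.mem_append.1 h with h | h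
    · obtain ⟨o, ho, rfl⟩ := List.mem_map.1 h
      exact ⟨δ, List.mem_cons_self, rfl, rfl, o, rfl,
        (List.mem_append.1 ho).imp_left fun h => ⟨k, h⟩⟩
    · obtain ⟨δ', h', h''⟩ := ih h
      exact ⟨δ', List.mem_cons_of_mem _ h', h''⟩

theorem proverEvents_sorted {S : SenderStrategy} {f : CommWire ↪ Wire d} {k : ℕ} {D : List Round}
    (hD : D.Pairwise fun a b => a.time ≤ b.time) :
    (proverEvents S f k D).Pairwise fun a b => a.time ≤ b.time := by
  induction D generalizing k with
  | nil => exact List.Pairwise.nil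
  | cons δ D ih =>
    rw [List.pairwise_cons] at hD
    refine List.pairwise_append.2 ⟨List.pairwise_map.2 (List.pairwise_of_forall fun _ _ => le_rfl),
      ih hD.2, fun a ha b hb => ?_⟩
    obtain ⟨o, -, rfl⟩ := List.mem_map.1 ha
    obtain ⟨δ', hδ', -, h, -⟩ := mem_proverEvents hb
    rw [h]
    exact hD.1 δ' hδ'

/-- At equal times verifiers go first, so exactly the verifier events up to time t precede the
block. Consecutive blocks at the same time are not separated by any verifier event. -/
theorem interact_block {l E : List (PartyEvent d)} (hl : l.Pairwise fun a b => a.time ≤ b.time)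
    {t : ℝ} (hE : ∀ e ∈ E, t ≤ e.time) (B : List (QOp (Wire d))) :
    interact l (B.map (fun o => ⟨0, t, o⟩) ++ E) =
      (eventsUntil t l).map PartyEvent.op ++ (B ++ interact (eventsAfter t l) E) := by
  conv_lhs => rw [← eventsUntil_append_eventsAfter (τ := t) hl]
  rw [interact_append_left, interact_append_right, List.map_map]
  · congr 2
    exact List.map_id _
  · intro a ha b hb
    obtain ⟨o, -, rfl⟩ := List.mem_map.1 hb
    exact (mem_eventsAfter.1 ha).2
  · intro a ha b hb
    refine (mem_eventsUntil.1 ha).2.trans ?_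
    rcases List.mem_append.1 hb with hb | hb
    · obtain ⟨o, -, rfl⟩ := List.mem_map.1 hb
      exact le_rfl
    · exact hE b hb

/-- The interface operations of a round open the receiver's following move, hence come directly
after the sender's move there; this accounts for the shift from k to k + 1. Nothing is assumed about
the sender or about where `f` places its qubits, so honest and cheating senders are covered alike.
-/
theorem map_cutRounds {dec : QOp (Wire d) → QOp CommWire} {post pre : List (QOp CommWire)}
    {l : List (PartyEvent d)} {D : List Round} (S : SenderStrategy) (f : CommWire ↪ Wire d)
    (hdec : ∀ e ∈ l, (dec e.op).map f = e.op) (hl : l.Pairwise fun a b => a.time ≤ b.time)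
    (hD : D.Pairwise fun a b => a.time ≤ b.time) (k : ℕ) :
    (((cutRounds dec post pre l D).zipIdx k).flatMap fun mr => S.move mr.2 ++ mr.1).map (QOp.map f)
      = (S.move k).map (QOp.map f) ++ (pre.map (QOp.map f) ++
        (interact l (proverEvents S f (k + 1) D) ++ post.map (QOp.map f))) := by
  induction D generalizing pre l k with
  | nil =>
    have e : (l.map fun e => dec e.op).map (QOp.map f) = l.map PartyEvent.op := by
      rw [List.map_map]
      exact List.map_congr_left fun e he => hdec e he
    simp only [cutRounds, List.zipIdx_singleton, List.flatMap_singleton, List.map_append, e,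
      proverEvents, interact_nil_right, List.append_assoc]
  | cons δ D ih =>
    rw [List.pairwise_cons] at hD
    have e : ((eventsUntil δ.time l).map fun e => dec e.op).map (QOp.map f) =
        (eventsUntil δ.time l).map PartyEvent.op := by
      rw [List.map_map]
      exact List.map_congr_left fun e he => hdec e (mem_eventsUntil.1 he).1
    have hE : ∀ e ∈ proverEvents S f (k + 1 + 1) D, δ.time ≤ e.time := by
      intro e he
      obtain ⟨δ', hδ', -, h, -⟩ := mem_proverEvents he
      rw [h]
      exact hD.1 δ' hδ'
    have e2 : proverEvents S f (k + 1) (δ :: D) =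
        (((S.move (k + 1) ++ δ.iface).map (QOp.map f)).map fun o => ⟨0, δ.time, o⟩) ++
          proverEvents S f (k + 1 + 1) D := by
      rw [List.map_map]; rfl
    rw [e2, interact_block hl hE, cutRounds, List.zipIdx_cons, List.flatMap_cons, List.map_append,
      ih (fun e he => hdec e (mem_eventsAfter.1 he).1) (hl.sublist List.filter_sublist) hD.2]
    simp only [List.map_append, e, List.append_assoc]

theorem mem_cutRounds {dec : QOp (Wire d) → QOp CommWire} {post pre : List (QOp CommWire)}
    {l : List (PartyEvent d)} {D : List Round} {P : QOp CommWire → Prop} (hpre : ∀ o ∈ pre, P o)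
    (hpost : ∀ o ∈ post, P o) (hl : ∀ e ∈ l, P (dec e.op)) (hD : ∀ δ ∈ D, ∀ o ∈ δ.iface, P o) :
    ∀ m ∈ cutRounds dec post pre l D, ∀ o ∈ m, P o := by
  induction D generalizing pre l with
  | nil =>
    intro m hm o ho
    rw [List.mem_singleton.1 hm, List.mem_append, List.mem_append] at ho
    rcases ho with (ho | ho) | ho
    · exact hpre o ho
    · obtain ⟨e, he, rfl⟩ := List.mem_map.1 ho
      exact hl e he
    · exact hpost o ho
  | cons δ D ih =>
    intro m hm o ho
    rcases List.mem_cons.1 hm with rfl | hm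
    · rcases List.mem_append.1 ho with ho | ho
      · exact hpre o ho
      · obtain ⟨e, he, rfl⟩ := List.mem_map.1 ho
        exact hl e (mem_eventsUntil.1 he).1
    · exact ih (hD δ List.mem_cons_self) (fun e he => hl e (mem_eventsAfter.1 he).1)
        (fun δ hδ => hD δ (List.mem_cons_of_mem _ hδ)) m hm o ho

theorem length_cutRounds (dec : QOp (Wire d) → QOp CommWire) (post pre : List (QOp CommWire))
    (l : List (PartyEvent d)) (D : List Round) :
    (cutRounds dec post pre l D).length = D.length + 1 := by
  induction D generalizing pre l with
  | nil => rfl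
  | cons δ D ih => rw [cutRounds, List.length_cons, ih, List.length_cons]

/-- The honest sender for the bit `b`. -/
def honestMove (init : List (QOp CommWire)) (D : List Round) (b : Bool) : ℕ → List (QOp CommWire)
  | 0 => init
  | r + 1 => (D[r]?).elim [] fun δ => δ.move b

theorem proverEvents_honest {S : SenderStrategy} {init : List (QOp CommWire)} {D : List Round}
    {b : Bool} (hS : S.move = honestMove init D b) (f : CommWire ↪ Wire d) :
    proverEvents S f 1 D =
      D.flatMap fun δ => (δ.move b ++ δ.iface).map fun o => ⟨0, δ.time, o.map f⟩ := by
  -- The rounds already played are carried along, because the sender looks up its move by position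
  -- in the full list; move 0 is reserved for its preparation.
  suffices h : ∀ (D₁ D₂ : List Round), D = D₁ ++ D₂ → proverEvents S f (D₁.length + 1) D₂ =
      D₂.flatMap fun δ => (δ.move b ++ δ.iface).map fun o => ⟨0, δ.time, o.map f⟩ from h [] D rfl
  intro D₁ D₂ hD
  induction D₂ generalizing D₁ with
  | nil => rfl
  | cons δ D₂ ih =>
    have hm : S.move (D₁.length + 1) = δ.move b := by
      rw [hS, hD]
      simp [honestMove]
    have := ih (D₁ ++ [δ]) (by rw [hD, List.append_assoc]; rfl)
    rw [List.length_append, List.length_singleton] at this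
    rw [proverEvents, hm, this, List.flatMap_cons]

/-- Replacing the events of the prover by blocks with the same effect. -/
theorem run_interact_flatMap {β : Type*} {Inv : Dens (Wire d) → Prop} {time : β → ℝ}
    {B B' : β → List (QOp (Wire d))} {es : List β} (hes : es.Pairwise fun a b => time a ≤ time b)
    {l : List (PartyEvent d)} (hl : l.Pairwise fun a b => a.time ≤ b.time)
    (hInv : ∀ e ∈ l, ∀ σ, Inv σ → Inv (e.op.apply σ))
    (hB : ∀ x ∈ es, ∀ σ, Inv σ → Dens.run (B x) σ = Dens.run (B' x) σ)
    (hB' : ∀ x ∈ es, ∀ σ, Inv σ → Inv (Dens.run (B' x) σ)) {σ : Dens (Wire d)} (hσ : Inv σ) :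
    Dens.run (interact l (es.flatMap fun x => (B x).map fun o => ⟨0, time x, o⟩)) σ =
      Dens.run (interact l (es.flatMap fun x => (B' x).map fun o => ⟨0, time x, o⟩)) σ ∧
    Inv (Dens.run (interact l (es.flatMap fun x => (B' x).map fun o => ⟨0, time x, o⟩)) σ) := by
  have hrun : ∀ l : List (PartyEvent d), (∀ e ∈ l, ∀ σ, Inv σ → Inv (e.op.apply σ)) →
      ∀ σ, Inv σ → Inv (Dens.run (l.map PartyEvent.op) σ) := by
    intro l
    induction l with
    | nil => exact fun _ σ hσ => hσ
    | cons e l ih =>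
      exact fun h σ hσ => ih (fun e he => h e (List.mem_cons_of_mem _ he)) _
        (h e List.mem_cons_self σ hσ)
  induction es generalizing l σ with
  | nil =>
    refine ⟨rfl, ?_⟩
    rw [List.flatMap_nil, interact_nil_right]
    exact hrun l hInv σ hσ
  | cons x es ih =>
    rw [List.pairwise_cons] at hes
    have hE : ∀ B : β → List (QOp (Wire d)),
        ∀ e ∈ es.flatMap (fun x => (B x).map fun o => (⟨0, time x, o⟩ : PartyEvent d)),
          time x ≤ e.time := by
      intro B e he
      obtain ⟨y, hy, he⟩ := List.mem_flatMap.1 he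
      obtain ⟨o, -, rfl⟩ := List.mem_map.1 he
      exact hes.1 y hy
    rw [List.flatMap_cons, List.flatMap_cons, interact_block hl (hE B), interact_block hl (hE B')]
    simp only [Dens.run_append]
    -- The verifier events before the block are the same on both sides and preserve the invariant,
    -- under which the two blocks agree.
    have h1 := hrun (eventsUntil (time x) l) (fun e he => hInv e (mem_eventsUntil.1 he).1) σ hσ
    rw [hB x List.mem_cons_self _ h1]
    exact ih hes.2 (hl.sublist List.filter_sublist) (fun e he => hInv e (mem_eventsAfter.1 he).1)
      (fun x hx => hB x (List.mem_cons_of_mem _ hx))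
      (fun x hx => hB' x (List.mem_cons_of_mem _ hx)) (hB' x List.mem_cons_self _ h1)

theorem filter_merge {β : Type*} {le : β → β → Bool} {p : β → Bool} {l l' : List β}
    (h : ∀ a ∈ l, p a = true) (h' : ∀ a ∈ l', p a = false) :
    (List.merge l l' le).filter p = l := by
  induction l generalizing l' with
  | nil =>
    rw [List.nil_merge, List.filter_eq_nil_iff]
    intro a ha
    simp [h' a ha]
  | cons a l ih =>
    induction l' with
    | nil => rw [List.merge_right, List.filter_eq_self]; exact h
    | cons b l' ihb =>
      rw [List.cons_merge_cons]
      split_ifs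
      · rw [List.filter_cons_of_pos (h a List.mem_cons_self),
          ih (fun a ha => h a (List.mem_cons_of_mem _ ha)) h']
      · rw [List.filter_cons_of_neg (by simp [h' b List.mem_cons_self])]
        exact ihb fun a ha => h' a (List.mem_cons_of_mem _ ha)

theorem filter_merge_right {β : Type*} {le : β → β → Bool} {p : β → Bool} {l l' : List β}
    (h : ∀ a ∈ l, p a = false) (h' : ∀ a ∈ l', p a = true) :
    (List.merge l l' le).filter p = l' := by
  induction l generalizing l' with
  | nil => rw [List.nil_merge, List.filter_eq_self]; exact h'
  | cons a l ih =>
    induction l' with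
    | nil =>
      rw [List.merge_right, List.filter_eq_nil_iff]
      intro b hb
      simp [h b hb]
    | cons b l' ihb =>
      rw [List.cons_merge_cons]
      split_ifs
      · rw [List.filter_cons_of_neg (by simp [h a List.mem_cons_self])]
        exact ih (fun a ha => h a (List.mem_cons_of_mem _ ha)) h'
      · rw [List.filter_cons_of_pos (h' b List.mem_cons_self),
          ihb fun a ha => h' a (List.mem_cons_of_mem _ ha)]

end Cut

/-! ## The receiver's encoding of the world -/

/-- The receiver's qubits: the verifiers' memories and a store for signals and broadcasts. -/
def recvEquiv : (ℕ × ℕ) ⊕ ℕ ≃ ℕ :=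
  (Equiv.sumCongr Nat.pairEquiv (Equiv.refl ℕ)).trans Equiv.natSumNatEquivNat

namespace CommWire

def vmem (q : ℕ × ℕ) : CommWire := receiver (recvEquiv (Sum.inl q))

def store (k : ℕ) : CommWire := receiver (recvEquiv (Sum.inr k))

theorem store_injective : Function.Injective store := fun j k h => by
  simpa [store] using h

/-- The slot of the message register for the `k`-th qubit of the store. -/
def slot (k : ℕ) : CommWire := message (k + 1)

theorem slot_injective : Function.Injective slot := fun j k h => by
  simpa [slot] using h

theorem store_ne_slot (j k : ℕ) : store j ≠ slot k := by simp [store, slot]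

theorem store_ne_message (j k : ℕ) : store j ≠ message k := by simp [store]

theorem slot_ne_message_zero (k : ℕ) : slot k ≠ message 0 := by simp [slot]

def receiverEmb : ℕ ↪ CommWire := ⟨receiver, fun i j h => by simpa using h⟩

def vmemEmb : ℕ × ℕ ↪ CommWire := ⟨vmem, fun p q h => by simpa [vmem] using h⟩

/-- Exchange qubits of the store with their slots in the message register. -/
noncomputable def exchange (l : List ℕ) : List (QOp CommWire) :=
  l.map fun k => QOp.swap (store k) (slot k) (store_ne_slot k k)

theorem exchange_involutive (l : List ℕ) :
    ∀ o ∈ exchange l, ∀ ρ, o.apply (o.apply ρ) = ρ := by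
  intro o ho ρ
  obtain ⟨k, -, rfl⟩ := List.mem_map.1 ho
  exact QOp.apply_swap_swap _ _

theorem mem_exchange {l : List ℕ} {o : QOp CommWire} (h : o ∈ exchange l) :
    ∃ k ∈ l, o.wires = [store k, slot k] ∧ o.Elementary := by
  obtain ⟨k, hk, rfl⟩ := List.mem_map.1 h
  exact ⟨k, hk, rfl, QOp.elementary_swap _⟩

/-- The effect of an exchange. -/
theorem exists_perm_exchange {l : List ℕ} (hl : l.Nodup) : ∃ π : CommWire ↪ CommWire,
    (∀ ρ, Dens.run (exchange l) ρ = Dens.extend π ρ) ∧ (∀ k ∈ l, π (store k) = slot k) ∧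
    (∀ k ∈ l, π (slot k) = store k) ∧
    ∀ w, (∀ k ∈ l, w ≠ store k ∧ w ≠ slot k) → π w = w := by
  classical
  induction l with
  | nil =>
    refine ⟨Function.Embedding.refl _, fun ρ => ?_, by simp, by simp, fun w _ => rfl⟩
    rw [exchange, List.map_nil, Dens.run_nil]
    refine (LinearMap.congr_fun (?_ : LinearMap.id = _) ρ)
    refine Dens.hom_ext fun c c' => ?_
    have : ∀ c : Conf CommWire,
        Function.extend (Function.Embedding.refl CommWire) c (fun _ => false) = c :=
      fun c => funext fun p => (Function.Embedding.refl CommWire).injective.extend_apply _ _ p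
    rw [Dens.extend_single, this, this]; rfl
  | cons k l ih =>
    rw [List.nodup_cons] at hl
    obtain ⟨π, h1, h2, h2', h3⟩ := ih hl.2
    have hne : ∀ j ∈ l, j ≠ k := fun j hj h => hl.1 (h ▸ hj)
    -- The pairs of exchanged qubits are disjoint, so the later swaps do not move the first pair.
    refine ⟨(Equiv.swap (store k) (slot k)).toEmbedding.trans π, fun ρ => ?_, ?_, ?_, ?_⟩
    · rw [exchange, List.map_cons, Dens.run_cons, QOp.apply_swap, ← Dens.extend_extend]
      exact h1 _
    · intro j hj
      simp only [Function.Embedding.trans_apply, Equiv.coe_toEmbedding]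
      rcases List.mem_cons.1 hj with rfl | hj
      · rw [Equiv.swap_apply_left]
        exact h3 _ fun i hi => ⟨(store_ne_slot _ _).symm, fun h => hne i hi (slot_injective h).symm⟩
      · rw [Equiv.swap_apply_of_ne_of_ne (fun h => hne j hj (store_injective h))
          (store_ne_slot _ _), h2 j hj]
    · intro j hj
      simp only [Function.Embedding.trans_apply, Equiv.coe_toEmbedding]
      rcases List.mem_cons.1 hj with rfl | hj
      · rw [Equiv.swap_apply_right]
        exact h3 _ fun i hi => ⟨fun h => hne i hi (store_injective h).symm, store_ne_slot _ _⟩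
      · rw [Equiv.swap_apply_of_ne_of_ne (store_ne_slot _ _).symm
          (fun h => hne j hj (slot_injective h)), h2' j hj]
    · intro w hw
      obtain ⟨hw1, hw2⟩ := hw k List.mem_cons_self
      simp only [Function.Embedding.trans_apply, Equiv.coe_toEmbedding]
      rw [Equiv.swap_apply_of_ne_of_ne hw1 hw2]
      exact h3 w fun j hj => hw j (List.mem_cons_of_mem _ hj)

end CommWire

/-- Directional signals and broadcasts. -/
def Wire.IsSignal {d : ℕ} : Wire d → Prop
  | mem _ _ _ => False
  | ray _ u _ => ‖u‖ = 1
  | bcast _ _ => True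

/-- What the receiver has to know in order to simulate the world: the signals that are used, and the
positions of the prover. -/
structure Interface (d : ℕ) where
  signals : List (Wire d)
  nodup : signals.Nodup
  isSignal : ∀ w ∈ signals, w.IsSignal
  track : ℝ → Space d

namespace Interface

open CommWire

variable {d : ℕ} (I : Interface d)

/-- The qubit that is encoded by the `k`-th qubit of the store (a qubit that is never used, if `k`
is too large). -/
noncomputable def storeWire (k : ℕ) : Wire d := I.signals.getD k (Wire.ray 0 0 k)

theorem storeWire_of_lt {k : ℕ} (h : k < I.signals.length) : I.storeWire k = I.signals[k] :=
  List.getD_eq_getElem _ _ h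

theorem storeWire_of_le {k : ℕ} (h : I.signals.length ≤ k) : I.storeWire k = Wire.ray 0 0 k :=
  List.getD_eq_default _ _ h

theorem isSignal_storeWire_iff {k : ℕ} : (I.storeWire k).IsSignal ↔ k < I.signals.length := by
  constructor
  · intro h
    by_contra hk
    rw [I.storeWire_of_le (not_lt.1 hk)] at h
    simp [Wire.IsSignal] at h
  · intro h
    rw [I.storeWire_of_lt h]
    exact I.isSignal _ (List.getElem_mem h)

/-- The padding wires have direction 0, not a unit vector. They are no signals, so they cannot
collide with listed ones, and no party can access them. -/
theorem storeWire_injective : Function.Injective I.storeWire := by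
  intro j k h
  by_cases hj : j < I.signals.length
  · have hk : k < I.signals.length := by
      rw [← I.isSignal_storeWire_iff, ← h, I.isSignal_storeWire_iff]; exact hj
    rw [I.storeWire_of_lt hj, I.storeWire_of_lt hk] at h
    exact (List.Nodup.getElem_inj_iff I.nodup).1 h
  · have hk : ¬ k < I.signals.length := by
      rw [← I.isSignal_storeWire_iff, ← h, I.isSignal_storeWire_iff]; exact hj
    rw [I.storeWire_of_le (not_lt.1 hj), I.storeWire_of_le (not_lt.1 hk)] at h
    simpa using h

theorem storeWire_ne_mem (k : ℕ) (s : Side) (i j : ℕ) : I.storeWire k ≠ Wire.mem s i j := by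
  intro h
  by_cases hk : k < I.signals.length
  · have := I.isSignal_storeWire_iff.2 hk
    rw [h] at this
    exact this
  · rw [I.storeWire_of_le (not_lt.1 hk)] at h
    simp at h

open Classical in
/-- The place of a signal in the store. -/
noncomputable def index (w : Wire d) : ℕ :=
  if h : w ∈ I.signals then (List.getElem_of_mem h).choose else 0

theorem index_lt {w : Wire d} (h : w ∈ I.signals) : I.index w < I.signals.length := by
  rw [index, dif_pos h]
  exact (List.getElem_of_mem h).choose_spec.1

theorem storeWire_index {w : Wire d} (h : w ∈ I.signals) : I.storeWire (I.index w) = w := by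
  rw [I.storeWire_of_lt (I.index_lt h)]
  simp only [index, dif_pos h]
  exact (List.getElem_of_mem h).choose_spec.2

/-- The meaning of the receiver's qubits. -/
noncomputable def recvEmb : ℕ ↪ Wire d :=
  ⟨fun j => (recvEquiv.symm j).elim (verifierMem d) I.storeWire, by
    refine Function.Injective.comp (g := Sum.elim (verifierMem d) I.storeWire) ?_
      recvEquiv.symm.injective
    exact (verifierEmb d).injective.sumElim I.storeWire_injective
      fun q k => (I.storeWire_ne_mem k _ _ _).symm⟩

/-- The meaning of all qubits of the two-party protocol, when the sender's qubits and the message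
register are in the memories of provers. -/
noncomputable def emb (r : ℕ ⊕ ℕ ↪ ℕ × ℕ) : CommWire ↪ Wire d where
  toFun
    | receiver j => I.recvEmb j
    | sender j => Wire.mem Side.prover (r (Sum.inl j)).1 (r (Sum.inl j)).2
    | message j => Wire.mem Side.prover (r (Sum.inr j)).1 (r (Sum.inr j)).2
  inj' := by
    have hne : ∀ j i k, I.recvEmb j ≠ Wire.mem Side.prover i k := by
      intro j i k
      simp only [recvEmb, Function.Embedding.coeFn_mk]
      rcases recvEquiv.symm j with q | m
      · simp [verifierMem]
      · exact I.storeWire_ne_mem m _ _ _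
    have hinj : ∀ a b, Wire.mem (d := d) Side.prover (r a).1 (r a).2 =
        Wire.mem Side.prover (r b).1 (r b).2 → a = b := by
      intro a b h
      simp only [Wire.mem.injEq, true_and] at h
      exact r.injective (Prod.ext h.1 h.2)
    rintro (i | i | i) (j | j | j) h
    · rw [I.recvEmb.injective h]
    · exact absurd h (hne _ _ _)
    · exact absurd h (hne _ _ _)
    · exact absurd h.symm (hne _ _ _)
    · rw [Sum.inl.inj (hinj _ _ h)]
    · exact absurd (hinj _ _ h) (by simp)
    · exact absurd h.symm (hne _ _ _)
    · exact absurd (hinj _ _ h) (by simp)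
    · rw [Sum.inr.inj (hinj _ _ h)]

variable (r : ℕ ⊕ ℕ ↪ ℕ × ℕ)

theorem emb_vmem (q : ℕ × ℕ) : I.emb r (vmem q) = verifierMem d q := by
  simp [emb, vmem, recvEmb]

theorem emb_store (k : ℕ) : I.emb r (store k) = I.storeWire k := by
  simp [emb, store, recvEmb]

theorem emb_message (j : ℕ) :
    I.emb r (message j) = Wire.mem Side.prover (r (Sum.inr j)).1 (r (Sum.inr j)).2 := rfl

theorem receiverEmb_trans_emb : receiverEmb.trans (I.emb r) = I.recvEmb := rfl

theorem vmemEmb_trans_emb : vmemEmb.trans (I.emb r) = verifierEmb d := by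
  ext q
  exact I.emb_vmem r q

/-- The encoding of the honest prover: the message register is held by an absent second prover. -/
def honestReg : ℕ ⊕ ℕ ↪ ℕ × ℕ :=
  ⟨Sum.elim (fun j => (0, j)) (fun j => (1, j)), by
    rintro (i | i) (j | j) h <;> simp_all⟩

/-- The encoding of a single prover in whose memory the first `N` qubits are not used. -/
def soloReg (N : ℕ) : ℕ ⊕ ℕ ↪ ℕ × ℕ :=
  ⟨Sum.elim (fun j => (0, N + 2 * j)) (fun j => (0, N + 2 * j + 1)), by
    rintro (i | i) (j | j) h <;> simp at h ⊢ <;> omega⟩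

open Classical in
/-- The receiver's version of an operation of the verifiers. -/
noncomputable def dec (o : QOp (Wire d)) : QOp CommWire :=
  if h : ∃ o' : QOp ℕ, o'.map I.recvEmb = o then h.choose.map receiverEmb
  -- The default is elementary and on the receiver's side, so locality and efficiency hold without
  -- conditions.
  else QOp.measure (receiver 0)

theorem dec_receiverSide (o : QOp (Wire d)) : (I.dec o).ActsOn ReceiverSide := by
  rw [dec]
  split_ifs with h
  · rw [QOp.actsOn_map, QOp.actsOn_iff]
    exact fun _ _ => trivial
  · trivial

theorem map_dec {o : QOp (Wire d)}
    (h : o.ActsOn fun w => w ∈ Set.range (verifierMem d) ∨ w ∈ I.signals) :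
    (I.dec o).map (I.emb r) = o := by
  have hex : ∃ o' : QOp ℕ, o'.map I.recvEmb = o := by
    obtain ⟨o', ho', -⟩ := QOp.exists_map_eq I.recvEmb (A := fun _ => True) (h.mono (by
      rintro w (⟨q, rfl⟩ | hw)
      · exact ⟨recvEquiv (Sum.inl q), trivial, by simp [recvEmb]⟩
      · exact ⟨recvEquiv (Sum.inr (I.index w)), trivial, by simp [recvEmb, I.storeWire_index hw]⟩))
    exact ⟨o', ho'⟩
  rw [dec, dif_pos hex, QOp.map_map, receiverEmb_trans_emb]
  exact hex.choose_spec

/-! ### The blocks of the simulation -/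

open Classical in
/-- The signals that the prover can access at time `t`. -/
noncomputable def accessible (t : ℝ) : List ℕ :=
  (List.range I.signals.length).filter fun k =>
    decide (Wire.AccessibleAt Side.prover 0 (I.track t, t) (I.storeWire k))

theorem mem_accessible {t : ℝ} {k : ℕ} : k ∈ I.accessible t ↔
    k < I.signals.length ∧ Wire.AccessibleAt Side.prover 0 (I.track t, t) (I.storeWire k) := by
  simp [accessible]

theorem accessible_nodup (t : ℝ) : (I.accessible t).Nodup := List.nodup_range.filter _

/-- Sending a bit by broadcast, or receiving one. -/
noncomputable def relay : QOp (Wire d) → List (QOp CommWire)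
  | QOp.copy _ (Wire.bcast x e) => [QOp.copy (message 0) (store (I.index (Wire.bcast x e)))]
  | QOp.copy (Wire.bcast x e) _ => [QOp.copy (store (I.index (Wire.bcast x e))) (message 0)]
  | _ => []

theorem relay_eq_nil {s : Side} {i : ℕ} {x : SpacetimePoint d} {o : QOp (Wire d)}
    (h : o.ActsOn (Wire.AccessibleAt s i x)) : I.relay o = [] := by
  match o, h with
  | QOp.channel _ _, _ => rfl
  | QOp.measure _, _ => rfl
  | QOp.copy _ (Wire.bcast _ _), h => exact h.2.elim
  | QOp.copy (Wire.bcast _ _) _, h => exact h.1.elim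
  | QOp.copy (Wire.mem _ _ _) (Wire.mem _ _ _), _ => rfl
  | QOp.copy (Wire.mem _ _ _) (Wire.ray _ _ _), _ => rfl
  | QOp.copy (Wire.ray _ _ _) (Wire.mem _ _ _), _ => rfl
  | QOp.copy (Wire.ray _ _ _) (Wire.ray _ _ _), _ => rfl

theorem relay_read {s : Side} {i e : ℕ} {x y : SpacetimePoint d} {b : Wire d}
    (h : Wire.AccessibleAt s i x b) : I.relay (QOp.copy (Wire.bcast y e) b) =
      [QOp.copy (store (I.index (Wire.bcast y e))) (message 0)] := by
  cases b with
  | mem _ _ _ => rfl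
  | ray _ _ _ => rfl
  | bcast _ _ => exact h.elim

/-- The operation is one of a single prover on the track, and its signals are known. -/
structure Admissible (t : ℝ) (o : QOp (Wire d)) : Prop where
  localAt : o.LocalAt Side.prover 0 (I.track t, t)
  mem_signals : ∀ w ∈ o.wires, w.IsSignal → w ∈ I.signals
  elementary : o.Elementary

/-- An honest prover can touch its own memory, which is the sender's, and the rays at its position,
which the receiver is about to hand over. -/
theorem exists_source {t : ℝ} {w : Wire d}
    (hw : Wire.AccessibleAt Side.prover 0 (I.track t, t) w) (hs : w.IsSignal → w ∈ I.signals) :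
    ∃ v, ((∃ j, v = sender j) ∨ ∃ k ∈ I.accessible t, v = store k) ∧ I.emb honestReg v = w := by
  cases w with
  | mem s i j =>
    obtain ⟨rfl, rfl⟩ := hw
    exact ⟨sender j, Or.inl ⟨j, rfl⟩, rfl⟩
  | ray b u e =>
    have hm := hs hw.1
    refine ⟨store (I.index (Wire.ray b u e)), Or.inr ⟨_, ?_, rfl⟩, ?_⟩
    · rw [mem_accessible, I.storeWire_index hm]
      exact ⟨I.index_lt hm, hw⟩
    · rw [emb_store, I.storeWire_index hm]
  | bcast x e => exact hw.elim

/-- An operation on accessible qubits is carried out between the two exchanges, with handed-over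
signals addressed by their slots. To send or receive a broadcast bit, the sender swaps the qubit
concerned with `message 0`, lets the receiver copy, and swaps back. -/
theorem exists_moves {t : ℝ} {o : QOp (Wire d)} (ho : I.Admissible t o) :
    ∃ X Y : List (QOp CommWire), X.length ≤ 1 ∧ Y.length ≤ 1 ∧
      (∀ p ∈ X ++ Y, p.ActsOn SenderSide ∧ p.Elementary) ∧
      ∃ o' : QOp CommWire, o'.map (I.emb honestReg) = o ∧ ∀ ρ,
        Dens.run (exchange (I.accessible t) ++ (X ++ I.relay o ++
          (Y ++ (exchange (I.accessible t)).reverse))) ρ = o'.apply ρ := by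
  classical
  obtain ⟨hloc, hsig, hel⟩ := ho
  obtain ⟨π, hπ, hπ1, -, hπ3⟩ := exists_perm_exchange (I.accessible_nodup t)
  have hrev := Dens.run_reverse_run (exchange_involutive (I.accessible t))
  have hsrc : ∀ v, ((∃ j, v = sender j) ∨ ∃ k ∈ I.accessible t, v = store k) →
      (π v).SenderSide ∧ π v ≠ message 0 := by
    rintro v (⟨j, rfl⟩ | ⟨k, hk, rfl⟩)
    · rw [hπ3 _ fun k _ => by simp [store, slot]]
      exact ⟨trivial, by simp⟩
    · rw [hπ1 k hk]
      exact ⟨trivial, slot_ne_message_zero k⟩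
  -- Broadcasts are never accessible, so the exchange leaves them in the store.
  have hbc : ∀ x e, Wire.bcast x e ∈ I.signals →
      π (store (I.index (Wire.bcast x e))) = store (I.index (Wire.bcast x e)) := by
    intro x e hm
    refine hπ3 _ fun k hk => ⟨fun h => ?_, store_ne_slot _ _⟩
    rw [mem_accessible, ← store_injective h, I.storeWire_index hm] at hk
    exact hk.2
  -- The relay is the wanted operation with its qubits renamed by the exchange and by the swap with
  -- `message 0`; undoing both afterwards gives the operation itself.
  have conj : ∀ (a : CommWire) (ha : a.SenderSide ∧ a ≠ message 0) (p o' : QOp CommWire),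
      p = (o'.map π).map (Equiv.swap a (message 0)).toEmbedding → ∀ ρ,
      Dens.run (exchange (I.accessible t) ++ ([QOp.swap a (message 0) ha.2] ++ [p] ++
        ([QOp.swap a (message 0) ha.2] ++ (exchange (I.accessible t)).reverse))) ρ =
        o'.apply ρ := by
    rintro a ha p o' rfl ρ
    simp only [Dens.run_append, Dens.run_cons, Dens.run_nil]
    rw [hπ ρ, QOp.apply_swap ha.2 (Dens.extend π ρ), Dens.apply_map_extend, Dens.apply_map_extend,
      ← QOp.apply_swap ha.2, QOp.apply_swap_swap, ← hπ, hrev]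
  have swap_ok : ∀ (a : CommWire) (ha : a.SenderSide ∧ a ≠ message 0),
      ∀ p ∈ [QOp.swap a (message 0) ha.2] ++ [QOp.swap a (message 0) ha.2],
        p.ActsOn SenderSide ∧ p.Elementary := by
    intro a ha p hp
    have : p = QOp.swap a (message 0) ha.2 := by simpa using hp
    rw [this]
    refine ⟨QOp.actsOn_iff.2 fun w hw => ?_, QOp.elementary_swap _⟩
    rw [QOp.wires_swap] at hw
    rcases List.mem_cons.1 hw with rfl | hw
    · exact ha.1
    · rw [List.mem_singleton.1 hw]; trivial
  rcases hloc with h | ⟨a, e, rfl, ha⟩ | ⟨y, e, b, rfl, hy, hb⟩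
  · obtain ⟨o', ho', hA⟩ := QOp.exists_map_eq (I.emb honestReg) (QOp.actsOn_iff.2 fun w hw =>
      I.exists_source (QOp.actsOn_iff.1 h w hw) (hsig w hw))
    refine ⟨[o'.map π], [], le_rfl, Nat.zero_le _, ?_, o', ho', fun ρ => ?_⟩
    · intro p hp
      rw [List.append_nil, List.mem_singleton] at hp
      rw [hp]
      refine ⟨QOp.actsOn_map.2 (hA.mono fun v hv => (hsrc v hv).1), ?_⟩
      rw [QOp.elementary_map, ← QOp.elementary_map (f := I.emb honestReg), ho']
      exact hel
    · rw [I.relay_eq_nil h]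
      simp only [Dens.run_append, Dens.run_cons, Dens.run_nil]
      rw [hπ ρ, Dens.apply_map_extend, ← hπ, hrev]
  · have hm := hsig (Wire.bcast (I.track t, t) e) (by simp [QOp.wires]) trivial
    obtain ⟨v, hv, rfl⟩ := I.exists_source ha (hsig a (by simp [QOp.wires]))
    refine ⟨_, _, le_rfl, le_rfl, swap_ok (π v) (hsrc v hv),
      QOp.copy v (store (I.index (Wire.bcast (I.track t, t) e))), ?_, fun ρ => ?_⟩
    · simp only [QOp.map, emb_store, I.storeWire_index hm]
    · refine conj (π v) (hsrc v hv) _ _ ?_ ρ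
      simp only [QOp.map, hbc _ _ hm, Equiv.coe_toEmbedding, Equiv.swap_apply_left]
      rw [Equiv.swap_apply_of_ne_of_ne _ (store_ne_message _ _)]
      rw [← hbc _ _ hm]
      intro h
      have := π.injective h
      rw [← this] at hv
      rcases hv with ⟨j, hj⟩ | ⟨k, hk, hj⟩
      · simp [store] at hj
      · rw [mem_accessible, ← store_injective hj, I.storeWire_index hm] at hk
        exact hk.2
  · have hm := hsig (Wire.bcast y e) (by simp [QOp.wires]) trivial
    obtain ⟨v, hv, rfl⟩ := I.exists_source hb (hsig b (by simp [QOp.wires]))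
    refine ⟨_, _, le_rfl, le_rfl, swap_ok (π v) (hsrc v hv),
      QOp.copy (store (I.index (Wire.bcast y e))) v, ?_, fun ρ => ?_⟩
    · simp only [QOp.map, emb_store, I.storeWire_index hm]
    · rw [I.relay_read hb]
      refine conj (π v) (hsrc v hv) _ _ ?_ ρ
      simp only [QOp.map, hbc _ _ hm, Equiv.coe_toEmbedding, Equiv.swap_apply_left]
      rw [Equiv.swap_apply_of_ne_of_ne _ (store_ne_message _ _)]
      rw [← hbc _ _ hm]
      intro h
      have := π.injective h
      rw [← this] at hv
      rcases hv with ⟨j, hj⟩ | ⟨k, hk, hj⟩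
      · simp [store] at hj
      · rw [mem_accessible, ← store_injective hj, I.storeWire_index hm] at hk
        exact hk.2

/-- The states in which an idle round has no effect. -/
structure Clean (ρ : Dens CommWire) : Prop where
  supportedOn : Dens.SupportedOn (· ≠ message 0) ρ
  diag : ∀ k x e, I.storeWire k = Wire.bcast x e → Dens.Diag (store k) ρ

theorem relay_cases {t : ℝ} {o : QOp (Wire d)} (ho : I.Admissible t o) :
    I.relay o = [] ∨ ∃ k x e, I.storeWire k = Wire.bcast x e ∧
      (I.relay o = [QOp.copy (message 0) (store k)] ∨
        I.relay o = [QOp.copy (store k) (message 0)]) := by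
  obtain ⟨hloc, hsig, -⟩ := ho
  rcases hloc with h | ⟨a, e, rfl, ha⟩ | ⟨y, e, b, rfl, hy, hb⟩
  · exact Or.inl (I.relay_eq_nil h)
  · have hm := hsig (Wire.bcast (I.track t, t) e) (by simp [QOp.wires]) trivial
    exact Or.inr ⟨_, _, _, I.storeWire_index hm, Or.inl rfl⟩
  · have hm := hsig (Wire.bcast y e) (by simp [QOp.wires]) trivial
    exact Or.inr ⟨_, _, _, I.storeWire_index hm, Or.inr (I.relay_read hb)⟩

/-- If the relay emits, it adds `message 0`, which is 0, to a broadcast. If it reads, it copies a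
classical bit into `message 0` without disturbance, and the sender clears that bit. The two
exchanges cancel. -/
theorem run_idle {t : ℝ} {o : QOp (Wire d)} (ho : I.Admissible t o) {ρ : Dens CommWire}
    (hρ : I.Clean ρ) : Dens.run (exchange (I.accessible t) ++ (I.relay o ++
      ([QOp.copy (message 0) (message 0)] ++ (exchange (I.accessible t)).reverse))) ρ = ρ := by
  classical
  have h0 : Dens.SupportedOn (· ≠ message 0) (Dens.run (exchange (I.accessible t)) ρ) := by
    refine hρ.supportedOn.run fun p hp => ?_
    obtain ⟨k, -, hw, -⟩ := mem_exchange hp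
    rw [QOp.actsOn_iff, hw]
    simp [store_ne_message, slot_ne_message_zero]
  have hd : ∀ k x e, I.storeWire k = Wire.bcast x e →
      Dens.Diag (store k) (Dens.run (exchange (I.accessible t)) ρ) := by
    intro k x e hk
    have : ∀ L : List (QOp CommWire), (∀ p ∈ L, store k ∉ p.wires) → ∀ σ, Dens.Diag (store k) σ →
        Dens.Diag (store k) (Dens.run L σ) := by
      intro L
      induction L with
      | nil => exact fun _ σ h => h
      | cons p L ih =>
        exact fun h σ hσ => ih (fun p hp => h p (List.mem_cons_of_mem _ hp)) _
          (hσ.apply_of_not_mem (h p List.mem_cons_self))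
    refine this _ (fun p hp => ?_) _ (hρ.diag k x e hk)
    obtain ⟨j, hj, hw, -⟩ := mem_exchange hp
    rw [hw]
    simp only [List.mem_cons, store_ne_slot, List.not_mem_nil, or_false]
    intro h
    rw [mem_accessible, ← store_injective h, hk] at hj
    exact hj.2
  have key : Dens.run (I.relay o ++ [QOp.copy (message 0) (message 0)])
      (Dens.run (exchange (I.accessible t)) ρ) = Dens.run (exchange (I.accessible t)) ρ := by
    refine Dens.eq_of_forall_support (L := Dens.runHom _) ?_
    rintro ⟨c, c'⟩ hcc
    obtain ⟨hc, hc'⟩ := h0 _ hcc (message 0) (by simp)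
    simp only at hc hc'
    -- The self-copy erases the bit because x xor x = 0.
    have reset : ∀ (c c' : Conf CommWire), c (message 0) = c' (message 0) →
        (QOp.copy (message 0) (message 0)).apply (Finsupp.single (c, c') 1) = Finsupp.single
          (Function.update c (message 0) false, Function.update c' (message 0) false) 1 := by
      intro c c' h
      rw [QOp.apply_copy_of_eq h, Bool.xor_self, Bool.xor_self]
    have hup : Function.update c (message 0) false = c := by
      rw [← hc, Function.update_eq_self]
    have hup' : Function.update c' (message 0) false = c' := by
      rw [← hc', Function.update_eq_self]
    rw [Dens.runHom_apply, Dens.run_append]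
    rcases I.relay_cases ho with h | ⟨k, x, e, hk, h | h⟩ <;>
      rw [h] <;> simp only [Dens.run_cons, Dens.run_nil]
    · rw [reset _ _ (hc.trans hc'.symm), hup, hup']
    · rw [QOp.apply_copy_of_eq (hc.trans hc'.symm), hc, hc', Bool.xor_false, Bool.xor_false,
        Function.update_eq_self, Function.update_eq_self, reset _ _ (hc.trans hc'.symm), hup, hup']
    · have hck : c (store k) = c' (store k) := hd k x e hk _ hcc
      rw [QOp.apply_copy_of_eq hck, hc, hc', Bool.false_xor, Bool.false_xor,
        reset _ _ (by simp [hck]), Function.update_idem, Function.update_idem, hup, hup']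
  rw [Dens.run_append, ← List.append_assoc, Dens.run_append, key]
  exact Dens.run_reverse_run (exchange_involutive _) ρ

end Interface

/-! ## Two programs on one schedule -/

section Schedule

variable {d : ℕ}

/-- The events of two programs in chronological order, each one with the name of its program. -/
noncomputable def schedule (p : Bool → List (PartyEvent d)) : List (Bool × PartyEvent d) :=
  open Classical in
  List.merge ((p false).map (Prod.mk false)) ((p true).map (Prod.mk true))
    fun a b => decide (a.2.time ≤ b.2.time)

theorem mem_schedule {p : Bool → List (PartyEvent d)} {x : Bool × PartyEvent d} :
    x ∈ schedule p ↔ x.2 ∈ p x.1 := by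
  obtain ⟨b, e⟩ := x
  cases b <;> simp [schedule, List.mem_merge]

theorem schedule_sorted {p : Bool → List (PartyEvent d)}
    (h : ∀ b, (p b).Pairwise fun a b => a.time ≤ b.time) :
    (schedule p).Pairwise fun a b => a.2.time ≤ b.2.time := by
  classical
  have := List.pairwise_merge (le := fun a b : Bool × PartyEvent d => decide (a.2.time ≤ b.2.time))
    (fun a b c hab hbc => by simpa using (of_decide_eq_true hab).trans (of_decide_eq_true hbc))
    (fun a b => by simpa using le_total a.2.time b.2.time)
    ((p false).map (Prod.mk false)) ((p true).map (Prod.mk true))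
    (List.pairwise_map.2 ((h false).imp fun h => by simpa using h))
    (List.pairwise_map.2 ((h true).imp fun h => by simpa using h))
  refine List.Pairwise.imp (fun h => of_decide_eq_true h) ?_
  unfold schedule
  convert this

theorem length_schedule (p : Bool → List (PartyEvent d)) :
    (schedule p).length = (p false).length + (p true).length := by
  simp [schedule, List.length_merge]

/-- A merge keeps the order within each list, so removing the other prover's entries gives back the
original program. -/
theorem schedule_flatMap (p : Bool → List (PartyEvent d)) (b : Bool) :
    ((schedule p).flatMap fun x => if x.1 = b then [x.2] else []) = p b := by
  have h1 : ((schedule p).filter fun x => decide (x.1 = b)) = (p b).map (Prod.mk b) := by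
    cases b
    · exact filter_merge (by simp) (by simp)
    · exact filter_merge_right (by simp) (by simp)
  have h2 : ∀ l : List (Bool × PartyEvent d), (l.flatMap fun x => if x.1 = b then [x.2] else []) =
      (l.filter fun x => decide (x.1 = b)).map Prod.snd := by
    intro l
    induction l with
    | nil => rfl
    | cons x l ih =>
      rw [List.flatMap_cons, ih, List.filter_cons]
      by_cases h : x.1 = b <;> simp [h]
  rw [h2, h1, List.map_map]
  exact List.map_id _

end Schedule

/-! ## The simulation of an honest prover -/

namespace Interface

open CommWire

variable {d : ℕ} (I : Interface d)

open Classical in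
/-- What the honest sender does before and after the operations of `relay`. -/
noncomputable def moves (t : ℝ) (o : QOp (Wire d)) : List (QOp CommWire) × List (QOp CommWire) :=
  if h : I.Admissible t o then
    ((I.exists_moves h).choose, (I.exists_moves h).choose_spec.choose) else ([], [])

theorem moves_local (t : ℝ) (o : QOp (Wire d)) :
    (I.moves t o).1.length ≤ 1 ∧ (I.moves t o).2.length ≤ 1 ∧
      ∀ p ∈ (I.moves t o).1 ++ (I.moves t o).2, p.ActsOn SenderSide ∧ p.Elementary := by
  unfold moves
  split_ifs with h
  · obtain ⟨h1, h2, h3, -⟩ := (I.exists_moves h).choose_spec.choose_spec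
    exact ⟨h1, h2, h3⟩
  · simp

theorem moves_spec {t : ℝ} {o : QOp (Wire d)} (h : I.Admissible t o) :
    ∃ o' : QOp CommWire, o'.map (I.emb honestReg) = o ∧ ∀ ρ,
      Dens.run (exchange (I.accessible t) ++ ((I.moves t o).1 ++ I.relay o ++
        ((I.moves t o).2 ++ (exchange (I.accessible t)).reverse))) ρ = o'.apply ρ := by
  unfold moves
  rw [dif_pos h]
  exact (I.exists_moves h).choose_spec.choose_spec.2.2.2

open Classical in
/-- The three rounds for an event of an honest prover: the prover gets the signals that it can
access, broadcasts are relayed, and the signals are returned. -/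
noncomputable def rounds (x : Bool × PartyEvent d) : List Round :=
  [⟨x.2.time, exchange (I.accessible x.2.time), fun _ => []⟩,
    ⟨x.2.time, I.relay x.2.op, fun b => if x.1 = b then (I.moves x.2.time x.2.op).1 else []⟩,
    ⟨x.2.time, (exchange (I.accessible x.2.time)).reverse, fun b =>
      -- In an idle round a bit relayed for the other prover is discarded by the self-copy.
      if x.1 = b then (I.moves x.2.time x.2.op).2 else [QOp.copy (message 0) (message 0)]⟩]

theorem mem_rounds_time {x : Bool × PartyEvent d} {δ : Round} (h : δ ∈ I.rounds x) :
    δ.time = x.2.time := by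
  simp only [rounds, List.mem_cons, List.not_mem_nil, or_false] at h
  rcases h with rfl | rfl | rfl <;> rfl

theorem rounds_sorted {es : List (Bool × PartyEvent d)}
    (h : es.Pairwise fun a b => a.2.time ≤ b.2.time) :
    (es.flatMap I.rounds).Pairwise fun a b => a.time ≤ b.time := by
  induction es with
  | nil => exact List.Pairwise.nil
  | cons x es ih =>
    rw [List.pairwise_cons] at h
    rw [List.flatMap_cons]
    refine List.pairwise_append.2 ⟨?_, ih h.2, fun δ hδ δ' hδ' => ?_⟩
    · exact List.pairwise_of_forall_mem_list fun δ hδ δ' hδ' => by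
        rw [I.mem_rounds_time hδ, I.mem_rounds_time hδ']
    · obtain ⟨y, hy, hδ'⟩ := List.mem_flatMap.1 hδ'
      rw [I.mem_rounds_time hδ, I.mem_rounds_time hδ']
      exact h.1 y hy

theorem mem_rounds_move {x : Bool × PartyEvent d} {δ : Round} (h : δ ∈ I.rounds x) (b : Bool) :
    (δ.move b).length ≤ 1 ∧ ∀ p ∈ δ.move b, p.ActsOn SenderSide ∧ p.Elementary := by
  obtain ⟨h1, h2, h3⟩ := I.moves_local x.2.time x.2.op
  simp only [rounds, List.mem_cons, List.not_mem_nil, or_false] at h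
  rcases h with rfl | rfl | rfl
  · simp
  · dsimp only
    split_ifs
    · exact ⟨h1, fun p hp => h3 p (List.mem_append_left _ hp)⟩
    · simp
  · dsimp only
    split_ifs
    · exact ⟨h2, fun p hp => h3 p (List.mem_append_right _ hp)⟩
    · refine ⟨le_rfl, fun p hp => ?_⟩
      rw [List.mem_singleton.1 hp]
      exact ⟨⟨trivial, trivial⟩, trivial⟩

theorem mem_relay {o : QOp (Wire d)} {p : QOp CommWire} (hp : p ∈ I.relay o) :
    ∃ x e, (∃ a, o = QOp.copy a (Wire.bcast x e) ∧
        p = QOp.copy (message 0) (store (I.index (Wire.bcast x e)))) ∨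
      (∃ a, o = QOp.copy (Wire.bcast x e) a ∧
        p = QOp.copy (store (I.index (Wire.bcast x e))) (message 0)) := by
  match o, hp with
  | QOp.channel _ _, hp => simp [relay] at hp
  | QOp.measure _, hp => simp [relay] at hp
  | QOp.copy a (Wire.bcast x e), hp =>
    exact ⟨x, e, Or.inl ⟨a, rfl, by simpa [relay] using hp⟩⟩
  | QOp.copy (Wire.bcast x e) (Wire.mem _ _ _), hp =>
    exact ⟨x, e, Or.inr ⟨_, rfl, by simpa [relay] using hp⟩⟩
  | QOp.copy (Wire.bcast x e) (Wire.ray _ _ _), hp =>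
    exact ⟨x, e, Or.inr ⟨_, rfl, by simpa [relay] using hp⟩⟩
  | QOp.copy (Wire.mem _ _ _) (Wire.mem _ _ _), hp => simp [relay] at hp
  | QOp.copy (Wire.mem _ _ _) (Wire.ray _ _ _), hp => simp [relay] at hp
  | QOp.copy (Wire.ray _ _ _) (Wire.mem _ _ _), hp => simp [relay] at hp
  | QOp.copy (Wire.ray _ _ _) (Wire.ray _ _ _), hp => simp [relay] at hp

theorem length_relay_le (o : QOp (Wire d)) : (I.relay o).length ≤ 1 := by
  unfold relay
  split <;> simp

theorem mem_rounds_iface {x : Bool × PartyEvent d} {δ : Round} (h : δ ∈ I.rounds x) :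
    δ.iface.length ≤ I.signals.length + 1 ∧
      ∀ p ∈ δ.iface, p.ActsOn ReceiverSide ∧ p.Elementary := by
  have hlen : (exchange (I.accessible x.2.time)).length ≤ I.signals.length + 1 := by
    rw [exchange, List.length_map, accessible]
    refine (List.length_filter_le _ _).trans ?_
    simp
  have hex : ∀ p ∈ exchange (I.accessible x.2.time), p.ActsOn ReceiverSide ∧ p.Elementary := by
    intro p hp
    obtain ⟨k, -, hw, he⟩ := mem_exchange hp
    refine ⟨?_, he⟩
    rw [QOp.actsOn_iff, hw]
    simp [ReceiverSide, store, slot]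
  simp only [rounds, List.mem_cons, List.not_mem_nil, or_false] at h
  rcases h with rfl | rfl | rfl
  · exact ⟨hlen, hex⟩
  · refine ⟨(I.length_relay_le _).trans (Nat.le_add_left _ _), fun p hp => ?_⟩
    obtain ⟨x, e, ⟨a, -, rfl⟩ | ⟨a, -, rfl⟩⟩ := I.mem_relay hp <;>
      exact ⟨⟨trivial, trivial⟩, trivial⟩
  · refine ⟨by rwa [List.length_reverse], fun p hp => hex p (List.mem_reverse.1 hp)⟩

/-- A single prover on the track can carry out the interface operations itself. -/
theorem mem_rounds_localAt {x : Bool × PartyEvent d} (hx : I.Admissible x.2.time x.2.op)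
    {δ : Round} (h : δ ∈ I.rounds x) (N : ℕ) {p : QOp CommWire} (hp : p ∈ δ.iface) :
    (p.map (I.emb (soloReg N))).LocalAt Side.prover 0 (I.track δ.time, δ.time) := by
  rw [I.mem_rounds_time h]
  have hex : ∀ p ∈ exchange (I.accessible x.2.time), (p.map (I.emb (soloReg N))).LocalAt
      Side.prover 0 (I.track x.2.time, x.2.time) := by
    intro p hp
    obtain ⟨k, hk, hw, -⟩ := mem_exchange hp
    refine Or.inl ?_
    rw [QOp.actsOn_map, QOp.actsOn_iff, hw]
    intro w hw
    rcases List.mem_cons.1 hw with rfl | hw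
    · rw [emb_store]; exact (I.mem_accessible.1 hk).2
    · rw [List.mem_singleton.1 hw, slot, emb_message]; exact ⟨rfl, rfl⟩
  have hmsg : Wire.AccessibleAt Side.prover 0 (I.track x.2.time, x.2.time)
      (I.emb (soloReg N) (message 0)) := ⟨rfl, rfl⟩
  simp only [rounds, List.mem_cons, List.not_mem_nil, or_false] at h
  rcases h with rfl | rfl | rfl
  · exact hex p hp
  · obtain ⟨y, e, ⟨a, ha, rfl⟩ | ⟨a, ha, rfl⟩⟩ := I.mem_relay hp
    · have hm := hx.mem_signals (Wire.bcast y e) (by simp [ha, QOp.wires]) trivial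
      simp only [QOp.map, emb_store, I.storeWire_index hm]
      -- The honest event is itself local, so a broadcast it writes is emitted at this very
      -- spacetime point, and the prover on the track may emit it from its message qubit too.
      have hl := hx.localAt
      rw [ha] at hl
      rcases hl with hl | ⟨a', e', hl, -⟩ | ⟨y', e', b, hl, -, hb⟩
      · exact hl.2.elim
      · obtain ⟨-, hl⟩ := QOp.copy.inj hl
        obtain ⟨rfl, rfl⟩ := Wire.bcast.inj hl
        exact Or.inr (Or.inl ⟨_, _, rfl, hmsg⟩)
      · obtain ⟨-, rfl⟩ := QOp.copy.inj hl
        exact hb.elim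
    · have hm := hx.mem_signals (Wire.bcast y e) (by simp [ha, QOp.wires]) trivial
      simp only [QOp.map, emb_store, I.storeWire_index hm]
      have hl := hx.localAt
      rw [ha] at hl
      rcases hl with hl | ⟨a', e', hl, hb⟩ | ⟨y', e', b, hl, hy, -⟩
      · exact hl.1.elim
      · obtain ⟨rfl, -⟩ := QOp.copy.inj hl
        exact hb.elim
      · obtain ⟨hl, -⟩ := QOp.copy.inj hl
        obtain ⟨rfl, rfl⟩ := Wire.bcast.inj hl
        exact Or.inr (Or.inr ⟨_, _, _, rfl, hy, hmsg⟩)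
  · exact hex p (List.mem_reverse.1 hp)

/-- The states of the real world that the honest simulation meets. -/
def Faithful (σ : Dens (Wire d)) : Prop :=
  (∃ ρ, σ = Dens.extend (I.emb honestReg) ρ ∧ Dens.SupportedOn (· ≠ message 0) ρ) ∧
    ∀ x e, Dens.Diag (Wire.bcast x e) σ

/-- Properties of the world are read back through the encoding, which loses no information. -/
theorem Faithful.clean {I : Interface d} {ρ : Dens CommWire}
    (h : I.Faithful (Dens.extend (I.emb honestReg) ρ)) : I.Clean ρ := by
  obtain ⟨⟨ρ', hρ', hs⟩, hd⟩ := h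
  have : ρ = ρ' := by
    rw [← Dens.restrict_extend_self (I.emb honestReg) ρ, hρ', Dens.restrict_extend_self]
  refine ⟨this ▸ hs, fun k x e hk => Dens.Diag.of_extend (f := I.emb honestReg) ?_⟩
  rw [emb_store, hk]
  exact hd x e

theorem faithful_vacuum : I.Faithful Dens.vacuum := by
  refine ⟨⟨Dens.vacuum, (Dens.run_vacuum_extend _).symm, Dens.supportedOn_vacuum _⟩, ?_⟩
  intro x e cc hcc
  rw [Dens.vacuum] at hcc
  rw [Finset.mem_singleton.1 (Finsupp.support_single_subset hcc)]

theorem Faithful.apply {I : Interface d} {σ : Dens (Wire d)} (hσ : I.Faithful σ)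
    {o : QOp (Wire d)} (ho : ∃ o' : QOp CommWire, o'.map (I.emb honestReg) = o)
    (hm : o.ActsOn (· ≠ I.emb honestReg (message 0)))
    (hd : ∀ x e σ, Dens.Diag (Wire.bcast x e) σ → Dens.Diag (Wire.bcast x e) (o.apply σ)) :
    I.Faithful (o.apply σ) := by
  obtain ⟨⟨ρ, rfl, hs⟩, hdiag⟩ := hσ
  obtain ⟨o', rfl⟩ := ho
  refine ⟨⟨o'.apply ρ, Dens.apply_map_extend _ _ _, hs.apply ?_⟩, fun x e => hd x e _ (hdiag x e)⟩
  exact (QOp.actsOn_map.1 hm).mono fun w hw h => hw (h ▸ rfl)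

theorem Faithful.apply_local {I : Interface d} {σ : Dens (Wire d)} (hσ : I.Faithful σ)
    {o : QOp (Wire d)} (ho : ∃ o' : QOp CommWire, o'.map (I.emb honestReg) = o) {s : Side} {i : ℕ}
    (hi : s = Side.prover → i = 0) {x : SpacetimePoint d} (hl : o.LocalAt s i x) :
    I.Faithful (o.apply σ) := by
  refine hσ.apply ho ?_ fun y e σ h => bcast_diag_of_local hl h
  -- The message register is placed with prover 1, who is absent; verifiers and prover 0 cannot
  -- reach it, so `message 0` stays at |0⟩.
  refine (hl.actsOn_reachable (k := 1) (τ := x.2) (fun h => by rw [hi h]; exact one_pos)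
    le_rfl).mono ?_
  rintro w hw rfl
  exact absurd hw (lt_irrefl 1)

/-- The honest simulation is perfect. -/
theorem run_honest {p : Bool → List (PartyEvent d)}
    (hsort : ∀ b, (p b).Pairwise fun a b => a.time ≤ b.time)
    (hp : ∀ b, ∀ e ∈ p b, e.who = 0 ∧ I.Admissible e.time e.op)
    {m : ℕ} {loc : ℕ → ℝ → Space d} {l : List (PartyEvent d)}
    (hl : IsProgram Side.verifier m loc l)
    (hsig : ∀ e ∈ l, e.op.ActsOn fun w => w ∈ Set.range (verifierMem d) ∨ w ∈ I.signals)
    {S : SenderStrategy} {init : List (QOp CommWire)} {b : Bool}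
    (hS : S.move = honestMove init ((schedule p).flatMap I.rounds) b) {σ : Dens (Wire d)}
    (hσ : I.Faithful σ) :
    Dens.run (interact l (proverEvents S (I.emb honestReg) 1 ((schedule p).flatMap I.rounds))) σ =
      Dens.run (interact l (p b)) σ ∧ I.Faithful (Dens.run (interact l (p b)) σ) := by
  have hadm : ∀ x ∈ schedule p, x.2.who = 0 ∧ I.Admissible x.2.time x.2.op := fun x hx =>
    hp x.1 x.2 (mem_schedule.1 hx)
  set B : Bool × PartyEvent d → List (QOp (Wire d)) := fun x =>
    ((I.rounds x).flatMap fun δ => δ.move b ++ δ.iface).map (QOp.map (I.emb honestReg)) with hBdef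
  set B' : Bool × PartyEvent d → List (QOp (Wire d)) := fun x =>
    if x.1 = b then [x.2.op] else [] with hB'def
  -- The three rounds of an event share its time and can be read as one block, to be compared with
  -- the event itself or with doing nothing.
  have e1 : proverEvents S (I.emb honestReg) 1 ((schedule p).flatMap I.rounds) =
      (schedule p).flatMap fun x => (B x).map fun o => ⟨0, x.2.time, o⟩ := by
    rw [proverEvents_honest hS, List.flatMap_assoc]
    refine List.flatMap_congr fun x _ => ?_
    rw [hBdef]
    simp only [rounds, List.flatMap_cons, List.flatMap_nil, List.append_nil, List.map_append,
      List.map_map]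
    rfl
  have e2 : ((schedule p).flatMap fun x => (B' x).map fun o => (⟨0, x.2.time, o⟩ : PartyEvent d)) =
      p b := by
    rw [← schedule_flatMap p b]
    refine List.flatMap_congr fun x hx => ?_
    rw [hB'def]
    dsimp only
    split_ifs
    · obtain ⟨b', who, time, op⟩ := x
      have := (hadm _ hx).1
      dsimp only at this
      rw [this]; rfl
    · rfl
  have := run_interact_flatMap (Inv := I.Faithful) (time := fun x => x.2.time) (B := B) (B' := B')
    (schedule_sorted hsort) hl.sorted (fun e he σ hσ => hσ.apply_local
      ⟨_, I.map_dec honestReg (hsig e he)⟩ (fun h => by cases h) (hl.located e he).2) ?_ ?_ hσ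
  · rwa [← e1, e2] at this
  · intro x hx σ hσ
    have hx' := (hadm x hx).2
    have hc := hσ
    obtain ⟨⟨ρ, rfl, -⟩, -⟩ := hσ
    have hc := hc.clean
    rw [hBdef, hB'def]
    dsimp only
    rw [Dens.run_map_extend]
    simp only [rounds, List.flatMap_cons, List.flatMap_nil, List.append_nil, List.nil_append]
    by_cases hb : x.1 = b
    · simp only [if_pos hb]
      obtain ⟨o', ho', h⟩ := I.moves_spec hx'
      rw [h, Dens.run_cons, Dens.run_nil, ← Dens.apply_map_extend, ho']
    · simp only [if_neg hb]
      rw [List.nil_append, I.run_idle hx' hc, Dens.run_nil]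
  · intro x hx σ hσ
    rw [hB'def]
    dsimp only
    split_ifs
    · obtain ⟨o', ho', -⟩ := I.moves_spec (hadm x hx).2
      exact hσ.apply_local ⟨o', ho'⟩ (fun _ => rfl) (hadm x hx).2.localAt
    · exact hσ

end Interface

/-! ## The bit commitment scheme -/

namespace QOp

variable {W V : Type}

open Classical in
/-- The operation whose image under `f` is the given one. -/
noncomputable def pullback (f : W ↪ V) (q : W) (o : QOp V) : QOp W :=
  if h : ∃ o' : QOp W, o'.map f = o then h.choose else measure q

theorem map_pullback {f : W ↪ V} (q : W) {o : QOp V} (h : o.ActsOn (· ∈ Set.range f)) :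
    (o.pullback f q).map f = o := by
  have hex : ∃ o' : QOp W, o'.map f = o := by
    obtain ⟨o', ho', -⟩ := exists_map_eq f (A := fun _ => True)
      (h.mono fun v ⟨w, hw⟩ => ⟨w, trivial, hw⟩)
    exact ⟨o', ho'⟩
  rw [pullback, dif_pos hex]
  exact hex.choose_spec

theorem Elementary.pullback {f : W ↪ V} (q : W) {o : QOp V} (h : o.Elementary) :
    (o.pullback f q).Elementary := by
  unfold QOp.pullback
  split_ifs with hex
  · rw [← elementary_map (f := f), hex.choose_spec]
    exact h
  · trivial

end QOp

namespace CommWire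

def senderEmb : ℕ ↪ CommWire := ⟨sender, fun i j h => by simpa using h⟩

/-- The place of a qubit of the verifiers in the receiver's memory. -/
def vmemIndex : ℕ × ℕ ↪ ℕ := ⟨fun q => recvEquiv (Sum.inl q), fun p q h => by simpa using h⟩

theorem vmemIndex_trans : vmemIndex.trans receiverEmb = vmemEmb := rfl

/-- The numbering has to send the verifiers' decision qubit to qubit 0, where the receiver's
decision is read. -/
theorem vmemIndex_zero : vmemIndex (0, 0) = 0 := by
  simp [vmemIndex, recvEquiv, Equiv.natSumNatEquivNat, Nat.pair]

end CommWire

namespace Interface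

open CommWire

variable {d : ℕ} (I : Interface d)

theorem elementary_dec {o : QOp (Wire d)} (h : o.Elementary) : (I.dec o).Elementary := by
  unfold dec
  split_ifs with hex
  · rw [QOp.elementary_map, ← QOp.elementary_map (f := I.recvEmb), hex.choose_spec]
    exact h
  · trivial

/-- With zero provers allowed for, a verifier reaches only verifier memories, rays and broadcasts,
and the last two are listed. -/
theorem actsOn_of_verifier {i : ℕ} {x : SpacetimePoint d} {o : QOp (Wire d)}
    (h : o.LocalAt Side.verifier i x) (hs : ∀ w ∈ o.wires, w.IsSignal → w ∈ I.signals) :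
    o.ActsOn fun w => w ∈ Set.range (verifierMem d) ∨ w ∈ I.signals := by
  have hr := QOp.actsOn_iff.1 (h.actsOn_reachable (k := 0) (τ := x.2) (fun h => by cases h) le_rfl)
  refine QOp.actsOn_iff.2 fun w hw => ?_
  have hw' := hr w hw
  match w, hw, hw' with
  | Wire.mem Side.verifier i j, _, _ => exact Or.inl ⟨(i, j), rfl⟩
  | Wire.mem Side.prover i _, _, h => exact absurd h (Nat.not_lt_zero i)
  | Wire.ray _ _ _, hw, h => exact Or.inr (hs _ hw h)
  | Wire.bcast _ _, hw, _ => exact Or.inr (hs _ hw trivial)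

end Interface

namespace PositionCommitment

open CommWire

variable {d : ℕ}

/-- Two distinct points that can be committed to on one worldline. -/
structure Pair (C : PositionCommitment d) where
  point : Bool → SpacetimePoint d
  mem : ∀ b, point b ∈ C.points
  ne : point false ≠ point true
  track : ℝ → Space d
  track_eq : ∀ b, C.track (point b) = track

namespace Pair

variable {C : PositionCommitment d} (p : C.Pair)

/-- All operations of the verifiers and of the two honest provers. -/
noncomputable def ops (n : ℕ) : List (QOp (Wire d)) :=
  (C.commit.events n).map PartyEvent.op ++
    ((C.reveal (p.point false) n).map PartyEvent.op ++
      ((C.reveal (p.point true) n).map PartyEvent.op ++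
        (((C.prover (p.point false)).events n).map PartyEvent.op ++
          ((C.prover (p.point true)).events n).map PartyEvent.op)))

theorem isQPT_ops : IsQPT p.ops :=
  C.commit_efficient.append ((C.reveal_efficient _ (p.mem _)).append
    ((C.reveal_efficient _ (p.mem _)).append ((C.prover_efficient _ (p.mem _)).2.append
      (C.prover_efficient _ (p.mem _)).2)))

open Classical in
-- Collecting the signals of both honest provers and of both Reveal phases makes the interface
-- independent of the bit. Preparations and verdicts act on memories only and add no signals.
noncomputable def interface (n : ℕ) : Interface d where
  signals := (((p.ops n).flatMap QOp.wires).filter fun w => decide w.IsSignal).dedup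
  nodup := List.nodup_dedup _
  isSignal w hw := by simpa using (List.mem_filter.1 (List.mem_dedup.1 hw)).2
  track := p.track

theorem mem_signals {n : ℕ} {o : QOp (Wire d)} (ho : o ∈ p.ops n) {w : Wire d} (hw : w ∈ o.wires)
    (h : w.IsSignal) : w ∈ (p.interface n).signals := by
  simp only [interface, List.mem_dedup, List.mem_filter, List.mem_flatMap, decide_eq_true_eq]
  exact ⟨⟨o, ho, hw⟩, h⟩

/-- An elementary operation touches at most two qubits, so the store that is used has polynomial
size. -/
theorem length_signals_le (n : ℕ) : (p.interface n).signals.length ≤ (p.ops n).length * 2 := by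
  classical
  have key : ∀ l : List (QOp (Wire d)), (∀ o ∈ l, o.Elementary) →
      (l.flatMap QOp.wires).length ≤ l.length * 2 := by
    intro l hl
    rw [List.length_flatMap]
    refine (List.sum_le_card_nsmul _ 2 fun x hx => ?_).trans (by simp)
    obtain ⟨o, ho, rfl⟩ := List.mem_map.1 hx
    exact (hl o ho).length_wires_le
  refine ((List.dedup_sublist _).length_le.trans (List.length_filter_le _ _)).trans ?_
  exact key _ (p.isQPT_ops.2 n)

theorem mem_ops_prover {n : ℕ} {b : Bool} {e : PartyEvent d}
    (he : e ∈ (C.prover (p.point b)).events n) : e.op ∈ p.ops n := by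
  have := List.mem_map_of_mem (f := PartyEvent.op) he
  cases b <;> simp only [ops, List.mem_append] <;> tauto

theorem mem_ops_reveal {n : ℕ} {b : Bool} {e : PartyEvent d}
    (he : e ∈ C.reveal (p.point b) n) : e.op ∈ p.ops n := by
  have := List.mem_map_of_mem (f := PartyEvent.op) he
  cases b <;> simp only [ops, List.mem_append] <;> tauto

theorem mem_ops_commit {n : ℕ} {e : PartyEvent d} (he : e ∈ C.commit.events n) :
    e.op ∈ p.ops n :=
  List.mem_append_left _ (List.mem_map_of_mem he)

theorem prover_size (b : Bool) : (C.prover (p.point b)).size = 1 :=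
  (C.prover_lone _ (p.mem b)).1

theorem admissible {n : ℕ} {b : Bool} {e : PartyEvent d}
    (he : e ∈ (C.prover (p.point b)).events n) :
    e.who = 0 ∧ (p.interface n).Admissible e.time e.op := by
  obtain ⟨h1, h2⟩ := ((C.prover (p.point b)).isProgram n).located e he
  rw [p.prover_size b, Nat.lt_one_iff] at h1
  rw [h1, (C.prover_lone _ (p.mem b)).2, p.track_eq] at h2
  exact ⟨h1, h2, fun w hw => p.mem_signals (p.mem_ops_prover he) hw,
    p.isQPT_ops.2 n _ (p.mem_ops_prover he)⟩

theorem actsOn_commit {n : ℕ} {e : PartyEvent d} (he : e ∈ C.commit.events n) :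
    e.op.ActsOn fun w => w ∈ Set.range (verifierMem d) ∨ w ∈ (p.interface n).signals :=
  (p.interface n).actsOn_of_verifier ((C.commit.isProgram n).located e he).2
    fun _ => p.mem_signals (p.mem_ops_commit he)

theorem actsOn_reveal {n : ℕ} {b : Bool} {e : PartyEvent d} (he : e ∈ C.reveal (p.point b) n) :
    e.op.ActsOn fun w => w ∈ Set.range (verifierMem d) ∨ w ∈ (p.interface n).signals :=
  (p.interface n).actsOn_of_verifier ((C.reveal_isProgram _ n).located e he).2
    fun _ => p.mem_signals (p.mem_ops_reveal he)

theorem actsOn_memory (n : ℕ) {k : ℕ} {o : QOp (Wire d)}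
    (h : o.ActsOn (Wire.InMemory Side.verifier k)) :
    o.ActsOn fun w => w ∈ Set.range (verifierMem d) ∨ w ∈ (p.interface n).signals :=
  h.mono fun _ ⟨i, j, _, hw⟩ => Or.inl ⟨(i, j), hw.symm⟩

/-- The rounds of the Commit phase. -/
noncomputable def commitRounds (n : ℕ) : List Round :=
  (schedule fun b => eventsUntil C.tFinal ((C.prover (p.point b)).events n)).flatMap
    (p.interface n).rounds

/-- The rounds of the Reveal phase. -/
noncomputable def revealRounds (n : ℕ) : List Round :=
  (schedule fun b => eventsAfter C.tFinal ((C.prover (p.point b)).events n)).flatMap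
    (p.interface n).rounds

open Classical in
/-- The signals that are under way at the end of the Commit phase. -/
noncomputable def underway (n : ℕ) : List ℕ :=
  (List.range (p.interface n).signals.length).filter fun k =>
    decide (Wire.Reachable 1 C.tFinal ((p.interface n).storeWire k))

theorem mem_underway {n k : ℕ} : k ∈ p.underway n ↔ k < (p.interface n).signals.length ∧
    Wire.Reachable 1 C.tFinal ((p.interface n).storeWire k) := by
  simp [underway]

theorem underway_nodup (n : ℕ) : (p.underway n).Nodup := List.nodup_range.filter _

/-- At the end of the Commit phase the receiver sends away the signals that are under way. -/
noncomputable def dump (n : ℕ) : List (QOp CommWire) := exchange (p.underway n)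

theorem mem_dump {n : ℕ} {o : QOp CommWire} (ho : o ∈ p.dump n) :
    o.ActsOn ReceiverSide ∧ o.Elementary := by
  obtain ⟨k, -, hw, he⟩ := mem_exchange ho
  refine ⟨?_, he⟩
  rw [QOp.actsOn_iff, hw]
  simp [ReceiverSide, store, slot]

theorem length_dump_le (n : ℕ) : (p.dump n).length ≤ (p.ops n).length * 2 := by
  rw [dump, exchange, List.length_map, underway]
  refine (List.length_filter_le _ _).trans ?_
  rw [List.length_range]
  exact p.length_signals_le n

/-- The memory of the prover. -/
def senderMem (d : ℕ) : ℕ ↪ Wire d :=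
  ⟨fun j => Wire.mem Side.prover 0 j, fun i j h => by simpa using h⟩

/-- The preparation of the honest sender. -/
noncomputable def senderPrep (b : Bool) (n : ℕ) : List (QOp CommWire) :=
  ((C.prover (p.point b)).prep n).map fun o => (o.pullback (senderMem d) 0).map senderEmb

theorem map_senderPrep (b : Bool) (n : ℕ) :
    (p.senderPrep b n).map (QOp.map ((p.interface n).emb Interface.honestReg)) =
      (C.prover (p.point b)).prep n := by
  rw [senderPrep, List.map_map]
  conv_rhs => rw [← List.map_id ((C.prover (p.point b)).prep n)]
  refine List.map_congr_left fun o ho => ?_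
  rw [Function.comp_apply, QOp.map_map, show senderEmb.trans _ = senderMem d from rfl]
  refine QOp.map_pullback _ (((C.prover (p.point b)).prep_mem n o ho).mono ?_)
  rintro w ⟨i, j, hi, rfl⟩
  rw [p.prover_size b, Nat.lt_one_iff] at hi
  exact ⟨j, by rw [hi]; rfl⟩

theorem senderPrep_local {b : Bool} {n : ℕ} {o : QOp CommWire} (ho : o ∈ p.senderPrep b n) :
    o.ActsOn SenderSide ∧ o.Elementary := by
  obtain ⟨o', ho', rfl⟩ := List.mem_map.1 ho
  refine ⟨QOp.actsOn_map.2 (QOp.actsOn_iff.2 fun _ _ => trivial), QOp.elementary_map.2 ?_⟩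
  exact ((C.prover_efficient _ (p.mem b)).1.2 n o' ho').pullback _

theorem map_dec_prep (n : ℕ) (r : ℕ ⊕ ℕ ↪ ℕ × ℕ) :
    ((C.verifiers.prep n).map (p.interface n).dec).map (QOp.map ((p.interface n).emb r)) =
      C.verifiers.prep n := by
  rw [List.map_map]
  conv_rhs => rw [← List.map_id (C.verifiers.prep n)]
  exact List.map_congr_left fun o ho => (p.interface n).map_dec r
    (p.actsOn_memory n (C.verifiers.prep_mem n o ho))

theorem map_dec_verdict (b : Bool) (n : ℕ) (r : ℕ ⊕ ℕ ↪ ℕ × ℕ) :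
    ((C.verdict (p.point b) n).map (p.interface n).dec).map (QOp.map ((p.interface n).emb r)) =
      C.verdict (p.point b) n := by
  rw [List.map_map]
  conv_rhs => rw [← List.map_id (C.verdict (p.point b) n)]
  exact List.map_congr_left fun o ho => (p.interface n).map_dec r
    (p.actsOn_memory n (C.verdict_mem _ n o ho))

end Pair

end PositionCommitment

theorem honestMove_local {P : QOp CommWire → Prop} {init : List (QOp CommWire)} {D : List Round}
    {b : Bool} (hi : ∀ o ∈ init, P o) (hD : ∀ δ ∈ D, ∀ o ∈ δ.move b, P o) (r : ℕ) :
    ∀ o ∈ honestMove init D b r, P o := by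
  cases r with
  | zero => exact hi
  | succ r =>
    intro o ho
    rw [honestMove] at ho
    cases h : D[r]? with
    | none => rw [h] at ho; exact absurd ho (by simp)
    | some δ =>
      rw [h] at ho
      exact hD δ (List.mem_of_getElem? h) o ho

theorem length_interact {d : ℕ} (l l' : List (PartyEvent d)) :
    (interact l l').length = l.length + l'.length := by
  simp [interact, List.length_merge]

namespace Interface

open CommWire

variable {d : ℕ} (I : Interface d)

theorem length_flatMap_rounds (es : List (Bool × PartyEvent d)) :
    (es.flatMap I.rounds).length = es.length * 3 := by
  induction es with
  | nil => rfl
  | cons x es ih =>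
    rw [List.flatMap_cons, List.length_append, ih, List.length_cons]
    simp only [rounds, List.length_cons, List.length_nil]
    omega

/-- Renaming preserves length, so the operations can be counted in the flattened interaction. Each
event costs three rounds, each consisting of at most one sender operation and one pass over the
signals. -/
theorem length_playRounds_le {S : SenderStrategy} {init pre post : List (QOp CommWire)} {b : Bool}
    {es : List (Bool × PartyEvent d)} {l : List (PartyEvent d)}
    (hes : es.Pairwise fun a b => a.2.time ≤ b.2.time)
    (hl : l.Pairwise fun a b => a.time ≤ b.time)
    (hsig : ∀ e ∈ l, e.op.ActsOn fun w => w ∈ Set.range (verifierMem d) ∨ w ∈ I.signals)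
    (hS : S.move = honestMove init (es.flatMap I.rounds) b) :
    (playRounds S (cutRounds I.dec post pre l (es.flatMap I.rounds))).length ≤
      init.length + (pre.length + (l.length + es.length * 3 * (I.signals.length + 2) +
        post.length)) := by
  rw [← List.length_map (f := QOp.map (I.emb honestReg)), playRounds,
    map_cutRounds S _ (fun e he => I.map_dec _ (hsig e he)) hl (I.rounds_sorted hes)]
  simp only [List.length_append, List.length_map, length_interact]
  have h0 : S.move 0 = init := by rw [hS]; rfl
  rw [h0]
  have : (proverEvents S (I.emb honestReg) (0 + 1) (es.flatMap I.rounds)).length ≤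
      es.length * 3 * (I.signals.length + 2) := by
    rw [zero_add, proverEvents_honest hS, List.length_flatMap, ← I.length_flatMap_rounds es]
    refine (List.sum_le_card_nsmul _ (I.signals.length + 2) fun x hx => ?_).trans (by simp)
    obtain ⟨δ, hδ, rfl⟩ := List.mem_map.1 hx
    obtain ⟨y, -, hy⟩ := List.mem_flatMap.1 hδ
    rw [List.length_map, List.length_append]
    have h1 := (I.mem_rounds_move hy b).1
    have h2 := (I.mem_rounds_iface hy).1
    omega
  omega

end Interface

theorem elementary_playRounds {S : SenderStrategy} {R : List (List (QOp CommWire))}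
    (hS : ∀ r, ∀ o ∈ S.move r, o.Elementary) (hR : ∀ m ∈ R, ∀ o ∈ m, o.Elementary) :
    ∀ o ∈ playRounds S R, o.Elementary := by
  intro o ho
  obtain ⟨⟨m, r⟩, hm, ho⟩ := List.mem_flatMap.1 ho
  rcases List.mem_append.1 ho with ho | ho
  · exact hS _ o ho
  · exact hR m (List.fst_mem_of_mem_zipIdx hm) o ho

/-! ### The scheme, its efficiency and its completeness -/

namespace PositionCommitment.Pair

open CommWire

variable {d : ℕ} {C : PositionCommitment d} (p : C.Pair)

/-- The verifiers' preparation opens the first move, and the signals under way leave with the last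
one. -/
noncomputable def commitR (n : ℕ) : List (List (QOp CommWire)) :=
  cutRounds (p.interface n).dec (p.dump n) ((C.verifiers.prep n).map (p.interface n).dec)
    (C.commit.events n) (p.commitRounds n)

/-- The signals under way are taken back first, after the sender has had the chance to replace them;
the verdict ends the last move. -/
noncomputable def revealR (b : Bool) (n : ℕ) : List (List (QOp CommWire)) :=
  cutRounds (p.interface n).dec ((C.verdict (p.point b) n).map (p.interface n).dec)
    (p.dump n).reverse (C.reveal (p.point b) n) (p.revealRounds n)

theorem mem_commitR {n : ℕ} {m : List (QOp CommWire)} (hm : m ∈ p.commitR n) :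
    ∀ o ∈ m, o.ActsOn ReceiverSide ∧ o.Elementary := by
  refine mem_cutRounds (fun o ho => ?_) (fun o ho => p.mem_dump ho) (fun e he => ?_)
    (fun δ hδ => ?_) m hm
  · obtain ⟨o', ho', rfl⟩ := List.mem_map.1 ho
    exact ⟨Interface.dec_receiverSide _ _,
      Interface.elementary_dec _ (C.verifiers_efficient.1.2 n o' ho')⟩
  · exact ⟨Interface.dec_receiverSide _ _,
      Interface.elementary_dec _ (p.isQPT_ops.2 n _ (p.mem_ops_commit he))⟩
  · obtain ⟨x, -, hx⟩ := List.mem_flatMap.1 hδ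
    exact ((p.interface n).mem_rounds_iface hx).2

theorem mem_revealR {b : Bool} {n : ℕ} {m : List (QOp CommWire)} (hm : m ∈ p.revealR b n) :
    ∀ o ∈ m, o.ActsOn ReceiverSide ∧ o.Elementary := by
  refine mem_cutRounds (fun o ho => p.mem_dump (List.mem_reverse.1 ho)) (fun o ho => ?_)
    (fun e he => ?_) (fun δ hδ => ?_) m hm
  · obtain ⟨o', ho', rfl⟩ := List.mem_map.1 ho
    exact ⟨Interface.dec_receiverSide _ _,
      Interface.elementary_dec _ ((C.verdict_efficient _ (p.mem b)).2 n o' ho')⟩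
  · exact ⟨Interface.dec_receiverSide _ _,
      Interface.elementary_dec _ (p.isQPT_ops.2 n _ (p.mem_ops_reveal he))⟩
  · obtain ⟨x, -, hx⟩ := List.mem_flatMap.1 hδ
    exact ((p.interface n).mem_rounds_iface hx).2

theorem move_commitRounds {n : ℕ} {b : Bool} {δ : Round} (hδ : δ ∈ p.commitRounds n) :
    ∀ o ∈ δ.move b, o.ActsOn SenderSide ∧ o.Elementary := by
  obtain ⟨x, -, hx⟩ := List.mem_flatMap.1 hδ
  exact ((p.interface n).mem_rounds_move hx b).2

theorem move_revealRounds {n : ℕ} {b : Bool} {δ : Round} (hδ : δ ∈ p.revealRounds n) :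
    ∀ o ∈ δ.move b, o.ActsOn SenderSide ∧ o.Elementary := by
  obtain ⟨x, -, hx⟩ := List.mem_flatMap.1 hδ
  exact ((p.interface n).mem_rounds_move hx b).2

noncomputable def senderC (b : Bool) (n : ℕ) : SenderStrategy where
  move := honestMove (p.senderPrep b n) (p.commitRounds n) b
  move_local r o ho := (honestMove_local (P := fun o => o.ActsOn SenderSide ∧ o.Elementary)
    (fun _ => p.senderPrep_local) (fun _ => p.move_commitRounds) r o ho).1

noncomputable def senderR (b : Bool) (n : ℕ) : SenderStrategy where
  move := honestMove [] (p.revealRounds n) b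
  move_local r o ho := (honestMove_local (P := fun o => o.ActsOn SenderSide ∧ o.Elementary)
    (by simp) (fun _ => p.move_revealRounds) r o ho).1

theorem length_events_le (n : ℕ) : ((C.prover (p.point false)).events n).length +
    ((C.prover (p.point true)).events n).length ≤ (p.ops n).length := by
  simp only [ops, List.length_append, List.length_map]
  omega

theorem length_commit_schedule_le (n : ℕ) :
    (schedule fun b => eventsUntil C.tFinal ((C.prover (p.point b)).events n)).length ≤
      (p.ops n).length := by
  rw [length_schedule]
  exact (add_le_add (List.length_filter_le _ _) (List.length_filter_le _ _)).trans
    (p.length_events_le n)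

theorem length_reveal_schedule_le (n : ℕ) :
    (schedule fun b => eventsAfter C.tFinal ((C.prover (p.point b)).events n)).length ≤
      (p.ops n).length := by
  rw [length_schedule]
  exact (add_le_add (List.length_filter_le _ _) (List.length_filter_le _ _)).trans
    (p.length_events_le n)

theorem commit_schedule_sorted (n : ℕ) :
    (schedule fun b => eventsUntil C.tFinal ((C.prover (p.point b)).events n)).Pairwise
      fun a b => a.2.time ≤ b.2.time :=
  schedule_sorted fun b =>
    ((C.prover (p.point b)).isProgram n).sorted.sublist List.filter_sublist

theorem reveal_schedule_sorted (n : ℕ) :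
    (schedule fun b => eventsAfter C.tFinal ((C.prover (p.point b)).events n)).Pairwise
      fun a b => a.2.time ≤ b.2.time :=
  schedule_sorted fun b =>
    ((C.prover (p.point b)).isProgram n).sorted.sublist List.filter_sublist

theorem polyBounded_ops : PolyBounded fun n => (p.ops n).length := p.isQPT_ops.1

theorem polyBounded_rounds : PolyBounded fun n => (p.ops n).length * 3 + 1 :=
  (p.polyBounded_ops.mul (polyBounded_const 3)).add (polyBounded_const 1)

theorem polyBounded_rounds_ops :
    PolyBounded fun n => (p.ops n).length * 3 * ((p.ops n).length * 2 + 2) :=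
  (p.polyBounded_ops.mul (polyBounded_const 3)).mul
    ((p.polyBounded_ops.mul (polyBounded_const 2)).add (polyBounded_const 2))

theorem length_commitR_le (n : ℕ) : (p.commitR n).length ≤ (p.ops n).length * 3 + 1 := by
  rw [commitR, length_cutRounds, commitRounds, Interface.length_flatMap_rounds]
  have := p.length_commit_schedule_le n
  omega

theorem length_revealR_le (b : Bool) (n : ℕ) :
    (p.revealR b n).length ≤ (p.ops n).length * 3 + 1 := by
  rw [revealR, length_cutRounds, revealRounds, Interface.length_flatMap_rounds]
  have := p.length_reveal_schedule_le n
  omega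

theorem isQPT_commit (b : Bool) : IsQPT fun n => playRounds (p.senderC b n) (p.commitR n) := by
  refine ⟨?_, fun n => elementary_playRounds (fun r o ho => (honestMove_local
    (P := fun o => o.ActsOn SenderSide ∧ o.Elementary) (fun _ => p.senderPrep_local)
    (fun _ => p.move_commitRounds) r o ho).2) fun m hm o ho => (p.mem_commitR hm o ho).2⟩
  refine (((C.prover_efficient _ (p.mem b)).1.1.add (C.verifiers_efficient.1.1.add
    ((p.polyBounded_ops.add p.polyBounded_rounds_ops).add
      (p.polyBounded_ops.mul (polyBounded_const 2)))))).mono fun n => ?_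
  refine ((p.interface n).length_playRounds_le (p.commit_schedule_sorted n)
    (C.commit.isProgram n).sorted (fun e he => p.actsOn_commit he) rfl).trans ?_
  have h1 : (C.commit.events n).length ≤ (p.ops n).length := by
    simp only [ops, List.length_append, List.length_map]
    omega
  have h2 := Nat.mul_le_mul (Nat.mul_le_mul_right 3 (p.length_commit_schedule_le n))
    (Nat.add_le_add_right (p.length_signals_le n) 2)
  have h3 := p.length_dump_le n
  simp only [senderPrep, List.length_map]
  omega

theorem isQPT_reveal (b : Bool) :
    IsQPT fun n => playRounds (p.senderR b n) (p.revealR b n) := by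
  refine ⟨?_, fun n => elementary_playRounds (fun r o ho => (honestMove_local
    (P := fun o => o.ActsOn SenderSide ∧ o.Elementary) (by simp)
    (fun _ => p.move_revealRounds) r o ho).2) fun m hm o ho => (p.mem_revealR hm o ho).2⟩
  refine ((C.verdict_efficient _ (p.mem b)).1.add
    ((p.polyBounded_ops.add p.polyBounded_rounds_ops).add
      (p.polyBounded_ops.mul (polyBounded_const 2)))).mono fun n => ?_
  refine ((p.interface n).length_playRounds_le (p.reveal_schedule_sorted n)
    (C.reveal_isProgram _ n).sorted (fun e he => p.actsOn_reveal he) rfl).trans ?_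
  have h1 : (C.reveal (p.point b) n).length ≤ (p.ops n).length := by
    cases b <;> simp only [ops, List.length_append, List.length_map] <;> omega
  have h2 := Nat.mul_le_mul (Nat.mul_le_mul_right 3 (p.length_reveal_schedule_le n))
    (Nat.add_le_add_right (p.length_signals_le n) 2)
  have h3 := p.length_dump_le n
  simp only [List.length_reverse, List.length_map, List.length_nil]
  omega

/-- The bit commitment in which the sender plays a prover that commits to one of the two points. -/
noncomputable def bitCommitment : QuantumBitCommitment where
  commitR := p.commitR
  commitR_local _ _ hm o ho := (p.mem_commitR hm o ho).1
  classical n := (C.classical n).map vmemIndex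
  revealR := p.revealR
  revealR_local _ _ _ hm o ho := (p.mem_revealR hm o ho).1
  senderC := p.senderC
  senderR := p.senderR
  classical_efficient := by simpa only [Finset.card_map] using C.classical_efficient
  commit_rounds := p.polyBounded_rounds.mono p.length_commitR_le
  reveal_rounds b := p.polyBounded_rounds.mono (p.length_revealR_le b)
  commit_efficient := p.isQPT_commit
  reveal_efficient := p.isQPT_reveal

/-! ### The honest sender -/

/-- The state of the world at the end of an honest Commit phase. -/
noncomputable def honestState (b : Bool) (n : ℕ) : Dens (Wire d) :=
  stateAt C.commit (C.prover (p.point b)) n C.tFinal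

theorem actsOn_ne_message {A : Wire d → Prop} {o : QOp (Wire d)} (n : ℕ) (h : o.ActsOn A)
    (hA : ∀ i, ¬ A (Wire.mem Side.prover 1 i)) :
    o.ActsOn (· ≠ (p.interface n).emb Interface.honestReg (message 0)) :=
  h.mono fun w hw he => hA 0 (by subst he; exact hw)

/-- Preparations act on the memories of verifiers and of prover 0 alone, so they touch neither
broadcasts nor the message register. -/
theorem faithful_prep (b : Bool) (n : ℕ) : (p.interface n).Faithful
    (Dens.run (C.verifiers.prep n) (Dens.run ((C.prover (p.point b)).prep n) Dens.vacuum)) := by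
  have key : ∀ (L : List (QOp CommWire)) (A : Wire d → Prop),
      (∀ o ∈ L.map (QOp.map ((p.interface n).emb Interface.honestReg)), o.ActsOn A) →
      (∀ i, ¬ A (Wire.mem Side.prover 1 i)) → (∀ x e, ¬ A (Wire.bcast x e)) →
      ∀ σ, (p.interface n).Faithful σ → (p.interface n).Faithful
        (Dens.run (L.map (QOp.map ((p.interface n).emb Interface.honestReg))) σ) := by
    intro L A hL h1 h2
    induction L with
    | nil => exact fun σ h => h
    | cons o L ih =>
      intro σ hσ
      rw [List.map_cons, Dens.run_cons]
      have ho := hL _ (List.mem_map_of_mem List.mem_cons_self)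
      refine ih (fun o' ho' => hL o' (List.mem_cons_of_mem _ ho')) _ (hσ.apply ⟨o, rfl⟩
        (p.actsOn_ne_message n ho h1) fun x e σ hd => hd.apply_of_not_mem fun hmem =>
          h2 x e (QOp.actsOn_iff.1 ho _ hmem))
  rw [← p.map_dec_prep n Interface.honestReg, ← p.map_senderPrep b n]
  refine key _ (Wire.InMemory Side.verifier C.verifiers.size) ?_ ?_ ?_ _
    (key _ (Wire.InMemory Side.prover 1) ?_ ?_ ?_ _ (p.interface n).faithful_vacuum)
  · rw [p.map_dec_prep]
    exact C.verifiers.prep_mem n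
  · rintro i ⟨_, _, -, h⟩
    cases h
  · rintro x e ⟨_, _, -, h⟩
    cases h
  · rw [p.map_senderPrep, ← p.prover_size b]
    exact (C.prover (p.point b)).prep_mem n
  · rintro i ⟨_, _, h, h'⟩
    cases h'
    exact lt_irrefl 1 h
  · rintro x e ⟨_, _, -, h⟩
    cases h

/-- In the two-party protocol the sender moves first, whereas in spacetime the verifiers'
preparation is listed first; the memories are disjoint. -/
theorem prep_comm (P : Coalition d) (n : ℕ) (σ : Dens (Wire d)) :
    Dens.run (C.verifiers.prep n) (Dens.run (P.prep n) σ) =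
      Dens.run (P.prep n) (Dens.run (C.verifiers.prep n) σ) := by
  refine Dens.run_comm (C.verifiers.prep_mem n) (P.prep_mem n) ?_ σ
  rintro w ⟨_, _, -, rfl⟩ ⟨_, _, -, h⟩
  cases h

theorem honest_admissible (n : ℕ) {q : PartyEvent d → Bool} (b : Bool) :
    ∀ e ∈ ((C.prover (p.point b)).events n).filter q,
      e.who = 0 ∧ (p.interface n).Admissible e.time e.op :=
  fun _ he => p.admissible (List.mem_filter.1 he).1

theorem commitRounds_sorted (n : ℕ) : (p.commitRounds n).Pairwise fun a b => a.time ≤ b.time :=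
  (p.interface n).rounds_sorted (p.commit_schedule_sorted n)

theorem revealRounds_sorted (n : ℕ) : (p.revealRounds n).Pairwise fun a b => a.time ≤ b.time :=
  (p.interface n).rounds_sorted (p.reveal_schedule_sorted n)

/-- The Commit phase as an interaction of the verifiers with a prover that simulates the sender. -/
theorem map_playRounds_commit (S : SenderStrategy) (n : ℕ) (r : ℕ ⊕ ℕ ↪ ℕ × ℕ) :
    (playRounds S (p.commitR n)).map (QOp.map ((p.interface n).emb r)) =
      (S.move 0).map (QOp.map ((p.interface n).emb r)) ++ (C.verifiers.prep n ++
        (interact (C.commit.events n)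
          (proverEvents S ((p.interface n).emb r) 1 (p.commitRounds n)) ++
          (p.dump n).map (QOp.map ((p.interface n).emb r)))) := by
  have := map_cutRounds (post := p.dump n) (pre := (C.verifiers.prep n).map (p.interface n).dec) S
    ((p.interface n).emb r) (fun e he => (p.interface n).map_dec r (p.actsOn_commit he))
    (C.commit.isProgram n).sorted (p.commitRounds_sorted n) 0
  rw [p.map_dec_prep] at this
  exact this

/-- The Reveal phase as an interaction of the verifiers with a prover that simulates the sender. -/
theorem map_playRounds_reveal (S : SenderStrategy) (b : Bool) (n : ℕ) (r : ℕ ⊕ ℕ ↪ ℕ × ℕ) :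
    (playRounds S (p.revealR b n)).map (QOp.map ((p.interface n).emb r)) =
      (S.move 0).map (QOp.map ((p.interface n).emb r)) ++
        ((p.dump n).reverse.map (QOp.map ((p.interface n).emb r)) ++
          (interact (C.reveal (p.point b) n)
            (proverEvents S ((p.interface n).emb r) 1 (p.revealRounds n)) ++
            C.verdict (p.point b) n)) := by
  have := map_cutRounds (pre := (p.dump n).reverse)
    (post := (C.verdict (p.point b) n).map (p.interface n).dec) (l := C.reveal (p.point b) n) S
    ((p.interface n).emb r) (fun e he => (p.interface n).map_dec r (p.actsOn_reveal he))
    (C.reveal_isProgram _ n).sorted (p.revealRounds_sorted n) 0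
  rw [p.map_dec_verdict] at this
  exact this

theorem run_honest_commit (b : Bool) (n : ℕ) :
    Dens.run (interact (C.commit.events n) (proverEvents (p.senderC b n)
      ((p.interface n).emb Interface.honestReg) 1 (p.commitRounds n)))
        (Dens.run (C.verifiers.prep n)
          (Dens.run ((C.prover (p.point b)).prep n) Dens.vacuum)) = p.honestState b n ∧
      (p.interface n).Faithful (p.honestState b n) := by
  have h := (p.interface n).run_honest (S := p.senderC b n) (b := b)
    (p := fun b => eventsUntil C.tFinal ((C.prover (p.point b)).events n))
    (fun b => (isProgram_until ((C.prover (p.point b)).isProgram n) C.tFinal).sorted)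
    (fun b => p.honest_admissible n b) (C.commit.isProgram n)
    (fun e he => p.actsOn_commit he) (init := p.senderPrep b n) rfl (p.faithful_prep b n)
  have e : Dens.run (interact (C.commit.events n)
      (eventsUntil C.tFinal ((C.prover (p.point b)).events n)))
        (Dens.run (C.verifiers.prep n)
          (Dens.run ((C.prover (p.point b)).prep n) Dens.vacuum)) = p.honestState b n := by
    rw [prep_comm, honestState, C.stateAt_commit]
  exact ⟨h.1.trans e, e ▸ h.2⟩

theorem run_honest_reveal (b : Bool) (n : ℕ) :
    Dens.run (interact (C.reveal (p.point b) n) (proverEvents (p.senderR b n)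
      ((p.interface n).emb Interface.honestReg) 1 (p.revealRounds n))) (p.honestState b n) =
      Dens.run (interact (C.reveal (p.point b) n)
        (eventsAfter C.tFinal ((C.prover (p.point b)).events n))) (p.honestState b n) :=
  ((p.interface n).run_honest (S := p.senderR b n) (b := b)
    (p := fun b => eventsAfter C.tFinal ((C.prover (p.point b)).events n))
    (fun b => (isProgram_after ((C.prover (p.point b)).isProgram n) C.tFinal).sorted)
    (fun b => p.honest_admissible n b) (C.reveal_isProgram _ n)
    (fun _ he => p.actsOn_reveal he) (init := []) rfl (p.run_honest_commit b n).2).1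

/-- The honest world state lies in the image of the encoding. The two-party run therefore ends in
its preimage, up to the signals sent away. -/
theorem exists_honest (b : Bool) (n : ℕ) :
    ∃ ρ, p.honestState b n = Dens.extend ((p.interface n).emb Interface.honestReg) ρ ∧
      Dens.run (playRounds (p.senderC b n) (p.commitR n)) Dens.vacuum =
        Dens.run (p.dump n) ρ := by
  obtain ⟨h, ⟨ρ, hρ, -⟩, -⟩ := p.run_honest_commit b n
  refine ⟨ρ, hρ, ?_⟩
  have key : Dens.extend ((p.interface n).emb Interface.honestReg)
      (Dens.run (playRounds (p.senderC b n) (p.commitR n)) Dens.vacuum) =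
      Dens.extend ((p.interface n).emb Interface.honestReg) (Dens.run (p.dump n) ρ) := by
    rw [← Dens.run_map_extend, ← Dens.run_map_extend, Dens.run_vacuum_extend,
      p.map_playRounds_commit, show (p.senderC b n).move 0 = p.senderPrep b n from rfl,
      p.map_senderPrep, Dens.run_append, Dens.run_append, Dens.run_append, h, hρ]
  have := congrArg (Dens.restrict ((p.interface n).emb Interface.honestReg)) key
  rwa [Dens.restrict_extend_self, Dens.restrict_extend_self] at this

theorem diag_run {W : Type} {L : List (QOp W)} {q : W} (h : ∀ o ∈ L, q ∉ o.wires) {ρ : Dens W}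
    (hρ : Dens.Diag q ρ) : Dens.Diag q (Dens.run L ρ) := by
  induction L generalizing ρ with
  | nil => exact hρ
  | cons o L ih =>
    exact ih (fun o ho => h o (List.mem_cons_of_mem _ ho))
      (hρ.apply_of_not_mem (h o List.mem_cons_self))

theorem actsOn_sender (n N : ℕ) {o : QOp CommWire} (ho : o.ActsOn SenderSide) :
    (o.map ((p.interface n).emb (Interface.soloReg N))).ActsOn
      fun w => ∃ j, w = Wire.mem Side.prover 0 j := by
  refine QOp.actsOn_map.2 (ho.mono fun w hw => ?_)
  match w, hw with
  | sender j, _ => exact ⟨_, rfl⟩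
  | message j, _ => exact ⟨_, rfl⟩

/-- A single prover on the worldline can simulate the sender. -/
theorem isProgram_proverEvents (S : SenderStrategy) (n N : ℕ) {D : List Round}
    (hD : D.Pairwise fun a b => a.time ≤ b.time)
    (h : ∀ δ ∈ D, ∀ o ∈ δ.iface, (o.map ((p.interface n).emb (Interface.soloReg N))).LocalAt
      Side.prover 0 (p.track δ.time, δ.time)) (k : ℕ) {loc : ℕ → ℝ → Space d}
    (hloc : loc 0 = p.track) :
    IsProgram Side.prover 1 loc
      (proverEvents S ((p.interface n).emb (Interface.soloReg N)) k D) := by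
  refine ⟨proverEvents_sorted hD, fun e he => ?_⟩
  obtain ⟨δ, hδ, hwho, htime, o, hop, ho⟩ := mem_proverEvents he
  rw [hwho, htime, hop, hloc]
  refine ⟨one_pos, ?_⟩
  rcases ho with ⟨r, ho⟩ | ho
  · refine Or.inl ((p.actsOn_sender n N (S.move_local r o ho)).mono ?_)
    rintro w ⟨j, rfl⟩
    exact ⟨rfl, rfl⟩
  · exact h δ hδ o ho

/-- Every round stems from an event of one of the honest provers, and these are on the common
worldline. -/
theorem localAt_commitRounds (n N : ℕ) : ∀ δ ∈ p.commitRounds n, ∀ o ∈ δ.iface,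
    (o.map ((p.interface n).emb (Interface.soloReg N))).LocalAt
      Side.prover 0 (p.track δ.time, δ.time) := by
  intro δ hδ o ho
  obtain ⟨x, hx, hδ⟩ := List.mem_flatMap.1 hδ
  exact (p.interface n).mem_rounds_localAt (p.honest_admissible n x.1 _ (mem_schedule.1 hx)).2
    hδ N ho

theorem localAt_revealRounds (n N : ℕ) : ∀ δ ∈ p.revealRounds n, ∀ o ∈ δ.iface,
    (o.map ((p.interface n).emb (Interface.soloReg N))).LocalAt
      Side.prover 0 (p.track δ.time, δ.time) := by
  intro δ hδ o ho
  obtain ⟨x, hx, hδ⟩ := List.mem_flatMap.1 hδ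
  exact (p.interface n).mem_rounds_localAt (p.honest_admissible n x.1 _ (mem_schedule.1 hx)).2
    hδ N ho

theorem isProgram_commit (S : SenderStrategy) (n N k : ℕ) {loc : ℕ → ℝ → Space d}
    (hloc : loc 0 = p.track) : IsProgram Side.prover 1 loc
      (proverEvents S ((p.interface n).emb (Interface.soloReg N)) k (p.commitRounds n)) :=
  p.isProgram_proverEvents S n N (p.commitRounds_sorted n) (p.localAt_commitRounds n N) k hloc

theorem actsOn_dump_not_vmem {n : ℕ} {o : QOp CommWire} (ho : o ∈ p.dump n) :
    o.ActsOn fun w => w ∉ Set.range vmemEmb := by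
  obtain ⟨k, -, hw, -⟩ := mem_exchange ho
  rw [QOp.actsOn_iff, hw]
  rintro w hw ⟨q, rfl⟩
  change vmem q ∈ _ at hw
  simp [vmem, store, slot] at hw

/-- The final measurement of the receiver has no effect, because the simulated verifiers have made
it already. -/
theorem commitState_eq (S : SenderStrategy) (n : ℕ) : p.bitCommitment.commitState S n =
    Dens.run (playRounds S (p.commitR n)) Dens.vacuum := by
  refine Dens.run_measure_eq fun o ho => ?_
  obtain ⟨j, hj, rfl⟩ := List.mem_map.1 ho
  obtain ⟨q, hq, rfl⟩ := Finset.mem_map.1 (Finset.mem_toList.1 hj)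
  -- Any sender can be read as a lone prover, so the fact that the verifiers' classical part is
  -- classical after Commit applies.
  refine ⟨_, rfl, Dens.Diag.of_extend (f := (p.interface n).emb (Interface.soloReg 0)) ?_⟩
  change Dens.Diag (((p.interface n).emb (Interface.soloReg 0)) (vmem q))
    (Dens.extend _ (Dens.run (playRounds S (p.commitR n)) Dens.vacuum))
  rw [← Dens.run_map_extend, p.map_playRounds_commit, Dens.run_append, Dens.run_append,
    Dens.run_append, Interface.emb_vmem]
  refine diag_run (fun o ho hmem => ?_)
    (C.diag_commit n (p.isProgram_commit S n 0 1 (loc := fun _ => p.track) rfl) hq _)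
  obtain ⟨o', ho', rfl⟩ := List.mem_map.1 ho
  rw [QOp.wires_map] at hmem
  obtain ⟨w, hw, hwq⟩ := List.mem_map.1 hmem
  rw [← (p.interface n).emb_vmem (Interface.soloReg 0)] at hwq
  exact QOp.actsOn_iff.1 (p.actsOn_dump_not_vmem ho') w hw
    ⟨q, (((p.interface n).emb _).injective hwq).symm⟩

theorem emb_accept (n : ℕ) (r : ℕ ⊕ ℕ ↪ ℕ × ℕ) :
    (p.interface n).emb r (receiver 0) = acceptWire d := by
  rw [← vmemIndex_zero]
  exact (p.interface n).emb_vmem r (0, 0)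

/-- The exchange at the end of Commit and its inverse at the start of Reveal cancel, because the
honest sender does nothing in between. What remains is the honest interaction in spacetime. -/
theorem revealProb_honest (b : Bool) (n : ℕ) :
    p.bitCommitment.revealProb b (p.senderR b n) n
      (p.bitCommitment.commitState (p.senderC b n) n) =
        C.acceptProb (p.point b) (C.prover (p.point b)) n := by
  obtain ⟨ρ, hρ, hrun⟩ := p.exists_honest b n
  rw [p.commitState_eq, hrun, QuantumBitCommitment.revealProb,
    C.acceptProb_eq, ← p.emb_accept n Interface.honestReg,
    ← Dens.probOne_extend ((p.interface n).emb Interface.honestReg) (receiver 0)]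
  congr 1
  rw [← Dens.run_map_extend, show p.bitCommitment.revealR b n = p.revealR b n from rfl,
    p.map_playRounds_reveal, show (p.senderR b n).move 0 = [] from rfl, List.map_nil,
    List.nil_append, Dens.run_append, Dens.run_append, Dens.run_map_extend, dump,
    Dens.run_reverse_run (exchange_involutive _), ← hρ, p.run_honest_reveal]
  rfl

theorem completeness {c : ℕ → ℝ} (h : C.HasCompletenessError c) :
    p.bitCommitment.HasCompletenessError c := by
  intro n b
  refine (h n _ (p.mem b)).trans_eq (p.revealProb_honest b n).symm

end PositionCommitment.Pair

/-! ## Hiding -/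

namespace Dens

variable {W V : Type}

theorem SupportedOn.restrict {A : W → Prop} (f : V ↪ W) {ρ : Dens W} (h : SupportedOn A ρ) :
    SupportedOn (fun q => A (f q)) (Dens.restrict f ρ) := by
  classical
  refine support_induction (L := Dens.restrict f)
    (P := fun c c' => ∀ w, ¬ A w → c w = false ∧ c' w = false)
    (Q := fun c c' => ∀ q, ¬ A (f q) → c q = false ∧ c' q = false) (fun c c' hc dd hdd => ?_) h
  rw [restrict_single] at hdd
  split_ifs at hdd
  · rw [Finset.mem_singleton.1 (Finsupp.support_single_subset hdd)]
    exact fun q hq => hc (f q) hq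
  · simp at hdd

theorem SupportedOn.extend {A : V → Prop} {B : W → Prop} (f : V ↪ W) (hf : ∀ q, A q → B (f q))
    {ρ : Dens V} (h : SupportedOn A ρ) : SupportedOn B (Dens.extend f ρ) := by
  refine support_induction (L := Dens.extend f)
    (P := fun c c' => ∀ w, ¬ A w → c w = false ∧ c' w = false)
    (Q := fun c c' => ∀ q, ¬ B q → c q = false ∧ c' q = false) (fun c c' hc dd hdd => ?_) h
  rw [extend_single] at hdd
  rw [Finset.mem_singleton.1 (Finsupp.support_single_subset hdd)]
  intro w hw
  by_cases hr : ∃ q, f q = w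
  · obtain ⟨q, rfl⟩ := hr
    simp only [f.injective.extend_apply]
    exact hc q fun hq => hw (hf q hq)
  · simp only [Function.extend_apply' _ _ _ hr, and_self]

end Dens

section Indist

variable {ι κ : Type}

theorem CompIndist.symm {X Y : ℕ → Dens ι} (h : CompIndist X Y) : CompIndist Y X := by
  intro D hD
  simpa only [abs_sub_comm] using h D hD

theorem CompIndist.trans {X Y Z : ℕ → Dens ι} (h : CompIndist X Y) (h' : CompIndist Y Z) :
    CompIndist X Z := by
  intro D hD
  refine ((h D hD).add (h' D hD)).trans_abs_le fun n => ?_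
  simp only [Pi.add_apply]
  rw [abs_abs]
  exact (abs_sub_le _ _ _).trans (le_abs_self _)

/-- Indistinguishability does not depend on the names of the qubits. -/
theorem CompIndist.extend {X Y : ℕ → Dens ι} (h : CompIndist X Y) (f : ι ↪ κ) (g : κ ⊕ ℕ ↪ ι ⊕ ℕ)
    (hf : ∀ q, g (Sum.inl (f q)) = Sum.inl q) (h0 : g (Sum.inr 0) = Sum.inr 0) :
    CompIndist (fun n => Dens.extend f (X n)) fun n => Dens.extend f (Y n) := by
  have key : ∀ (D : List (QOp (κ ⊕ ℕ))) (ρ : Dens ι),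
      distinguisherProb D (Dens.extend f ρ) = distinguisherProb (D.map (QOp.map g)) ρ := by
    intro D ρ
    have e : (f.trans Function.Embedding.inl).trans g = (Function.Embedding.inl : ι ↪ ι ⊕ ℕ) := by
      ext q
      exact hf q
    have e1 : Dens.extend (Sum.inl : κ → κ ⊕ ℕ) (Dens.extend f ρ) =
        Dens.extend (f.trans Function.Embedding.inl) ρ :=
      Dens.extend_extend (Function.Embedding.inl : κ ↪ κ ⊕ ℕ) f ρ
    have e2 : Dens.extend (Sum.inl : ι → ι ⊕ ℕ) ρ =
        Dens.extend g (Dens.extend (f.trans Function.Embedding.inl) ρ) := by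
      rw [Dens.extend_extend, e]; rfl
    rw [distinguisherProb, distinguisherProb, e1, e2, Dens.run_map_extend, ← h0,
      Dens.probOne_extend]
  intro D hD
  simp only [key]
  exact h _ (hD.map fun _ => g)

end Indist

namespace PositionCommitment.Pair

open CommWire

variable {d : ℕ} {C : PositionCommitment d} (p : C.Pair)

/-- This locates the zeros of the honest state: the memory of the absent prover 1 and broadcasts
from after `tFinal`. -/
theorem supportedOn_honestState (b : Bool) (n : ℕ) :
    Dens.SupportedOn (Wire.Reachable 1 C.tFinal) (p.honestState b n) := by
  rw [honestState, C.stateAt_commit]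
  refine Dens.SupportedOn.run ?_ (Dens.SupportedOn.run ?_ (Dens.SupportedOn.run ?_
    (Dens.supportedOn_vacuum _)))
  · have := actsOn_interact (τ := C.tFinal) (C.commit.isProgram n)
      (isProgram_until ((C.prover (p.point b)).isProgram n) C.tFinal) (C.commit_time_le n)
      fun e he => (mem_eventsUntil.1 he).2
    rwa [p.prover_size b] at this
  · intro o ho
    refine ((C.prover (p.point b)).prep_mem n o ho).mono fun w hw =>
      inMemory_reachable (fun _ => (p.prover_size b).le) hw
  · intro o ho
    exact (C.verifiers.prep_mem n o ho).mono fun w hw =>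
      inMemory_reachable (fun h => by cases h) hw

/-- At the end of an honest Commit phase the receiver has the memories of the verifiers and nothing
else. -/
theorem commitView_honest (b : Bool) (n : ℕ) :
    p.bitCommitment.commitView (p.senderC b n) n =
      Dens.extend vmemIndex (viewAt C.commit (C.prover (p.point b)) n C.tFinal) := by
  obtain ⟨ρ, hρ, hrun⟩ := p.exists_honest b n
  have hview : Dens.restrict vmemIndex (p.bitCommitment.commitView (p.senderC b n) n) =
      viewAt C.commit (C.prover (p.point b)) n C.tFinal := by
    rw [QuantumBitCommitment.commitView, p.commitState_eq, hrun]
    change Dens.restrict vmemIndex (Dens.restrict receiverEmb _) = _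
    rw [← Dens.restrict_trans, vmemIndex_trans,
      Dens.restrict_run_of_disjoint fun o ho => p.actsOn_dump_not_vmem ho, viewAt]
    change _ = Dens.restrict (verifierEmb d) (p.honestState b n)
    rw [hρ, ← (p.interface n).vmemEmb_trans_emb Interface.honestReg, Dens.restrict_extend]
  rw [← hview, Dens.extend_restrict]
  rw [QuantumBitCommitment.commitView, p.commitState_eq, hrun]
  obtain ⟨π, hπ, hπ1, hπ2, hπ3⟩ := exists_perm_exchange (p.underway_nodup n)
  have hs : Dens.SupportedOn (fun w => Wire.Reachable 1 C.tFinal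
      ((p.interface n).emb Interface.honestReg w)) ρ :=
    Dens.SupportedOn.of_extend (hρ ▸ p.supportedOn_honestState b n)
  -- An exchanged store qubit now holds its message slot, which lies with the absent prover and is
  -- |0⟩; a store qubit that was not exchanged is unreachable and |0⟩ as well.
  have hs' : Dens.SupportedOn (fun w => ∀ k, w ≠ store k) (Dens.run (p.dump n) ρ) := by
    rw [dump, hπ]
    refine hs.extend π fun w hw k hk => ?_
    by_cases hu : k ∈ p.underway n
    · have : w = slot k := π.injective (hk.trans (hπ2 k hu).symm)
      rw [this] at hw
      exact lt_irrefl 1 hw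
    · have hfix : π (store k) = store k := hπ3 _ fun j hj =>
        ⟨fun h => hu (store_injective h ▸ hj), store_ne_slot _ _⟩
      have : w = store k := π.injective (hk.trans hfix.symm)
      rw [this, Interface.emb_store] at hw
      refine hu (p.mem_underway.2 ⟨?_, hw⟩)
      by_contra hlt
      rw [Interface.storeWire_of_le _ (not_lt.1 hlt)] at hw
      have : ‖(0 : Space d)‖ = 1 := hw
      simp at this
  have h := hs'.restrict receiverEmb
  intro cc hcc w hw
  refine h cc hcc w fun hk => hw ?_
  obtain ⟨v, rfl⟩ := recvEquiv.surjective w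
  rcases v with q | k
  · exact ⟨q, rfl⟩
  · exact absurd rfl (hk k)

/-- The receiver's qubits and those of a distinguisher, as qubits of a distinguisher for the
verifiers. -/
def workEmb : ℕ ⊕ ℕ ↪ (ℕ × ℕ) ⊕ ℕ :=
  -- The receiver's store is all zeros, so it can be taken from fresh work qubits: odd ones for the
  -- store, even ones for the distinguisher, whose output stays at 0.
  ⟨Sum.elim (fun m => (recvEquiv.symm m).map id fun k => 2 * k + 1) fun k => Sum.inr (2 * k), by
    refine Function.Injective.sumElim ?_ (fun i j h => by simpa using h) fun m k h => ?_
    · refine (Function.Injective.sumMap Function.injective_id fun i j h => ?_).comp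
        recvEquiv.symm.injective
      simpa using h
    · have h' : (recvEquiv.symm m).map id (fun k => 2 * k + 1) = Sum.inr (2 * k) := h
      generalize recvEquiv.symm m = v at h'
      rcases v with q | j
      · exact Sum.inl_ne_inr h'
      · have : 2 * j + 1 = 2 * k := Sum.inr.inj h'
        omega⟩

/-- The simulator at time `tFinal` does not depend on the point, so both views are close to the same
family and hence to each other. Renaming and padding with zeros carries this over to the receiver.
-/
theorem isHiding (h : C.IsHiding) : p.bitCommitment.IsHiding := by
  obtain ⟨Sim, -, hSim⟩ := h
  have hb : ∀ b, CompIndist (fun n => simOutput (Sim n C.tFinal))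
      fun n => viewAt C.commit (C.prover (p.point b)) n C.tFinal := fun b =>
    hSim _ (p.mem b) _ C.tInit_le_tFinal le_rfl
  have := ((hb false).symm.trans (hb true)).extend vmemIndex workEmb
    (fun q => by
    change (recvEquiv.symm (recvEquiv (Sum.inl q))).map id _ = _
    rw [Equiv.symm_apply_apply]
    rfl) rfl
  unfold QuantumBitCommitment.IsHiding
  simpa only [show p.bitCommitment.senderC = p.senderC from rfl, p.commitView_honest] using this

end PositionCommitment.Pair

/-! ## Binding -/

namespace Dens

variable {W V : Type}

theorem project_restrict (f : V ↪ W) (K z : Finset V) (ρ : Dens W) :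
    project K z (restrict f ρ) = restrict f (project (K.map f) (z.map f) ρ) := by
  rw [project_eq_filt, project_eq_filt, ← restrict_filt]
  congr 2
  ext c
  simp [Finset.mem_map]

/-- Properties of the outcome can be checked on the reduced state. -/
theorem probGood_restrict_le (f : V ↪ W) (K : Finset V) {G : Set (Conf W)} {ρ : Dens W}
    (hρ : ρ ∈ Cone G) {Good : Dens V → Prop} {Good' : Dens W → Prop}
    (h : ∀ z, Good ((trace (project (K.map f) z ρ))⁻¹ • restrict f (project (K.map f) z ρ)) →
      Good' ((trace (project (K.map f) z ρ))⁻¹ • project (K.map f) z ρ)) :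
    probGood K (restrict f ρ) Good ≤ probGood (K.map f) ρ Good' := by
  classical
  have hnn : ∀ z, 0 ≤ (trace (project (K.map f) z ρ)).re := by
    intro z
    rw [trace_eq, project_eq_filt]
    exact (Complex.nonneg_iff.1 (weight_nonneg _ (filt_mem_cone _ hρ))).1
  unfold probGood
  simp only [project_restrict, trace_restrict]
  -- Distinct outcomes for the verifiers correspond to distinct outcomes for the receiver, so the
  -- good ones form part of a sum of nonnegative terms.
  refine le_trans (le_of_eq ?_) (Finset.sum_le_sum_of_subset_of_nonneg
    (s := (K.powerset.filter fun z => Good ((trace (project (K.map f) (z.map f) ρ))⁻¹ •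
      restrict f (project (K.map f) (z.map f) ρ))).map (Finset.mapEmbedding f).toEmbedding)
    (fun z hz => ?_) fun z _ _ => hnn z)
  · rw [Finset.sum_map]
    rfl
  · obtain ⟨y, hy, rfl⟩ := Finset.mem_map.1 hz
    rw [Finset.mem_filter, Finset.mem_powerset] at hy ⊢
    exact ⟨Finset.map_subset_map.2 hy.1, h _ hy.2⟩

end Dens

theorem exists_lt_forall_mem (L : List ℝ) : ∃ t, ∀ x ∈ L, t < x := by
  induction L with
  | nil => exact ⟨0, by simp⟩
  | cons y L ih =>
    obtain ⟨t, ht⟩ := ih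
    refine ⟨min t (y - 1), fun x hx => ?_⟩
    rcases List.mem_cons.1 hx with rfl | hx
    · exact (min_le_right _ _).trans_lt (sub_one_lt x)
    · exact (min_le_left _ _).trans_lt (ht x hx)

theorem exists_memory_bound {d : ℕ} (L : List (Wire d)) :
    ∃ N, ∀ s i j, Wire.mem s i j ∈ L → j < N := by
  induction L with
  | nil => exact ⟨0, by simp⟩
  | cons w L ih =>
    obtain ⟨N, hN⟩ := ih
    refine ⟨N + (match w with | Wire.mem _ _ j => j + 1 | _ => 0), fun s i j h => ?_⟩
    rcases List.mem_cons.1 h with rfl | h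
    · dsimp only
      omega
    · exact (hN s i j h).trans_le (Nat.le_add_right _ _)

namespace PositionCommitment.Pair

open CommWire

variable {d : ℕ} {C : PositionCommitment d} (p : C.Pair)

theorem commit_rounds_time_le (n : ℕ) : ∀ δ ∈ p.commitRounds n, δ.time ≤ C.tFinal := by
  intro δ hδ
  obtain ⟨x, hx, hδ⟩ := List.mem_flatMap.1 hδ
  rw [Interface.mem_rounds_time _ hδ]
  exact (mem_eventsUntil.1 (mem_schedule.1 hx)).2

theorem lt_reveal_rounds_time (n : ℕ) : ∀ δ ∈ p.revealRounds n, C.tFinal < δ.time := by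
  intro δ hδ
  obtain ⟨x, hx, hδ⟩ := List.mem_flatMap.1 hδ
  rw [Interface.mem_rounds_time _ hδ]
  exact (mem_eventsAfter.1 (mem_schedule.1 hx)).2

theorem verifierEmb_eq (n : ℕ) (r : ℕ ⊕ ℕ ↪ ℕ × ℕ) :
    verifierEmb d = (vmemIndex.trans receiverEmb).trans ((p.interface n).emb r) := by
  rw [vmemIndex_trans, Interface.vmemEmb_trans_emb]

theorem map_dump_disjoint (n : ℕ) (r : ℕ ⊕ ℕ ↪ ℕ × ℕ) :
    ∀ o ∈ (p.dump n).map (QOp.map ((p.interface n).emb r)),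
      o.ActsOn fun w => w ∉ Set.range (verifierEmb d) := by
  intro o ho
  obtain ⟨o', ho', rfl⟩ := List.mem_map.1 ho
  refine QOp.actsOn_map.2 ((p.actsOn_dump_not_vmem ho').mono fun w hw => ?_)
  rintro ⟨q, hq⟩
  rw [← (p.interface n).vmemEmb_trans_emb r] at hq
  exact hw ⟨q, ((p.interface n).emb r).injective hq⟩

theorem map_sender_disjoint (n N : ℕ) {L : List (QOp CommWire)}
    (h : ∀ o ∈ L, o.ActsOn SenderSide) :
    ∀ o ∈ L.map (QOp.map ((p.interface n).emb (Interface.soloReg N))),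
      o.ActsOn fun w => w ∉ Set.range (verifierEmb d) := by
  intro o ho
  obtain ⟨o', ho', rfl⟩ := List.mem_map.1 ho
  refine (p.actsOn_sender n N (h o' ho')).mono ?_
  rintro w ⟨j, rfl⟩ ⟨q, hq⟩
  cases hq

/-- A prover on the worldline that simulates a given sender leads to the same commitment state. -/
theorem exists_simulation (S : SenderStrategy) (n : ℕ) {P : Coalition d} (hP : P.IsLone p.track) :
    ∃ P' : Coalition d, P'.size = P.size ∧ P'.loc = P.loc ∧ P'.prep = P.prep ∧
      viewAt C.commit P' n C.tFinal =
        Dens.restrict vmemIndex (p.bitCommitment.commitView S n) := by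
  -- The simulated sender lives above all qubits used in preparing the coalition's given shared
  -- state.
  obtain ⟨N, hN⟩ := exists_memory_bound ((P.prep n).flatMap QOp.wires)
  obtain ⟨t, ht⟩ := exists_lt_forall_mem (C.tFinal :: ((p.commitRounds n).map Round.time ++
    (C.commit.events n).map PartyEvent.time))
  have ht0 : t < C.tFinal := ht _ List.mem_cons_self
  have ht1 : ∀ δ ∈ p.commitRounds n, t < δ.time := fun δ hδ => ht _ (List.mem_cons_of_mem _
    (List.mem_append_left _ (List.mem_map_of_mem hδ)))
  have ht2 : ∀ e ∈ C.commit.events n, t < e.time := fun e he => ht _ (List.mem_cons_of_mem _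
    (List.mem_append_right _ (List.mem_map_of_mem he)))
  set Φ := (p.interface n).emb (Interface.soloReg N) with hΦ
  -- The sender's move 0 precedes everything the verifiers do. It gets a round of its own at a time
  -- t strictly before all their Commit events, strictly because verifiers go first at equal times.
  set D : List Round := ⟨t, [], fun _ => []⟩ :: p.commitRounds n with hD
  have hprog : IsProgram Side.prover P.size P.loc (proverEvents S Φ 0 D) := by
    rw [hP.1]
    refine p.isProgram_proverEvents S n N ?_ ?_ 0 hP.2
    · exact List.pairwise_cons.2 ⟨fun δ hδ => (ht1 δ hδ).le, p.commitRounds_sorted n⟩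
    · intro δ hδ o ho
      rcases List.mem_cons.1 hδ with rfl | hδ
      · simp at ho
      · exact p.localAt_commitRounds n N δ hδ o ho
  have hE : eventsUntil C.tFinal (proverEvents S Φ 0 D) = proverEvents S Φ 0 D := by
    refine eventsUntil_eq_self fun e he => ?_
    obtain ⟨δ, hδ, -, h, -⟩ := mem_proverEvents he
    rw [h]
    rcases List.mem_cons.1 hδ with rfl | hδ
    · exact ht0.le
    · exact p.commit_rounds_time_le n δ hδ
  have hint : interact (C.commit.events n) (proverEvents S Φ 0 D) =
      (S.move 0).map (QOp.map Φ) ++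
        interact (C.commit.events n) (proverEvents S Φ 1 (p.commitRounds n)) := by
    rw [hD, proverEvents, interact_append_right, List.append_nil, List.map_map]
    · rfl
    · intro a ha b hb
      obtain ⟨o, -, rfl⟩ := List.mem_map.1 hb
      exact ht2 a ha
  have hmap := p.map_playRounds_commit S n (Interface.soloReg N)
  rw [← hΦ] at hmap
  have hrange : ∀ o ∈ (playRounds S (p.commitR n)).map (QOp.map Φ),
      o.ActsOn (· ∈ Set.range Φ) := by
    intro o ho
    obtain ⟨o', -, rfl⟩ := List.mem_map.1 ho
    exact QOp.actsOn_map.2 (QOp.actsOn_iff.2 fun w _ => ⟨w, rfl⟩)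
  rw [hmap] at hrange
  have hprep : ∀ o ∈ P.prep n, o.ActsOn fun w => ∃ j < N, w = Wire.mem Side.prover 0 j := by
    intro o ho
    refine QOp.actsOn_iff.2 fun w hw => ?_
    obtain ⟨i, j, hi, rfl⟩ := QOp.actsOn_iff.1 (P.prep_mem n o ho) w hw
    rw [hP.1, Nat.lt_one_iff] at hi
    exact ⟨j, hN _ _ _ (List.mem_flatMap.2 ⟨o, ho, hw⟩), by rw [hi]⟩
  have hdisj : ∀ w, w ∈ Set.range Φ → ¬ ∃ j < N, w = Wire.mem Side.prover 0 j := by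
    rintro w ⟨v, rfl⟩ ⟨j, hj, h⟩
    cases v with
    | receiver m =>
      obtain ⟨u, rfl⟩ := recvEquiv.surjective m
      rcases u with q | k
      · rw [hΦ, show receiver (recvEquiv (Sum.inl q)) = vmem q from rfl, Interface.emb_vmem] at h
        cases h
      · rw [hΦ, show receiver (recvEquiv (Sum.inr k)) = store k from rfl, Interface.emb_store] at h
        exact Interface.storeWire_ne_mem _ _ _ _ _ h
    | sender m =>
      have : N + 2 * m = j := (Wire.mem.inj h).2.2
      omega
    | message m =>
      have : N + 2 * m + 1 = j := (Wire.mem.inj h).2.2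
      omega
  refine ⟨{ P with events := fun _ => proverEvents S Φ 0 D, isProgram := fun _ => hprog },
    rfl, rfl, rfl, ?_⟩
  rw [viewAt, C.stateAt_commit]
  dsimp only
  -- The prepared state sits on qubits that the simulation never touches, so its preparation can be
  -- postponed to the end and is then invisible to the verifiers.
  rw [hE, hint, Dens.run_comm (l' := P.prep n) (A := (· ∈ Set.range Φ)) ?_ hprep hdisj]
  · change Dens.restrict (verifierEmb d) _ = _
    rw [Dens.restrict_run_of_disjoint (l := P.prep n), Dens.run_append,
      Dens.run_comm (l := (S.move 0).map (QOp.map Φ)) (l' := C.verifiers.prep n)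
        (A := fun w => ∃ j, w = Wire.mem Side.prover 0 j) ?_ (C.verifiers.prep_mem n),
      -- Sending away the signals does not affect the verifiers' memories, so it may be appended to
      -- match the receiver's full Commit phase.
      ← Dens.restrict_run_of_disjoint (p.map_dump_disjoint n (Interface.soloReg N)), ← hΦ,
      ← Dens.run_append, ← Dens.run_append, ← Dens.run_append, ← hmap,
      ← Dens.run_vacuum_extend Φ, Dens.run_map_extend, p.verifierEmb_eq n (Interface.soloReg N),
      Dens.restrict_extend, Dens.restrict_trans, ← p.commitState_eq]
    · rfl
    · rintro w ⟨j, rfl⟩ ⟨_, _, -, h⟩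
      cases h
    · intro o ho
      obtain ⟨o', ho', rfl⟩ := List.mem_map.1 ho
      exact p.actsOn_sender n N (S.move_local 0 o' ho')
    · intro o ho
      refine (hprep o ho).mono ?_
      rintro w ⟨j, -, rfl⟩ ⟨q, hq⟩
      cases hq
  · intro o ho
    refine hrange o ?_
    rcases List.mem_append.1 ho with ho | ho
    · exact List.mem_append_left _ ho
    · exact List.mem_append_right _ (List.mem_append_right _ (List.mem_append_left _ ho))

theorem dump_reachable (n : ℕ) : ∀ o ∈ (p.dump n).map
    (QOp.map ((p.interface n).emb (Interface.soloReg 0))),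
    o.ActsOn (Wire.Reachable 1 C.tFinal) := by
  intro o ho
  obtain ⟨o', ho', rfl⟩ := List.mem_map.1 ho
  obtain ⟨k, hk, hw, -⟩ := mem_exchange ho'
  rw [QOp.actsOn_map, QOp.actsOn_iff, hw]
  intro w hw
  rcases List.mem_cons.1 hw with rfl | hw
  · rw [Interface.emb_store]
    exact (p.mem_underway.1 hk).2
  · rw [List.mem_singleton.1 hw]
    exact one_pos

theorem sender_reachable (n : ℕ) {L : List (QOp CommWire)} (h : ∀ o ∈ L, o.ActsOn SenderSide) :
    ∀ o ∈ L.map (QOp.map ((p.interface n).emb (Interface.soloReg 0))),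
      o.ActsOn (Wire.Reachable 1 C.tFinal) := by
  intro o ho
  obtain ⟨o', ho', rfl⟩ := List.mem_map.1 ho
  refine (p.actsOn_sender n 0 (h o' ho')).mono ?_
  rintro w ⟨j, rfl⟩
  exact one_pos

/-- Even a cheating sender fills the store only with signals that some party could have under way at
`tFinal`, since the receiver exchanges no others at the end. This makes the state accessible to
fresh coalitions. -/
theorem commitView_mem_cone (S : SenderStrategy) (n : ℕ) : p.bitCommitment.commitView S n ∈
    Dens.Cone (Dens.finConf fun q => Wire.Reachable 1 C.tFinal
      ((p.interface n).emb (Interface.soloReg 0) (receiverEmb q))) := by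
  rw [QuantumBitCommitment.commitView, p.commitState_eq]
  refine Dens.restrict_mem_cone (A := fun w => Wire.Reachable 1 C.tFinal
    ((p.interface n).emb (Interface.soloReg 0) w)) receiverEmb
    (Dens.run_mem_cone (fun o ho => QOp.actsOn_map.1 ?_) (Dens.vacuum_mem_cone _))
  have ho := List.mem_map_of_mem (f := QOp.map ((p.interface n).emb (Interface.soloReg 0))) ho
  rw [p.map_playRounds_commit] at ho
  rcases List.mem_append.1 ho with ho | ho
  · exact p.sender_reachable n (S.move_local 0) _ ho
  rcases List.mem_append.1 ho with ho | ho
  · exact (C.verifiers.prep_mem n _ ho).mono fun w hw =>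
      inMemory_reachable (fun h => by cases h) hw
  rcases List.mem_append.1 ho with ho | ho
  · refine actsOn_interact (C.commit.isProgram n)
      (p.isProgram_commit S n 0 1 (loc := fun _ => p.track) rfl) (C.commit_time_le n)
      (fun e he => ?_) _ ho
    obtain ⟨δ, hδ, -, h, -⟩ := mem_proverEvents he
    rw [h]
    exact p.commit_rounds_time_le n δ hδ
  · exact p.dump_reachable n _ ho

/-- A commitment state of the verifiers that cannot be opened to a point gives a state of the
receiver that cannot be opened to the bit. -/
theorem revealProb_eq_zero (b : Bool) (A : SenderStrategy) (n : ℕ) {Y : Dens ℕ}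
    (hY : Y ∈ Dens.Cone (Dens.finConf fun q => Wire.Reachable 1 C.tFinal
      ((p.interface n).emb (Interface.soloReg 0) (receiverEmb q))))
    (h : ∀ A, C.revealProb (p.point b) A n
      ((Dens.trace Y)⁻¹ • Dens.restrict vmemIndex Y) = 0) :
    p.bitCommitment.revealProb b A n (Dens.extend receiver ((Dens.trace Y)⁻¹ • Y)) = 0 := by
  set Φ := (p.interface n).emb (Interface.soloReg 0) with hΦ
  -- The world when the Reveal events start: the sender has made its first move and the signals have
  -- been taken back. The verifiers' memories are untouched, but the rest may be correlated with
  -- them, for the store may contain what a cheating sender left there.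
  set σ : Dens (Wire d) := Dens.run ((p.dump n).reverse.map (QOp.map Φ))
    (Dens.run ((A.move 0).map (QOp.map Φ)) (Dens.extend Φ (Dens.extend receiverEmb Y))) with hσ
  have hdump : ∀ {Q : QOp (Wire d) → Prop}, (∀ o ∈ (p.dump n).map (QOp.map Φ), Q o) →
      ∀ o ∈ (p.dump n).reverse.map (QOp.map Φ), Q o := by
    intro Q hQ o ho
    rw [List.map_reverse] at ho
    exact hQ o (List.mem_reverse.1 ho)
  have htr : Dens.trace σ = Dens.trace Y := by
    rw [hσ, Dens.trace_run, Dens.trace_run, Dens.trace_extend, Dens.trace_extend]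
  have hres : Dens.restrict (verifierMem d) σ = Dens.restrict vmemIndex Y := by
    change Dens.restrict (verifierEmb d) σ = _
    rw [hσ, Dens.restrict_run_of_disjoint (hdump (p.map_dump_disjoint n _)),
      Dens.restrict_run_of_disjoint (p.map_sender_disjoint n 0 (A.move_local 0)),
      p.verifierEmb_eq n (Interface.soloReg 0), Dens.restrict_extend, Dens.restrict_extend]
  have hcone : σ ∈ Dens.Cone (Dens.finConf (Wire.Reachable 1 C.tFinal)) := by
    refine Dens.run_mem_cone (hdump (p.dump_reachable n)) (Dens.run_mem_cone
      (p.sender_reachable n (A.move_local 0)) (Dens.extend_mem_cone Φ (fun _ h => h)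
        (Dens.extend_mem_cone (B := fun w => Wire.Reachable 1 C.tFinal (Φ w)) receiverEmb
          (fun _ h => h) hY)))
  have hz := C.accept_eq_zero (p.point b) n one_pos (l := proverEvents A Φ 1 (p.revealRounds n))
    (p.isProgram_proverEvents A n 0 (p.revealRounds_sorted n) (p.localAt_revealRounds n 0) 1
      (loc := fun _ => p.track) rfl) (fun e he => ?_) hcone fun A' => by
        rw [htr, hres]; exact h A'
  · rw [QuantumBitCommitment.revealProb, Dens.probOne_eq]
    change (Dens.weight _ (Dens.runHom (playRounds A (p.revealR b n))
      (Dens.extend receiverEmb ((Dens.trace Y)⁻¹ • Y)))).re = 0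
    -- By linearity the normalizing factor moves outside, leaving the vanishing acceptance weight of
    -- the lone prover.
    rw [map_smul, map_smul, map_smul, Dens.runHom_apply, ← Dens.weight_extend Φ, hΦ, p.emb_accept,
      ← Dens.run_map_extend, p.map_playRounds_reveal, ← hΦ, Dens.run_append, Dens.run_append,
      Dens.run_append, ← hσ, hz, smul_zero, Complex.zero_re]
  · obtain ⟨δ, hδ, -, h, -⟩ := mem_proverEvents he
    rw [h]
    exact p.lt_reveal_rounds_time n δ hδ

/-- A lone prover simulating the sender has the positions and shared state of the given member of 𝒞,
so it belongs to 𝒞 and position binding applies to it. Outcomes that bind it to a point bind the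
sender to a bit. -/
theorem hasStatisticalBinding {𝒞 : Set (Coalition d)} {s : ℕ → ℝ} (h𝒞 : NoComputationalLimits 𝒞)
    {P : Coalition d} (hP : P ∈ 𝒞) (hlone : P.IsLone p.track)
    (hbinding : C.HasPositionBinding 𝒞 s) : p.bitCommitment.HasStatisticalBinding s := by
  classical
  intro n S
  obtain ⟨P', h1, h2, h3, hview⟩ := p.exists_simulation S n hlone
  refine (hbinding P' (h𝒞 P hP P' h1 (fun i _ => by rw [h2]) h3) n).trans ?_
  rw [hview]
  refine Dens.probGood_restrict_le vmemIndex _ (p.commitView_mem_cone S n) fun z hz => ?_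
  obtain ⟨β, -, hβ⟩ := hz
  -- If the bound point is neither of the two, the bit `false` is taken; neither bit can be opened
  -- then, so the choice is immaterial.
  have hne : ∀ b', b' ≠ decide (β = p.point true) → p.point b' ≠ β := by
    rintro (_ | _) hb' rfl
    · exact hb' (by simp [p.ne])
    · exact hb' (by simp)
  refine ⟨decide (β = p.point true), fun b' hb' A => p.revealProb_eq_zero b' A n ?_
    (hβ _ (p.mem b') (hne b' hb'))⟩
  rw [Dens.project_eq_filt]
  exact Dens.filt_mem_cone _ (p.commitView_mem_cone S n)

end PositionCommitment.Pair

theorem mainTheorem4 (d : ℕ) (C : PositionCommitment d) (𝒞 : Set (Coalition d)) (c s : ℕ → ℝ)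
    (hcomplete : C.HasCompletenessError c)
    (hbinding : C.HasPositionBinding 𝒞 s)
    (hhiding : C.IsHiding) :
    (∀ α ∈ C.points, ∃ Q : PositionVerification d,
      Q.region = {α} ∧ Q.HasCompletenessError c ∧ Q.HasPositionSecurity 𝒞 s) ∧
    (NoComputationalLimits 𝒞 →
      ∀ α₀ ∈ C.points, ∀ α₁ ∈ C.points, α₀ ≠ α₁ → C.track α₀ = C.track α₁ →
      (∃ P ∈ 𝒞, P.IsLone (C.track α₀)) →
      ∃ B : QuantumBitCommitment,
        B.HasCompletenessError c ∧ B.HasStatisticalBinding s ∧ B.IsHiding) := by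
  refine ⟨fun α hα => C.exists_positionVerification hcomplete hbinding hα, ?_⟩
  rintro h𝒞 α₀ h₀ α₁ h₁ hne htrack ⟨P, hP, hlone⟩
  let p : C.Pair :=
    { point := fun b => bif b then α₁ else α₀
      mem := by rintro (_ | _) <;> assumption
      ne := hne
      track := C.track α₀
      track_eq := by rintro (_ | _) <;> [rfl; exact htrack.symm] }
  exact ⟨p.bitCommitment, p.completeness hcomplete, p.hasStatisticalBinding h𝒞 hP hlone hbinding,
    p.isHiding hhiding⟩
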